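/- **Setting.** Let $n\ge 1$, let $\Omega\subset\mathbb{R}^n$ be a bounded open set and $\Omega_2$ an open set with $\overline{\Omega_2}\subset\Omega$, both with boundary of class $C^3$, and put $\Omega_1=\Omega\setminus\overline{\Omega_2}$. Let $k_1,k_2>0$. Assume: (a) $b\in C^\infty(\Omega_1)\cap C^0(\overline{\Omega_1})$ is nonnegative and there is a positive distance between $\operatorname{supp} b$ and $\partial\Omega_2$; (b) $g\in L^1([0,\infty))\cap C^1([0,\infty))$ is positive and non-increasing, and with $k_0=\int_0^\infty g(s)\,ds$ one has $1-k_0\|b\|_{L^\infty(\Omega_1)}>0$. **Spaces.** Let $$\mathbb{H}^1_{\partial\Omega}=\{(u,v)\in H^1(\Omega_1)\times H^1(\Omega_2): u=0 \text{ on }\partial\Omega,\ u=v\text{ on }\partial\Omega_2\}$$ with inner product $k_1\int_{\Omega_1}(1-k_0b)\nabla u_1\cdot\nabla u_2\,dx+k_2\int_{\Omega_2}\nabla v_1\cdot\nabla v_2\,dx$, and let $\mathbb{L}^2=L^2(\Omega_1)\times L^2(\Omega_2)$. Let $$V=\{w\in L^2(\Omega_1): \sqrt b\,\nabla w\in L^2(\Omega_1),\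 w=0\text{ on }\partial\Omega\}$$ with inner product $k_1\int_{\Omega_1}b\,\nabla w_1\cdot\nabla w_2\,dx+k_1\int_{\Omega_1}w_1w_2\,dx$, where "$w=0$ on $\partial\Omega$" means that $w$ is a limit, in the norm of $V$, of functions in $H^1(\Omega_1)$ with zero trace on $\partial\Omega$. Let $L^2_g(\mathbb{R}^+;V)$ be the space of $\eta:(0,\infty)\to V$ with $\int_0^\infty g(s)\|\eta(s)\|_V^2\,ds<\infty$, and let $$X=\mathbb{H}^1_{\partial\Omega}\times\mathbb{L}^2\times L^2_g(\mathbb{R}^+;V).$$ **Operator.** $D(\mathcal{A})$ is the set of $U=((u_1,v_1),(u_2,v_2),\eta)\in X$ such that $(u_2,v_2)\in\mathbb{H}^1_{\partial\Omega}$; $\eta_s\in L^2_g(\mathbb{R}^+;V)$ and $\eta(0)=0$; the distributions $\operatorname{div}((1-k_0b)\nabla u_1)+\int_0^\infty g(s)\operatorname{div}(b\nabla\eta(s))\,ds$ on $\Omega_1$ and $\Delta v_1$ on $\Omega_2$ are square integrable; and $$k_2\frac{\partial v_1}{\partial\nu}=k_1(1-k_0b)\frac{\partial u_1}{\partial\nu}+k_1\int_0^\infty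 g(s)\,b\,\frac{\partial\eta}{\partial\nu}(s)\,ds\quad\text{on }\partial\Omega_2$$ in the weak sense of Green's formula. For $U\in D(\mathcal{A})$, $$\mathcal{A}U=\Big((u_2,v_2),\ \big(k_1\operatorname{div}((1-k_0b)\nabla u_1)+k_1\textstyle\int_0^\infty g(s)\operatorname{div}(b\nabla\eta(s))\,ds,\ k_2\Delta v_1\big),\ u_2-\eta_s\Big).$$ A *mild solution* of $\frac{d}{dt}U=\mathcal{A}U$, $U(0)=U_0$, is a function $U\in C([0,\infty),X)$ with $U(0)=U_0$ such that, for all $t\ge0$, $\int_0^tU(s)\,ds\in D(\mathcal{A})$ and $U(t)=U_0+\mathcal{A}\int_0^tU(s)\,ds$. **Theorem (global well-posedness).** (i) For every $U_0\in X$ the Cauchy problem $\frac{d}{dt}U=\mathcal{A}U$, $U(0)=U_0$, has a unique mild solution $U\in C([0,\infty),X)$. (ii) If $U_0\in D(\mathcal{A})$, this mild solution is regular: $U\in C([0,\infty),D(\mathcal{A}))\cap C^1([0,\infty),X)$, where $D(\mathcal{A})$ carries the graph norm, and $\frac{d}{dt}U(t)=\mathcal{A}U(t)$ for all $t\ge0$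 (one-sided derivative at $t=0$). -/

import Mathlib

open MeasureTheory Set Filter Topology
open scoped ContDiff RealInnerProductSpace

noncomputable section

/-! ### Weak derivatives, boundary values, weighted measures -/

/-- The Euclidean space `ℝⁿ`. -/
abbrev Eu (n : ℕ) : Type := EuclideanSpace ℝ (Fin n)

/-- `φ ∈ C_c^∞(O)`. -/
def IsTest {n : ℕ} (O : Set (Eu n)) (φ : Eu n → ℝ) : Prop :=
  ContDiff ℝ ∞ φ ∧ HasCompactSupport φ ∧ tsupport φ ⊆ O

/-- `O` has boundary of class `C^k`: near each boundary point, `O` is a sublevel set of a `C^k`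
function with non-vanishing derivative at the point. -/
def HasCkBoundary {n : ℕ} (k : ℕ) (O : Set (Eu n)) : Prop :=
  ∀ x ∈ frontier O, ∃ N ∈ 𝓝 x, ∃ ρ : Eu n → ℝ,
    ContDiffOn ℝ k ρ N ∧ fderiv ℝ ρ x ≠ 0 ∧ O ∩ N = {y ∈ N | ρ y < 0}

/-- The Green pairing `∫_O (u ∂_e φ + φ p·e) dx`. For `u ∈ H¹(O)` with `∇u = p` and `O` with
regular boundary it is the boundary integral `∫_{∂O} u φ (ν·e) dS`, where `ν` is the outward
unit normal of `O`. -/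
def green {n : ℕ} (O : Set (Eu n)) (u : Eu n → ℝ) (p : Eu n → Eu n) (φ : Eu n → ℝ)
    (e : Eu n) : ℝ :=
  ∫ x in O, (u x * fderiv ℝ φ x e + φ x * ⟪p x, e⟫)

/-- `p` is the weak gradient of `u` in `O`. -/
def HasWeakGrad {n : ℕ} (O : Set (Eu n)) (u : Eu n → ℝ) (p : Eu n → Eu n) : Prop :=
  ∀ φ, IsTest O φ → ∀ e, green O u p φ e = 0

/-- The measure `w dx` on `A`. -/
def wt {n : ℕ} (A : Set (Eu n)) (w : Eu n → ℝ) : Measure (Eu n) :=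
  (volume.restrict A).withDensity fun x => ENNReal.ofReal (w x)

theorem smul_le_wt {n : ℕ} {A K : Set (Eu n)} {w : Eu n → ℝ} {c : ℝ} (hK : MeasurableSet K)
    (hKA : K ⊆ A) (h : ∀ᵐ x ∂volume.restrict K, c ≤ w x) :
    ENNReal.ofReal c • (volume.restrict K : Measure (Eu n)) ≤ wt A w := by
  calc ENNReal.ofReal c • (volume.restrict K : Measure (Eu n))
      = (volume.restrict K).withDensity (fun _ => ENNReal.ofReal c) := (withDensity_const _).symm
    _ ≤ (volume.restrict K).withDensity (fun x => ENNReal.ofReal (w x)) :=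
        withDensity_mono (h.mono fun x hx => ENNReal.ofReal_le_ofReal hx)
    _ = (wt A w).restrict K := by
        rw [wt, restrict_withDensity hK, Measure.restrict_restrict hK, inter_eq_left.2 hKA]
    _ ≤ wt A w := Measure.restrict_le_self

theorem restrict_le_smul_wt {n : ℕ} {A K : Set (Eu n)} {w : Eu n → ℝ} {c : ℝ} (hc : 0 < c)
    (hK : MeasurableSet K) (hKA : K ⊆ A) (h : ∀ᵐ x ∂volume.restrict K, c ≤ w x) :
    (volume.restrict K : Measure (Eu n)) ≤ (ENNReal.ofReal c)⁻¹ • wt A w := by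
  have hc' : ENNReal.ofReal c ≠ 0 := by simpa using hc
  calc (volume.restrict K : Measure (Eu n))
      = (ENNReal.ofReal c)⁻¹ • (ENNReal.ofReal c • (volume.restrict K : Measure (Eu n))) := by
        rw [smul_smul, ENNReal.inv_mul_cancel hc' ENNReal.ofReal_ne_top, one_smul]
    _ ≤ _ := by gcongr; exact smul_le_wt hK hKA h

theorem memLp_of_wt {n : ℕ} {F : Type*} [NormedAddCommGroup F] {A K : Set (Eu n)}
    {w : Eu n → ℝ} {c : ℝ} (hc : 0 < c) (hK : MeasurableSet K) (hKA : K ⊆ A)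
    (h : ∀ᵐ x ∂volume.restrict K, c ≤ w x) {p : Eu n → F} (hp : MemLp p 2 (wt A w)) :
    MemLp p 2 (volume.restrict K) :=
  hp.of_measure_le_smul (by simpa using hc) (restrict_le_smul_wt hc hK hKA h)

theorem ae_of_wt {n : ℕ} {A K : Set (Eu n)} {w : Eu n → ℝ} {c : ℝ} (hc : 0 < c)
    (hK : MeasurableSet K) (hKA : K ⊆ A) (h : ∀ᵐ x ∂volume.restrict K, c ≤ w x)
    {P : Eu n → Prop} (hP : ∀ᵐ x ∂wt A w, P x) : ∀ᵐ x ∂volume.restrict K, P x :=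
  ((Measure.absolutelyContinuous_of_le (restrict_le_smul_wt hc hK hKA h)).trans
    (Measure.smul_absolutelyContinuous)).ae_le hP

section greenLemmas

variable {n : ℕ} {O O' : Set (Eu n)} {u u' : Eu n → ℝ} {p p' : Eu n → Eu n} {φ : Eu n → ℝ}

theorem IsTest.mono (h : IsTest O φ) (hO : O ⊆ O') : IsTest O' φ :=
  ⟨h.1, h.2.1, h.2.2.trans hO⟩

theorem IsTest.fderiv_memLp (h : IsTest O φ) (e : Eu n) (μ : Measure (Eu n))
    [IsFiniteMeasureOnCompacts μ] : MemLp (fun x => fderiv ℝ φ x e) 2 μ :=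
  ((h.1.continuous_fderiv (by simp)).clm_apply continuous_const).memLp_of_hasCompactSupport
    (HasCompactSupport.fderiv_apply ℝ h.2.1 e)

theorem IsTest.memLp (h : IsTest O φ) (μ : Measure (Eu n))
    [IsFiniteMeasureOnCompacts μ] : MemLp φ 2 μ :=
  h.1.continuous.memLp_of_hasCompactSupport h.2.1

theorem integrable_test_left (hu : MemLp u 2 (volume.restrict O)) (h : IsTest O' φ) (e : Eu n) :
    IntegrableOn (fun x => u x * fderiv ℝ φ x e) O :=
  hu.integrable_mul (h.fderiv_memLp e _)

theorem memLp_inner {μ : Measure (Eu n)} (hp : MemLp p 2 μ) (e : Eu n) :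
    MemLp (fun x => ⟪p x, e⟫) 2 μ := hp.inner_const e

theorem integrable_test_right (hp : MemLp p 2 (volume.restrict O)) (h : IsTest O' φ) (e : Eu n) :
    IntegrableOn (fun x => φ x * ⟪p x, e⟫) O :=
  (h.memLp _).integrable_mul (memLp_inner hp e)

theorem green_add {e : Eu n} (h1 : IntegrableOn (fun x => u x * fderiv ℝ φ x e) O)
    (h2 : IntegrableOn (fun x => φ x * ⟪p x, e⟫) O)
    (h1' : IntegrableOn (fun x => u' x * fderiv ℝ φ x e) O)
    (h2' : IntegrableOn (fun x => φ x * ⟪p' x, e⟫) O) :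
    green O (u + u') (p + p') φ e = green O u p φ e + green O u' p' φ e := by
  unfold green
  refine Eq.trans ?_ (integral_add (h1.add h2) (h1'.add h2'))
  congr 1; ext x
  simp only [Pi.add_apply, inner_add_left]; ring

theorem green_smul (c : ℝ) (e : Eu n) : green O (c • u) (c • p) φ e = c * green O u p φ e := by
  unfold green
  rw [← integral_const_mul]
  congr 1; ext x
  simp only [Pi.smul_apply, inner_smul_left, smul_eq_mul, RCLike.conj_to_real]; ring

theorem green_zero (e : Eu n) : green O 0 0 φ e = 0 := by
  simp [green]

theorem green_congr {e : Eu n} (hu : u =ᵐ[volume.restrict O] u')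
    (hp : p =ᵐ[volume.restrict O] p') : green O u p φ e = green O u' p' φ e := by
  unfold green
  refine integral_congr_ae ?_
  filter_upwards [hu, hp] with x h1 h2
  rw [h1, h2]

end greenLemmas

/-! ### The medium -/

/-- The domains, coefficients and relaxation kernel of the transmission problem, with the standing
assumptions on them. `Ω₁ = Ω ∖ closure Ω₂` is the viscoelastic part, `Ω₂` the elastic inclusion. -/
structure ViscoMedium (n : ℕ) where
  /-- the whole body -/
  Ω : Set (Eu n)
  /-- the inclusion -/
  Ω₂ : Set (Eu n)
  /-- the coefficient in `Ω₁` -/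
  k₁ : ℝ
  /-- the coefficient in `Ω₂` -/
  k₂ : ℝ
  /-- localization of the viscoelastic effect; only its values on `closure Ω₁` matter -/
  b : Eu n → ℝ
  /-- relaxation kernel; only its values on `[0,∞)` matter -/
  g : ℝ → ℝ
  dim_pos : 0 < n
  isOpen_Ω : IsOpen Ω
  isBounded_Ω : Bornology.IsBounded Ω
  isOpen_Ω₂ : IsOpen Ω₂
  closure_Ω₂ : closure Ω₂ ⊆ Ω
  boundary_Ω : HasCkBoundary 3 Ω
  boundary_Ω₂ : HasCkBoundary 3 Ω₂
  k₁_pos : 0 < k₁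
  k₂_pos : 0 < k₂
  b_smooth : ContDiffOn ℝ ∞ b (Ω \ closure Ω₂)
  b_cont : ContinuousOn b (closure (Ω \ closure Ω₂))
  b_nonneg : ∀ x ∈ Ω \ closure Ω₂, 0 ≤ b x
  b_dist : ∃ δ > 0, ∀ x ∈ closure {x ∈ Ω \ closure Ω₂ | b x ≠ 0}, ∀ y ∈ frontier Ω₂, δ ≤ dist x y
  g_integrable : IntegrableOn g (Ici 0)
  g_smooth : ContDiffOn ℝ 1 g (Ici 0)
  g_pos : ∀ s ∈ Ici (0 : ℝ), 0 < g s
  g_anti : AntitoneOn g (Ici 0)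
  l_pos : 0 < 1 - (∫ s in Ici 0, g s) *
    (eLpNorm b ⊤ (volume.restrict (Ω \ closure Ω₂))).toReal

namespace ViscoMedium

variable {n : ℕ} (S : ViscoMedium n)

/-- `Ω₁ = Ω ∖ closure Ω₂`. -/
def Ω₁ : Set (Eu n) := S.Ω \ closure S.Ω₂

/-- `k₀ = ∫₀^∞ g`. -/
def k₀ : ℝ := ∫ s in Ici 0, S.g s

/-- `l = 1 - k₀ ‖b‖_{L^∞(Ω₁)}`. -/
def l : ℝ := 1 - S.k₀ * (eLpNorm S.b ⊤ (volume.restrict S.Ω₁)).toReal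

theorem isOpen_Ω₁ : IsOpen S.Ω₁ := S.isOpen_Ω.sdiff isClosed_closure

theorem k₀_nonneg : 0 ≤ S.k₀ :=
  setIntegral_nonneg measurableSet_Ici fun s hs => (S.g_pos s hs).le

theorem exists_b_bound : ∃ C, ∀ x ∈ S.Ω₁, ‖S.b x‖ ≤ C := by
  have hK : IsCompact (closure S.Ω₁) :=
    Metric.isCompact_of_isClosed_isBounded isClosed_closure
      (S.isBounded_Ω.subset sdiff_subset).closure
  obtain ⟨C, hC⟩ := hK.exists_bound_of_continuousOn S.b_cont
  exact ⟨C, fun x hx => hC x (subset_closure hx)⟩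

theorem l_le_coeff : ∀ᵐ x ∂volume.restrict S.Ω₁, S.l ≤ 1 - S.k₀ * S.b x := by
  obtain ⟨C, hC⟩ := S.exists_b_bound
  have hfin : eLpNormEssSup S.b (volume.restrict S.Ω₁) ≠ ⊤ :=
    (eLpNormEssSup_lt_top_of_ae_bound (C := C)
      ((ae_restrict_iff' S.isOpen_Ω₁.measurableSet).2 (ae_of_all _ hC))).ne
  filter_upwards [ae_le_eLpNormEssSup (f := S.b) (μ := volume.restrict S.Ω₁)] with x hx
  have h1 : ‖S.b x‖ ≤ (eLpNormEssSup S.b (volume.restrict S.Ω₁)).toReal := by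
    have := ENNReal.toReal_mono hfin hx
    simpa using this
  have h2 := mul_le_mul_of_nonneg_left ((le_abs_self _).trans h1) S.k₀_nonneg
  simp only [l, eLpNorm_exponent_top]
  linarith

/-! ### The spaces -/

/-- `(u, v, ∇u, ∇v)`, with `∇u` square integrable for `k₁ (1 - k₀ b) dx` on `Ω₁` and `∇v` for
`k₂ dx` on `Ω₂`. -/
abbrev PreH : Type :=
  (Lp ℝ 2 (volume.restrict S.Ω₁) × Lp ℝ 2 (volume.restrict S.Ω₂)) ×
    WithLp 2 (Lp (Eu n) 2 (wt S.Ω₁ fun x => S.k₁ * (1 - S.k₀ * S.b x)) ×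
      Lp (Eu n) 2 (wt S.Ω₂ fun _ => S.k₂))

/-- `u = 0` on `∂Ω`, for `u ∈ H¹(Ω₁)` with gradient `p`: the boundary integrals
`∫_{∂Ω} u φ (ν·e) dS` vanish for all `φ` supported away from `closure Ω₂`. -/
def ZeroTrace (u : Eu n → ℝ) (p : Eu n → Eu n) : Prop :=
  ∀ φ, IsTest (closure S.Ω₂)ᶜ φ → ∀ e, green S.Ω₁ u p φ e = 0

/-- `u = v` on `∂Ω₂`, for `u ∈ H¹(Ω₁)`, `v ∈ H¹(Ω₂)` with gradients `p`, `q`: the boundary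
integrals `∫_{∂Ω₂} (v - u) φ (ν·e) dS` vanish for all `φ` supported in `Ω`, where `ν` is the
outward unit normal of `Ω₂`. -/
def TraceEq (u v : Eu n → ℝ) (p q : Eu n → Eu n) : Prop :=
  ∀ φ, IsTest S.Ω φ → ∀ e, green S.Ω₁ u p φ e + green S.Ω₂ v q φ e = 0

theorem memLp_grad₁ {p : Eu n → Eu n}
    (hp : MemLp p 2 (wt S.Ω₁ fun x => S.k₁ * (1 - S.k₀ * S.b x))) :
    MemLp p 2 (volume.restrict S.Ω₁) :=
  memLp_of_wt (mul_pos S.k₁_pos S.l_pos) S.isOpen_Ω₁.measurableSet Subset.rfl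
    (S.l_le_coeff.mono fun _ hx => mul_le_mul_of_nonneg_left hx S.k₁_pos.le) hp

theorem memLp_grad₂ {p : Eu n → Eu n} (hp : MemLp p 2 (wt S.Ω₂ fun _ => S.k₂)) :
    MemLp p 2 (volume.restrict S.Ω₂) :=
  memLp_of_wt S.k₂_pos S.isOpen_Ω₂.measurableSet Subset.rfl (ae_of_all _ fun _ => le_rfl) hp

theorem ae_grad₁ {P : Eu n → Prop}
    (hP : ∀ᵐ x ∂wt S.Ω₁ fun x => S.k₁ * (1 - S.k₀ * S.b x), P x) :
    ∀ᵐ x ∂volume.restrict S.Ω₁, P x :=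
  ae_of_wt (mul_pos S.k₁_pos S.l_pos) S.isOpen_Ω₁.measurableSet Subset.rfl
    (S.l_le_coeff.mono fun _ hx => mul_le_mul_of_nonneg_left hx S.k₁_pos.le) hP

theorem ae_grad₂ {P : Eu n → Prop} (hP : ∀ᵐ x ∂wt S.Ω₂ fun _ => S.k₂, P x) :
    ∀ᵐ x ∂volume.restrict S.Ω₂, P x :=
  ae_of_wt S.k₂_pos S.isOpen_Ω₂.measurableSet Subset.rfl (ae_of_all _ fun _ => le_rfl) hP

theorem green_add' {O : Set (Eu n)} {u u' : Eu n → ℝ} {p p' : Eu n → Eu n}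
    (hu : MemLp u 2 (volume.restrict O)) (hp : MemLp p 2 (volume.restrict O))
    (hu' : MemLp u' 2 (volume.restrict O)) (hp' : MemLp p' 2 (volume.restrict O))
    {O' : Set (Eu n)} {φ : Eu n → ℝ} (h : IsTest O' φ) (e : Eu n) :
    green O (u + u') (p + p') φ e = green O u p φ e + green O u' p' φ e :=
  green_add (integrable_test_left hu h e) (integrable_test_right hp h e)
    (integrable_test_left hu' h e) (integrable_test_right hp' h e)

/-- `ℍ¹_{∂Ω}`: pairs `(u, v) ∈ H¹(Ω₁) × H¹(Ω₂)` with `u = 0` on `∂Ω` and `u = v` on `∂Ω₂`. -/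
def HSub : Submodule ℝ S.PreH where
  carrier := {h | HasWeakGrad S.Ω₁ h.1.1 h.2.fst ∧ HasWeakGrad S.Ω₂ h.1.2 h.2.snd ∧
    S.ZeroTrace h.1.1 h.2.fst ∧ S.TraceEq h.1.1 h.1.2 h.2.fst h.2.snd}
  add_mem' := by
    intro h k hh hk
    have e1 : ∀ O φ, IsTest O φ → ∀ e, green S.Ω₁ (h + k).1.1 (h + k).2.fst φ e =
        green S.Ω₁ h.1.1 h.2.fst φ e + green S.Ω₁ k.1.1 k.2.fst φ e := fun O φ hφ e => by
      rw [← green_add' (Lp.memLp _) (S.memLp_grad₁ (Lp.memLp _)) (Lp.memLp _)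
        (S.memLp_grad₁ (Lp.memLp _)) hφ]
      exact green_congr (Lp.coeFn_add _ _) (S.ae_grad₁ (Lp.coeFn_add _ _))
    have e2 : ∀ O φ, IsTest O φ → ∀ e, green S.Ω₂ (h + k).1.2 (h + k).2.snd φ e =
        green S.Ω₂ h.1.2 h.2.snd φ e + green S.Ω₂ k.1.2 k.2.snd φ e := fun O φ hφ e => by
      rw [← green_add' (Lp.memLp _) (S.memLp_grad₂ (Lp.memLp _)) (Lp.memLp _)
        (S.memLp_grad₂ (Lp.memLp _)) hφ]
      exact green_congr (Lp.coeFn_add _ _) (S.ae_grad₂ (Lp.coeFn_add _ _))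
    refine ⟨fun φ hφ e => ?_, fun φ hφ e => ?_, fun φ hφ e => ?_, fun φ hφ e => ?_⟩
    · rw [e1 _ φ hφ, hh.1 φ hφ, hk.1 φ hφ, add_zero]
    · rw [e2 _ φ hφ, hh.2.1 φ hφ, hk.2.1 φ hφ, add_zero]
    · rw [e1 _ φ hφ, hh.2.2.1 φ hφ, hk.2.2.1 φ hφ, add_zero]
    · have a := hh.2.2.2 φ hφ e
      have b := hk.2.2.2 φ hφ e
      rw [e1 _ φ hφ, e2 _ φ hφ]
      linarith
  zero_mem' := by
    have e1 : ∀ φ e, green S.Ω₁ (0 : S.PreH).1.1 (0 : S.PreH).2.fst φ e = 0 := fun φ e => by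
      rw [← green_zero e (O := S.Ω₁) (φ := φ)]
      exact green_congr (Lp.coeFn_zero _ _ _) (S.ae_grad₁ (Lp.coeFn_zero _ _ _))
    have e2 : ∀ φ e, green S.Ω₂ (0 : S.PreH).1.2 (0 : S.PreH).2.snd φ e = 0 := fun φ e => by
      rw [← green_zero e (O := S.Ω₂) (φ := φ)]
      exact green_congr (Lp.coeFn_zero _ _ _) (S.ae_grad₂ (Lp.coeFn_zero _ _ _))
    refine ⟨fun φ _ e => e1 φ e, fun φ _ e => e2 φ e, fun φ _ e => e1 φ e, fun φ _ e => ?_⟩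
    rw [e1, e2, add_zero]
  smul_mem' := by
    intro c h hh
    have e1 : ∀ φ e, green S.Ω₁ (c • h).1.1 (c • h).2.fst φ e =
        c * green S.Ω₁ h.1.1 h.2.fst φ e := fun φ e => by
      rw [← green_smul]
      exact green_congr (Lp.coeFn_smul _ _) (S.ae_grad₁ (Lp.coeFn_smul _ _))
    have e2 : ∀ φ e, green S.Ω₂ (c • h).1.2 (c • h).2.snd φ e =
        c * green S.Ω₂ h.1.2 h.2.snd φ e := fun φ e => by
      rw [← green_smul]
      exact green_congr (Lp.coeFn_smul _ _) (S.ae_grad₂ (Lp.coeFn_smul _ _))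
    refine ⟨fun φ hφ e => ?_, fun φ hφ e => ?_, fun φ hφ e => ?_, fun φ hφ e => ?_⟩
    · rw [e1, hh.1 φ hφ, mul_zero]
    · rw [e2, hh.2.1 φ hφ, mul_zero]
    · rw [e1, hh.2.2.1 φ hφ, mul_zero]
    · rw [e1, e2, ← mul_add, hh.2.2.2 φ hφ, mul_zero]

theorem exists_cutoff : ∃ χ : Eu n → ℝ, ContDiff ℝ ∞ χ ∧ tsupport χ ⊆ S.Ω ∧
    ∀ᶠ x in 𝓝ˢ (closure S.Ω₂), χ x = 1 := by
  obtain ⟨χ, h0, h1, -⟩ := exists_contMDiffMap_zero_one_nhds_of_isClosed (n := (⊤ : ℕ∞))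
    (modelWithCornersSelf ℝ (Eu n)) S.isOpen_Ω.isClosed_compl (isClosed_closure (s := S.Ω₂))
    (disjoint_compl_left_iff_subset.2 S.closure_Ω₂)
  refine ⟨χ, χ.contMDiff.contDiff, fun x hx => ?_, h1⟩
  by_contra hxΩ
  have : ∀ᶠ y in 𝓝 x, χ y = 0 := h0.filter_mono (nhds_le_nhdsSet hxΩ)
  exact (notMem_tsupport_iff_eventuallyEq.2 this) hx

theorem pair_univ {u v : Eu n → ℝ} {p q : Eu n → Eu n}
    (hu : MemLp u 2 (volume.restrict S.Ω₁)) (hp : MemLp p 2 (volume.restrict S.Ω₁))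
    (h1 : S.ZeroTrace u p) (h2 : S.TraceEq u v p q) {φ : Eu n → ℝ} (hφ : IsTest univ φ)
    (e : Eu n) : green S.Ω₁ u p φ e + green S.Ω₂ v q φ e = 0 := by
  obtain ⟨χ, hχ, hχΩ, hχ1⟩ := S.exists_cutoff
  set φ₁ : Eu n → ℝ := fun x => χ x * φ x with hφ₁
  set φ₂ : Eu n → ℝ := fun x => φ x - χ x * φ x with hφ₂
  have t1 : IsTest S.Ω φ₁ :=
    ⟨hχ.mul hφ.1, hφ.2.1.mul_left, (tsupport_mul_subset_left).trans hχΩ⟩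
  have t2 : IsTest (closure S.Ω₂)ᶜ φ₂ := by
    refine ⟨hφ.1.sub (hχ.mul hφ.1), hφ.2.1.sub hφ.2.1.mul_left, fun x hx hx2 => ?_⟩
    have : ∀ᶠ y in 𝓝 x, φ₂ y = 0 := by
      filter_upwards [hχ1.filter_mono (nhds_le_nhdsSet hx2)] with y hy
      simp [hφ₂, hy]
    exact (notMem_tsupport_iff_eventuallyEq.2 this) hx
  have e1 : green S.Ω₁ u p φ e = green S.Ω₁ u p φ₁ e + green S.Ω₁ u p φ₂ e := by
    unfold green
    refine Eq.trans ?_ (integral_add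
      ((integrable_test_left hu t1 e).add (integrable_test_right hp t1 e))
      ((integrable_test_left hu t2 e).add (integrable_test_right hp t2 e)))
    congr 1; ext x
    have d : fderiv ℝ φ x = fderiv ℝ φ₁ x + fderiv ℝ φ₂ x := by
      have a1 := (t1.1.differentiable (by simp)).differentiableAt (x := x)
      have a2 := (t2.1.differentiable (by simp)).differentiableAt (x := x)
      rw [← fderiv_add a1 a2]
      congr 1; ext y; simp [hφ₁, hφ₂]
    simp only [d, add_apply, hφ₁, hφ₂]
    ring
  have e2 : green S.Ω₂ v q φ e = green S.Ω₂ v q φ₁ e := by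
    unfold green
    refine setIntegral_congr_fun S.isOpen_Ω₂.measurableSet fun x hx => ?_
    have ev : φ =ᶠ[𝓝 x] φ₁ := by
      filter_upwards [hχ1.filter_mono (nhds_le_nhdsSet (subset_closure hx))] with y hy
      simp [hφ₁, hy]
    simp only [ev.fderiv_eq, ev.eq_of_nhds]
  rw [e1, e2, h1 _ t2, add_zero, h2 _ t1]

theorem zero_of_grad_zero (h : S.HSub) (h0 : h.1.2 = 0) : h = 0 := by
  obtain ⟨⟨⟨u, v⟩, pq⟩, hm⟩ := h
  simp only at h0
  subst h0
  obtain ⟨-, -, hz, ht⟩ := hm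
  simp only [WithLp.zero_fst, WithLp.zero_snd] at hz ht
  -- square integrable functions on the bounded sets are integrable
  have hΩfin : volume S.Ω < ⊤ := S.isBounded_Ω.measure_lt_top
  have hf1 : IsFiniteMeasure (volume.restrict S.Ω₁) :=
    ⟨by rw [Measure.restrict_apply_univ]
        exact (measure_mono sdiff_subset).trans_lt hΩfin⟩
  have hf2 : IsFiniteMeasure (volume.restrict S.Ω₂) :=
    ⟨by rw [Measure.restrict_apply_univ]
        exact (measure_mono (subset_closure.trans S.closure_Ω₂)).trans_lt hΩfin⟩
  have hu1 : IntegrableOn u S.Ω₁ := (Lp.memLp u).integrable (by norm_num)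
  have hv1 : IntegrableOn v S.Ω₂ := (Lp.memLp v).integrable (by norm_num)
  set W : Eu n → ℝ := fun x => S.Ω₁.indicator u x + S.Ω₂.indicator v x with hW
  have hWi : Integrable W :=
    (hu1.integrable_indicator S.isOpen_Ω₁.measurableSet).add
      (hv1.integrable_indicator S.isOpen_Ω₂.measurableSet)
  have hWs : ∀ x, x ∉ S.Ω → W x = 0 := fun x hx => by
    have a1 : x ∉ S.Ω₁ := fun h => hx h.1
    have a2 : x ∉ S.Ω₂ := fun h => hx (S.closure_Ω₂ (subset_closure h))
    simp [hW, a1, a2]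
  have split : ∀ f : Eu n → ℝ, (∃ C, ∀ x, ‖f x‖ ≤ C) → Continuous f →
      ∫ x, W x * f x = (∫ x in S.Ω₁, u x * f x) + ∫ x in S.Ω₂, v x * f x := by
    rintro f ⟨C, hC⟩ hf
    rw [← integral_indicator S.isOpen_Ω₁.measurableSet,
      ← integral_indicator S.isOpen_Ω₂.measurableSet, ← integral_add]
    · congr 1; ext x
      simp only [hW, add_mul, indicator_mul_left]
    · exact IntegrableOn.integrable_indicator (hu1.mul_bdd hf.aestronglyMeasurable
        (ae_of_all _ hC)) S.isOpen_Ω₁.measurableSet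
    · exact IntegrableOn.integrable_indicator (hv1.mul_bdd hf.aestronglyMeasurable
        (ae_of_all _ hC)) S.isOpen_Ω₂.measurableSet
  have hWφ : ∀ φ, IsTest univ φ → ∀ e, ∫ x, W x * fderiv ℝ φ x e = 0 := by
    intro φ hφ e
    have hc : Continuous fun x => fderiv ℝ φ x e :=
      (hφ.1.continuous_fderiv (by simp)).clm_apply continuous_const
    have hb := hc.bounded_above_of_compact_support (HasCompactSupport.fderiv_apply ℝ hφ.2.1 e)
    rw [split _ hb hc, ← S.pair_univ (Lp.memLp u)
      (S.memLp_grad₁ (Lp.memLp (0 : Lp (Eu n) 2 _))) hz ht hφ e]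
    unfold green
    congr 1
    · refine integral_congr_ae ?_
      filter_upwards [S.ae_grad₁ (Lp.coeFn_zero (Eu n) 2 _)] with x hx
      rw [hx]
      simp
    · refine integral_congr_ae ?_
      filter_upwards [S.ae_grad₂ (Lp.coeFn_zero (Eu n) 2 _)] with x hx
      rw [hx]
      simp
  -- translate a test function out of `Ω`
  have hWψ : ∀ ψ, IsTest univ ψ → ∫ x, W x * ψ x = 0 := by
    intro ψ hψ
    set e : Eu n := EuclideanSpace.single ⟨0, S.dim_pos⟩ 1 with he
    have hc : Continuous fun x => fderiv ℝ ψ x e :=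
      (hψ.1.continuous_fderiv (by simp)).clm_apply continuous_const
    obtain ⟨C, hC⟩ :=
      hc.bounded_above_of_compact_support (HasCompactSupport.fderiv_apply ℝ hψ.2.1 e)
    obtain ⟨C', hC'⟩ := hψ.1.continuous.bounded_above_of_compact_support hψ.2.1
    have tr : ∀ r : ℝ, IsTest univ fun y => ψ (y + r • e) := fun r =>
      ⟨hψ.1.comp (contDiff_id.add contDiff_const),
        hψ.2.1.comp_homeomorph (Homeomorph.addRight (r • e)), subset_univ _⟩
    have dtr : ∀ (r : ℝ) y, fderiv ℝ (fun y => ψ (y + r • e)) y = fderiv ℝ ψ (y + r • e) :=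
      fun r y => fderiv_comp_add_right _
    set F : ℝ → ℝ := fun r => ∫ y, W y * ψ (y + r • e) with hF
    have hder : ∀ r, HasDerivAt F 0 r := by
      intro r
      have key := (hasDerivAt_integral_of_dominated_loc_of_deriv_le (μ := volume)
        (F := fun r y => W y * ψ (y + r • e))
        (F' := fun r y => W y * fderiv ℝ ψ (y + r • e) e)
        (bound := fun y => ‖W y‖ * C) (s := univ) (x₀ := r) univ_mem
        (Eventually.of_forall fun r => hWi.aestronglyMeasurable.mul
          (tr r).1.continuous.aestronglyMeasurable)
        (hWi.mul_bdd (tr r).1.continuous.aestronglyMeasurable (ae_of_all _ fun y => hC' _))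
        (hWi.aestronglyMeasurable.mul
          (hc.comp (continuous_id.add continuous_const)).aestronglyMeasurable)
        (ae_of_all _ fun y r _ => by
          rw [norm_mul]; exact mul_le_mul_of_nonneg_left (hC _) (norm_nonneg _))
        (hWi.norm.mul_const C)
        (ae_of_all _ fun y r _ => by
          have l : HasDerivAt (fun r : ℝ => y + r • e) e r := by
            simpa using ((hasDerivAt_id r).smul_const e).const_add y
          exact (((hψ.1.differentiable (by simp)) _).hasFDerivAt.comp_hasDerivAt r l).const_mul
            (W y))).2
      have z := hWφ _ (tr r) e
      simp only [dtr] at z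
      rwa [z] at key
    have hconst : ∀ r, F r = F 0 := fun r =>
      is_const_of_deriv_eq_zero (fun r => (hder r).differentiableAt) (fun r => (hder r).deriv) r 0
    obtain ⟨R, hR⟩ := S.isBounded_Ω.subset_ball (0 : Eu n)
    obtain ⟨R', hR'⟩ := hψ.2.1.isCompact.isBounded.subset_ball (0 : Eu n)
    have hfar : F (|R| + |R'|) = 0 := by
      refine integral_eq_zero_of_ae (ae_of_all _ fun y => ?_)
      by_cases hy : y ∈ S.Ω
      · have h1 : ‖y‖ < R := by simpa using hR hy
        have : y + (|R| + |R'|) • e ∉ tsupport ψ := fun hmem => by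
          have h2 : ‖y + (|R| + |R'|) • e‖ < R' := by simpa using hR' hmem
          have h3 : ‖(|R| + |R'|) • e‖ = |R| + |R'| := by
            rw [norm_smul, he, PiLp.norm_single, norm_one, mul_one, Real.norm_eq_abs,
              abs_of_nonneg (by positivity)]
          have h4 : ‖(|R| + |R'|) • e‖ ≤ ‖y + (|R| + |R'|) • e‖ + ‖y‖ := by
            have := norm_sub_le (y + (|R| + |R'|) • e) y
            simpa using this
          have := le_abs_self R
          have := le_abs_self R'
          linarith
        simp [image_eq_zero_of_notMem_tsupport this]
      · simp [hWs y hy]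
    have := hconst (|R| + |R'|)
    rw [hfar] at this
    simpa [hF] using this.symm
  have hW0 : ∀ᵐ x, W x = 0 := by
    have := isOpen_univ.ae_eq_zero_of_integral_contDiff_smul_eq_zero (μ := volume)
      (f := W) (hWi.locallyIntegrable.locallyIntegrableOn univ) (fun ψ a b c => by
        simpa [mul_comm] using hWψ ψ ⟨a, b, subset_univ _⟩)
    simpa using this
  have hdisj : ∀ x ∈ S.Ω₁, x ∉ S.Ω₂ := fun x hx h => hx.2 (subset_closure h)
  have hu0 : u = 0 := by
    refine Lp.ext ?_
    filter_upwards [Lp.coeFn_zero ℝ 2 (volume.restrict S.Ω₁), ae_restrict_of_ae hW0,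
      ae_restrict_mem S.isOpen_Ω₁.measurableSet] with x h0 h1 h2
    rw [h0]
    simpa [hW, h2, hdisj x h2] using h1
  have hv0 : v = 0 := by
    refine Lp.ext ?_
    filter_upwards [Lp.coeFn_zero ℝ 2 (volume.restrict S.Ω₂), ae_restrict_of_ae hW0,
      ae_restrict_mem S.isOpen_Ω₂.measurableSet] with x h0 h1 h2
    have : x ∉ S.Ω₁ := fun h => hdisj x h h2
    rw [h0]
    simpa [hW, h2, this] using h1
  subst hu0 hv0
  rfl

/-- `ℍ¹_{∂Ω}` with the norm of the inner product
`k₁ ∫_{Ω₁} (1 - k₀ b) ∇u₁·∇u₂ dx + k₂ ∫_{Ω₂} ∇v₁·∇v₂ dx`. -/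
def H : Type := S.HSub

instance : AddCommGroup S.H := inferInstanceAs (AddCommGroup S.HSub)

instance : Module ℝ S.H := inferInstanceAs (Module ℝ S.HSub)

/-- `(u, v) ↦ (∇u, ∇v)`. -/
def gradMap : S.H →ₗ[ℝ] WithLp 2 (Lp (Eu n) 2 (wt S.Ω₁ fun x => S.k₁ * (1 - S.k₀ * S.b x)) ×
    Lp (Eu n) 2 (wt S.Ω₂ fun _ => S.k₂)) :=
  (LinearMap.snd ℝ _ _).comp S.HSub.subtype

theorem gradMap_injective : Function.Injective S.gradMap :=
  (injective_iff_map_eq_zero _).2 fun h h0 => S.zero_of_grad_zero h h0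

instance : NormedAddCommGroup S.H :=
  NormedAddCommGroup.induced _ _ S.gradMap S.gradMap_injective

instance : NormedSpace ℝ S.H := NormedSpace.induced ℝ S.H _ S.gradMap

variable {S} in
/-- The component `u ∈ L²(Ω₁)` of `(u, v) ∈ ℍ¹_{∂Ω}`. -/
def H.u (h : S.H) : Lp ℝ 2 (volume.restrict S.Ω₁) := h.1.1.1

variable {S} in
/-- The component `v ∈ L²(Ω₂)` of `(u, v) ∈ ℍ¹_{∂Ω}`. -/
def H.v (h : S.H) : Lp ℝ 2 (volume.restrict S.Ω₂) := h.1.1.2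

variable {S} in
/-- `∇u` for `(u, v) ∈ ℍ¹_{∂Ω}`. -/
def H.gradu (h : S.H) : Lp (Eu n) 2 (wt S.Ω₁ fun x => S.k₁ * (1 - S.k₀ * S.b x)) := h.1.2.fst

variable {S} in
/-- `∇v` for `(u, v) ∈ ℍ¹_{∂Ω}`. -/
def H.gradv (h : S.H) : Lp (Eu n) 2 (wt S.Ω₂ fun _ => S.k₂) := h.1.2.snd

/-- `𝕃² = L²(Ω₁) × L²(Ω₂)`, with the Hilbert norm. -/
abbrev L2 : Type :=
  WithLp 2 (Lp ℝ 2 (volume.restrict S.Ω₁) × Lp ℝ 2 (volume.restrict S.Ω₂))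

/-- The part of `Ω₁` where `b > 0`. -/
def posSet : Set (Eu n) := {x ∈ S.Ω₁ | 0 < S.b x}

/-- `(w, ∇w)` with `w` square integrable for `k₁ dx` and `∇w` square integrable for `k₁ b dx`
on `Ω₁`; the norm is that of `k₁ ∫ b ∇w₁·∇w₂ dx + k₁ ∫ w₁ w₂ dx`. -/
abbrev PreV : Type :=
  WithLp 2 (Lp ℝ 2 (wt S.Ω₁ fun _ => S.k₁) × Lp (Eu n) 2 (wt S.Ω₁ fun x => S.k₁ * S.b x))

theorem isOpen_posSet : IsOpen S.posSet :=
  (S.b_smooth.continuousOn).isOpen_inter_preimage S.isOpen_Ω₁ isOpen_Ioi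

theorem ae_k₁ {P : Eu n → Prop} (hP : ∀ᵐ x ∂wt S.Ω₁ fun _ => S.k₁, P x) :
    ∀ᵐ x ∂volume.restrict S.Ω₁, P x :=
  ae_of_wt S.k₁_pos S.isOpen_Ω₁.measurableSet Subset.rfl (ae_of_all _ fun _ => le_rfl) hP

theorem exists_pos_le {K : Set (Eu n)} (hK : IsCompact K) (hKs : K ⊆ S.posSet) :
    ∃ c > 0, ∀ᵐ x ∂volume.restrict K, c ≤ S.k₁ * S.b x := by
  rcases K.eq_empty_or_nonempty with rfl | hne
  · exact ⟨1, one_pos, by simp⟩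
  · obtain ⟨x₀, hx₀, hmin⟩ := hK.exists_isMinOn hne
      (S.b_smooth.continuousOn.mono fun x hx => (hKs hx).1)
    exact ⟨S.k₁ * S.b x₀, mul_pos S.k₁_pos (hKs hx₀).2,
      (ae_restrict_iff' hK.measurableSet).2 (ae_of_all _ fun x hx =>
        mul_le_mul_of_nonneg_left (hmin hx) S.k₁_pos.le)⟩

theorem integrable_posSet {p : Eu n → Eu n} (hp : MemLp p 2 (wt S.Ω₁ fun x => S.k₁ * S.b x))
    {φ : Eu n → ℝ} (hφ : IsTest S.posSet φ) (e : Eu n) :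
    IntegrableOn (fun x => φ x * ⟪p x, e⟫) S.posSet := by
  obtain ⟨c, hc, hle⟩ := S.exists_pos_le hφ.2.1.isCompact hφ.2.2
  have h1 := memLp_of_wt hc hφ.2.1.isCompact.measurableSet (fun x hx => (hφ.2.2 hx).1) hle hp
  have h2 := integrable_test_right h1 hφ e
  have h3 : Integrable fun x => φ x * ⟪p x, e⟫ :=
    (integrableOn_iff_integrable_of_support_subset fun x hx =>
      subset_tsupport φ (left_ne_zero_of_mul hx)).1 h2
  exact h3.integrableOn

theorem ae_posSet {P : Eu n → Prop} (hP : ∀ᵐ x ∂wt S.Ω₁ fun x => S.k₁ * S.b x, P x) :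
    ∀ᵐ x ∂volume.restrict S.posSet, P x := by
  have hb : AEMeasurable (fun x => ENNReal.ofReal (S.k₁ * S.b x)) (volume.restrict S.Ω₁) :=
    ((S.b_smooth.continuousOn.aemeasurable S.isOpen_Ω₁.measurableSet).const_mul _).ennreal_ofReal
  have := (ae_withDensity_iff' hb).1 hP
  rw [ae_restrict_iff' S.isOpen_posSet.measurableSet]
  rw [ae_restrict_iff' S.isOpen_Ω₁.measurableSet] at this
  filter_upwards [this] with x hx hxs
  exact hx hxs.1 (by simpa using mul_pos S.k₁_pos hxs.2)

/-- `w ∈ L²(Ω₁)` with `√b ∇w ∈ L²(Ω₁)`. Since `b` is nonnegative and smooth, `√b` is locally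
Lipschitz and the distribution `√b ∇w` is in `L²(Ω₁)` iff `w` has on the open set `{b > 0}` a weak
gradient with `∫_{b > 0} b |∇w|² dx < ∞`. -/
def weightedSub : Submodule ℝ S.PreV where
  carrier := {z | HasWeakGrad S.posSet z.fst z.snd}
  add_mem' := by
    intro z z' hz hz' φ hφ e
    have i1 : ∀ z : S.PreV, IntegrableOn (fun x => z.fst x * fderiv ℝ φ x e) S.posSet := fun z =>
      integrable_test_left ((memLp_of_wt S.k₁_pos S.isOpen_Ω₁.measurableSet Subset.rfl
        (ae_of_all _ fun _ => le_rfl) (Lp.memLp z.fst)).mono_measure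
        (Measure.restrict_mono (fun x hx => hx.1) le_rfl)) hφ e
    have i2 := fun z : S.PreV => S.integrable_posSet (Lp.memLp z.snd) hφ e
    have := green_add (i1 z) (i2 z) (i1 z') (i2 z')
    rw [hz φ hφ, hz' φ hφ, add_zero] at this
    rw [← this]
    exact green_congr (ae_restrict_of_ae_restrict_of_subset (fun x hx => hx.1)
      (S.ae_k₁ (Lp.coeFn_add _ _))) (S.ae_posSet (Lp.coeFn_add _ _))
  zero_mem' := by
    intro φ hφ e
    rw [← green_zero e (O := S.posSet) (φ := φ)]
    exact green_congr (ae_restrict_of_ae_restrict_of_subset (fun x hx => hx.1)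
      (S.ae_k₁ (Lp.coeFn_zero _ _ _))) (S.ae_posSet (Lp.coeFn_zero _ _ _))
  smul_mem' := by
    intro c z hz φ hφ e
    rw [← mul_zero c, ← hz φ hφ e, ← green_smul]
    exact green_congr (ae_restrict_of_ae_restrict_of_subset (fun x hx => hx.1)
      (S.ae_k₁ (Lp.coeFn_smul _ _))) (S.ae_posSet (Lp.coeFn_smul _ _))

/-- The functions `w ∈ H¹(Ω₁)` with `w = 0` on `∂Ω`. -/
def zeroTraceSub : Submodule ℝ S.PreV where
  carrier := {z | ∃ u p, MemLp u 2 (volume.restrict S.Ω₁) ∧ MemLp p 2 (volume.restrict S.Ω₁) ∧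
    HasWeakGrad S.Ω₁ u p ∧ S.ZeroTrace u p ∧ z.fst =ᵐ[wt S.Ω₁ fun _ => S.k₁] u ∧
    z.snd =ᵐ[wt S.Ω₁ fun x => S.k₁ * S.b x] p}
  add_mem' := by
    rintro z z' ⟨u, p, hu, hp, h1, h2, h3, h4⟩ ⟨u', p', hu', hp', h1', h2', h3', h4'⟩
    refine ⟨u + u', p + p', hu.add hu', hp.add hp', fun φ hφ e => ?_, fun φ hφ e => ?_,
      (Lp.coeFn_add _ _).trans (h3.add h3'), (Lp.coeFn_add _ _).trans (h4.add h4')⟩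
    · rw [green_add' hu hp hu' hp' hφ, h1 φ hφ, h1' φ hφ, add_zero]
    · rw [green_add' hu hp hu' hp' hφ, h2 φ hφ, h2' φ hφ, add_zero]
  zero_mem' := ⟨0, 0, MemLp.zero, MemLp.zero, fun _ _ e => green_zero e, fun _ _ e => green_zero e,
    Lp.coeFn_zero _ _ _, Lp.coeFn_zero _ _ _⟩
  smul_mem' := by
    rintro c z ⟨u, p, hu, hp, h1, h2, h3, h4⟩
    refine ⟨c • u, c • p, hu.const_smul c, hp.const_smul c, fun φ hφ e => ?_, fun φ hφ e => ?_,
      (Lp.coeFn_smul _ _).trans (h3.const_smul c), (Lp.coeFn_smul _ _).trans (h4.const_smul c)⟩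
    · rw [green_smul, h1 φ hφ, mul_zero]
    · rw [green_smul, h2 φ hφ, mul_zero]

/-- `V = {w ∈ L²(Ω₁) : √b ∇w ∈ L²(Ω₁), w = 0 on ∂Ω}`. As `b` may vanish near `∂Ω`, where `w` then
has no trace, the boundary condition means that `w` is a limit, in the norm of `V`, of functions of
`H¹(Ω₁)` with zero trace on `∂Ω`. -/
def V : Submodule ℝ S.PreV := S.weightedSub ⊓ S.zeroTraceSub.topologicalClosure

instance : NormedAddCommGroup S.V := inferInstance

instance : NormedSpace ℝ S.V := inferInstance

/-- The measure `g(s) ds` on `(0,∞)`. -/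
def gMeas : Measure ℝ := (volume.restrict (Ioi 0)).withDensity fun s => ENNReal.ofReal (S.g s)

/-- `L²_g(ℝ⁺; V)`. -/
abbrev Lg : Type := Lp S.V 2 S.gMeas

/-- The state space `X = ℍ¹_{∂Ω} × 𝕃² × L²_g(ℝ⁺; V)`, with the Hilbert norm. -/
abbrev X : Type := WithLp 2 (S.H × WithLp 2 (S.L2 × S.Lg))

instance : NormedAddCommGroup S.L2 := inferInstance

instance : NormedSpace ℝ S.L2 := inferInstance

instance : NormedAddCommGroup S.Lg := inferInstance

instance : NormedSpace ℝ S.Lg := inferInstance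

instance : NormedAddCommGroup (WithLp 2 (S.L2 × S.Lg)) := inferInstance

instance : NormedSpace ℝ (WithLp 2 (S.L2 × S.Lg)) := inferInstance

instance : NormedAddCommGroup S.X := inferInstance

instance : NormedSpace ℝ S.X := inferInstance

/-! ### The operator -/

variable {S}

/-- `η ∈ D(T)` with `η_s = ζ`: `η` is absolutely continuous with derivative `ζ` and `η(0) = 0`. -/
def IsHistDeriv (η ζ : S.Lg) : Prop :=
  ∀ᵐ s ∂volume.restrict (Ioi (0 : ℝ)), η s = ∫ r in (0 : ℝ)..s, ζ r

/-- `∫_{Ω₁} [(1 - k₀ b) ∇u + ∫₀^∞ g(s) b ∇η(s) ds] · q dx`, where `p = ∇u`. -/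
def stress (p : Eu n → Eu n) (η : S.Lg) (q : Eu n → Eu n) : ℝ :=
  (∫ x in S.Ω₁, (1 - S.k₀ * S.b x) * ⟪p x, q x⟫) +
    ∫ s in Ioi (0 : ℝ), S.g s * ∫ x in S.Ω₁, S.b x * ⟪(η s).1.snd x, q x⟫

/-- The graph of `𝒜`: for `U = ((u₁, v₁), (u₂, v₂), η)` it says that `U ∈ D(𝒜)` and `𝒜 U = W`. The
divergence and the Laplacian are those of distributions, and the transmission condition
`k₂ ∂v₁/∂ν = k₁ (1 - k₀ b) ∂u₁/∂ν + k₁ ∫₀^∞ g b ∂η/∂ν ds` on `∂Ω₂` is the equality of normal traces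
in the sense of Green's formula, tested with the traces on `∂Ω₂` of all of `ℍ¹_{∂Ω}`. -/
structure IsGen (U W : S.X) : Prop where
  /-- `(u₂, v₂) ∈ ℍ¹_{∂Ω}`, and it is the first component of `𝒜 U` -/
  velocity_u : W.fst.u = U.snd.fst.fst
  velocity_v : W.fst.v = U.snd.fst.snd
  /-- the component in `L²(Ω₁)` is `k₁ div((1 - k₀ b) ∇u₁) + k₁ ∫₀^∞ g(s) div(b ∇η(s)) ds` -/
  momentum_u : ∀ φ, IsTest S.Ω₁ φ →
    ∫ x in S.Ω₁, W.snd.fst.fst x * φ x = -(S.k₁ * stress U.fst.gradu U.snd.snd (gradient φ))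
  /-- the component in `L²(Ω₂)` is `k₂ Δv₁` -/
  momentum_v : ∀ φ, IsTest S.Ω₂ φ →
    ∫ x in S.Ω₂, W.snd.fst.snd x * φ x =
      -(S.k₂ * ∫ x in S.Ω₂, ⟪U.fst.gradv x, gradient φ x⟫)
  /-- the transmission condition on `∂Ω₂` -/
  transmission : ∀ h : S.H,
    (∫ x in S.Ω₂, W.snd.fst.snd x * h.v x) + S.k₂ * (∫ x in S.Ω₂, ⟪U.fst.gradv x, h.gradv x⟫) =
      -((∫ x in S.Ω₁, W.snd.fst.fst x * h.u x) + S.k₁ * stress U.fst.gradu U.snd.snd h.gradu)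
  /-- `η ∈ D(T)`, and the component in `L²_g(ℝ⁺; V)` is `u₂ - η_s`, where `u₂` is the element `z`
  of `V`, constant in `s` -/
  history : ∃ ζ : S.Lg, IsHistDeriv U.snd.snd ζ ∧ ∃ z : S.V,
    z.1.fst =ᵐ[volume.restrict S.Ω₁] U.snd.fst.fst ∧
    (z.1.snd : Eu n → Eu n) =ᵐ[wt S.Ω₁ fun x => S.k₁ * S.b x] W.fst.gradu ∧
    ∀ᵐ s ∂volume.restrict (Ioi (0 : ℝ)), W.snd.snd s = z - ζ s

variable (S) in
/-- `D(𝒜)`. -/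
def domA : Set S.X := {U | ∃ W, IsGen U W}

/-- `U ∈ C([0,∞), X)` is a mild solution of `dU/dt = 𝒜 U`, `U(0) = U₀`. -/
structure IsMildSolution (U₀ : S.X) (U : ℝ → S.X) : Prop where
  continuousOn : ContinuousOn U (Ici 0)
  initial : U 0 = U₀
  integral_eq : ∀ t, 0 ≤ t → IsGen (∫ s in (0 : ℝ)..t, U s) (U t - U₀)

/-- `U ∈ C([0,∞), D(𝒜)) ∩ C¹([0,∞), X)` and `dU/dt = 𝒜 U` on `[0,∞)`, one-sided at `0`. Here `U'`
is both `dU/dt` and `𝒜 U`, so its continuity with that of `U` is continuity of `U` for the graph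
norm. -/
def IsRegularSolution (U : ℝ → S.X) : Prop :=
  ∃ U' : ℝ → S.X, ContinuousOn U (Ici 0) ∧ ContinuousOn U' (Ici 0) ∧
    (∀ t, 0 ≤ t → HasDerivWithinAt U (U' t) (Ici 0) t) ∧ ∀ t, 0 ≤ t → IsGen (U t) (U' t)

end ViscoMedium

end

/-!
The equation `dU/dt = 𝒜 U` is solved by the generation theorem for maximal dissipative operators.
The domain `D(𝒜)` is described by a single variational identity, so that the Lax-Milgram lemma gives
the resolvent of `𝒜`.

*Reduction to an abstract system.* Let `J : ℍ¹_{∂Ω} → 𝕃²` be the embedding (`toL2`), let `Q` send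
`(u, v)` to the history constantly equal to `u` (`histConst`), and let
`D η h = k₁ ∫₀^∞ g(s) ∫_{Ω₁} b ∇η(s)·∇h dx ds` (`memForm`). The two momentum equations together with
the transmission condition say exactly that `⟪W₂, J h⟫ + ⟪U₁, h⟫ + D U₃ h = 0` for all
`h ∈ ℍ¹_{∂Ω}`: the momentum equations are this identity for test functions supported in `Ω₁` or in
`Ω₂` (`transmission_iff`). So the graph of `𝒜` is the linear relation `memorySystem J Q D T`, with
`T η = -η_s` the generator of right translations on histories vanishing at `s = 0`
(`mem_genGraph`).

*Abstract system.* If `T` is maximal dissipative and `⟪η, Q h⟫ - D η h` is bounded by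
`c ‖η‖ ‖J h‖`, the relation is dissipative up to a bounded perturbation, and its resolvent equation
reduces to a coercive variational problem on `ℍ¹_{∂Ω}` (`quasiMaxDissipative_memorySystem`). Here
the difference of the two forms is `k₁ ∫₀^∞ g(s) ∫_{Ω₁} η(s) u dx ds`, which contains no gradient
(`exists_memForm_bound`).

*Concrete ingredients.* The operator `T` has the resolvent
`f ↦ ∫₀^s exp(-λ (s - r)) f(r) dr`; since `g` is non-increasing, this has norm at most `1 / λ` in
`L²_g` (`eLpNorm_expConv_le`), and letting `λ → ∞` gives dissipativity
(`maxDissipative_histGen`). The Poincaré inequality `‖(u, v)‖_{𝕃²} ≤ C ‖(∇u, ∇v)‖`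
(`exists_poincare`) gives the continuity of `J` and the completeness of `ℍ¹_{∂Ω}`; it is proved on
`ℝⁿ` by translating test functions out of the support of the extension of `(u, v)` by zero.

*Generation.* For a maximal dissipative relation `A` the semigroups generated by the Yosida
approximations converge to solutions of `dU/dt = A U` for data in the domain
(`MaxDissipative.exists_regular`). A quasi-dissipative relation is a shift of a dissipative one.
Mild solutions for arbitrary data come from regular ones through the resolvent
(`QuasiMaxDissipative.exists_isMildSol`); uniqueness holds because the time integral of the
difference of two mild solutions satisfies an energy inequality
(`QuasiMaxDissipative.eqOn_of_isMildSol`).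
-/

noncomputable section

open scoped ENNReal

/-! ### Generation theorem for quasi-dissipative relations in a Hilbert space -/

section HilleYosida

variable {E : Type*} [NormedAddCommGroup E] [InnerProductSpace ℝ E]

/-- The fundamental theorem of calculus on `[0,∞)`, one-sided at `0`. -/
theorem hasDerivWithinAt_integral_Ici {F : Type*} [NormedAddCommGroup F]
    [NormedSpace ℝ F] [CompleteSpace F] {f : ℝ → F} (hf : ContinuousOn f (Ici 0)) {t : ℝ}
    (ht : 0 ≤ t) : HasDerivWithinAt (fun t => ∫ s in (0 : ℝ)..t, f s) (f t) (Ici 0) t := by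
  set G : ℝ → F := fun s => f (max s 0)
  have hG : Continuous G :=
    hf.comp_continuous (by fun_prop) fun s => mem_Ici.2 (le_max_right s 0)
  have h1 := (hG.integral_hasStrictDerivAt 0 t).hasDerivAt.hasDerivWithinAt (s := Ici 0)
  have h2 : G t = f t := by simp [G, ht]
  rw [h2] at h1
  refine h1.congr (fun s hs => ?_) ?_ <;>
  · refine intervalIntegral.integral_congr fun r hr => ?_
    rw [uIcc_of_le (by assumption)] at hr
    simp [G, hr.1]

/-- A linear relation `A` in a Hilbert space (given by its graph) is *maximal dissipative* if it is
single-valued, `⟪A u, u⟫ ≤ 0`, and `λ - A` is onto for all `λ > 0`. -/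
structure MaxDissipative (A : Submodule ℝ (E × E)) : Prop where
  single : ∀ w, ((0 : E), w) ∈ A → w = 0
  dissip : ∀ p ∈ A, ⟪p.2, p.1⟫ ≤ 0
  range : ∀ lam : ℝ, 0 < lam → ∀ f, ∃ p ∈ A, lam • p.1 - p.2 = f

namespace MaxDissipative

variable {A : Submodule ℝ (E × E)}

theorem norm_le (hA : MaxDissipative A) {lam : ℝ} (hl : 0 < lam) {p : E × E} (hp : p ∈ A) :
    ‖p.1‖ ≤ lam⁻¹ * ‖lam • p.1 - p.2‖ := by
  have h1 := hA.dissip p hp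
  have h2 : lam * ‖p.1‖ ^ 2 ≤ ‖lam • p.1 - p.2‖ * ‖p.1‖ := by
    refine le_trans ?_ (real_inner_le_norm _ _)
    rw [inner_sub_left, inner_smul_left, real_inner_self_eq_norm_sq]
    simp only [conj_trivial]
    linarith
  rcases (norm_nonneg p.1).eq_or_lt' with h0 | h0
  · rw [h0]; positivity
  · rw [inv_mul_eq_div, le_div_iff₀ hl]
    nlinarith

theorem exists_resolvent (hA : MaxDissipative A) (lam : ℝ) (hl : 0 < lam) :
    ∃ R : E →L[ℝ] E, (∀ f, ‖R f‖ ≤ lam⁻¹ * ‖f‖) ∧ (∀ f, (R f, lam • R f - f) ∈ A) ∧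
      ∀ p ∈ A, R (lam • p.1 - p.2) = p.1 := by
  choose P hP hPf using hA.range lam hl
  have uniq : ∀ p ∈ A, ∀ q ∈ A, lam • p.1 - p.2 = lam • q.1 - q.2 → p.1 = q.1 := by
    intro p hp q hq h
    have := hA.norm_le hl (A.sub_mem hp hq)
    have h0 : lam • (p - q).1 - (p - q).2 = 0 := by
      rw [Prod.fst_sub, Prod.snd_sub, smul_sub]
      rw [← sub_eq_zero] at h
      rw [← h]; abel
    rw [h0, norm_zero, mul_zero] at this
    exact sub_eq_zero.1 (norm_le_zero_iff.1 this)
  let R : E →ₗ[ℝ] E :=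
    { toFun := fun f => (P f).1
      map_add' := fun f g => uniq _ (hP _) _ (A.add_mem (hP f) (hP g)) (by
        rw [hPf, Prod.fst_add, Prod.snd_add, smul_add, add_sub_add_comm, hPf, hPf])
      map_smul' := fun c f => uniq _ (hP _) _ (A.smul_mem c (hP f)) (by
        rw [hPf, Prod.smul_fst, Prod.smul_snd, smul_comm, ← smul_sub, hPf]) }
  have hR : ∀ f, R f = (P f).1 := fun f => rfl
  have hRb : ∀ f, ‖R f‖ ≤ lam⁻¹ * ‖f‖ := fun f => by
    have := hA.norm_le hl (hP f)
    rwa [hPf] at this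
  refine ⟨R.mkContinuous lam⁻¹ hRb, hRb, fun f => ?_, fun p hp => ?_⟩
  · have : (P f).2 = lam • (P f).1 - f := by
      have := hPf f
      rw [sub_eq_iff_eq_add] at this
      rw [this]; abel
    rw [LinearMap.mkContinuous_apply, hR, ← this]
    exact hP f
  · rw [LinearMap.mkContinuous_apply, hR]
    exact uniq _ (hP _) _ hp (hPf _)

/-- The resolvent `(λ - A)⁻¹`. -/
def res (hA : MaxDissipative A) (lam : ℝ) (hl : 0 < lam) : E →L[ℝ] E :=
  (hA.exists_resolvent lam hl).choose

theorem res_le (hA : MaxDissipative A) {lam : ℝ} (hl : 0 < lam) (f : E) :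
    ‖hA.res lam hl f‖ ≤ lam⁻¹ * ‖f‖ :=
  (hA.exists_resolvent lam hl).choose_spec.1 f

theorem res_mem (hA : MaxDissipative A) {lam : ℝ} (hl : 0 < lam) (f : E) :
    (hA.res lam hl f, lam • hA.res lam hl f - f) ∈ A :=
  (hA.exists_resolvent lam hl).choose_spec.2.1 f

theorem res_eq (hA : MaxDissipative A) {lam : ℝ} (hl : 0 < lam) {u w : E} (h : (u, w) ∈ A) :
    hA.res lam hl (lam • u - w) = u :=
  (hA.exists_resolvent lam hl).choose_spec.2.2 _ h

/-- The resolvent identity. -/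
theorem res_sub (hA : MaxDissipative A) {lam mu : ℝ} (hl : 0 < lam) (hm : 0 < mu) (f : E) :
    hA.res lam hl f - hA.res mu hm f = (mu - lam) • hA.res lam hl (hA.res mu hm f) := by
  have h := hA.res_eq hl (hA.res_mem hm f)
  rw [← sub_add, map_add, ← sub_smul, map_smul] at h
  rw [sub_eq_iff_eq_add, ← neg_sub lam mu, neg_smul, eq_neg_add_iff_add_eq]
  exact h

theorem res_comm (hA : MaxDissipative A) {lam mu : ℝ} (hl : 0 < lam) (hm : 0 < mu) (f : E) :
    hA.res lam hl (hA.res mu hm f) = hA.res mu hm (hA.res lam hl f) := by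
  rcases eq_or_ne lam mu with rfl | hne
  · rfl
  · have h1 := hA.res_sub hl hm f
    have h2 := hA.res_sub hm hl f
    rw [← neg_sub, h1, ← neg_smul, neg_sub] at h2
    exact smul_right_injective E (sub_ne_zero.2 hne) h2

/-- The relation is recovered from its resolvent. -/
theorem mem_iff (hA : MaxDissipative A) {u w : E} :
    (u, w) ∈ A ↔ hA.res 1 one_pos (u - w) = u := by
  constructor
  · intro h
    have := hA.res_eq one_pos h
    rwa [one_smul] at this
  · intro h
    have := hA.res_mem one_pos (u - w)
    rwa [h, one_smul, sub_sub_cancel] at this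

theorem isClosed (hA : MaxDissipative A) : IsClosed (A : Set (E × E)) := by
  have : (A : Set (E × E)) = {p | hA.res 1 one_pos (p.1 - p.2) = p.1} := by
    ext p; exact hA.mem_iff
  rw [this]
  exact isClosed_eq (by fun_prop) continuous_fst

/-- `J_n = (n+1) (n + 1 - A)⁻¹`. -/
def resN (hA : MaxDissipative A) (n : ℕ) : E →L[ℝ] E :=
  ((n : ℝ) + 1) • hA.res ((n : ℝ) + 1) n.cast_add_one_pos

theorem resN_le (hA : MaxDissipative A) (n : ℕ) (f : E) : ‖hA.resN n f‖ ≤ ‖f‖ := by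
  have h := n.cast_add_one_pos (α := ℝ)
  have := hA.res_le h f
  rw [resN, smul_apply, norm_smul, Real.norm_of_nonneg h.le]
  calc ((n : ℝ) + 1) * _ ≤ ((n : ℝ) + 1) * (((n : ℝ) + 1)⁻¹ * ‖f‖) := by gcongr
    _ = ‖f‖ := by field_simp

theorem resN_sub_self (hA : MaxDissipative A) (n : ℕ) {u w : E} (h : (u, w) ∈ A) :
    hA.resN n u - u = hA.res ((n : ℝ) + 1) n.cast_add_one_pos w := by
  have := hA.res_eq n.cast_add_one_pos h
  rw [map_sub, map_smul] at this
  nth_rw 2 [← this]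
  rw [resN, smul_apply]
  abel

/-- The Yosida approximation `A_n = A J_n = (n+1) (J_n - 1)`. -/
def yosida (hA : MaxDissipative A) (n : ℕ) : E →L[ℝ] E :=
  ((n : ℝ) + 1) • (hA.resN n - 1)

theorem yosida_mem (hA : MaxDissipative A) (n : ℕ) (f : E) :
    (hA.resN n f, hA.yosida n f) ∈ A := by
  have := A.smul_mem ((n : ℝ) + 1) (hA.res_mem n.cast_add_one_pos f)
  simpa [resN, yosida, smul_sub] using this

theorem yosida_eq (hA : MaxDissipative A) (n : ℕ) {u w : E} (h : (u, w) ∈ A) :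
    hA.yosida n u = hA.resN n w := by
  have := hA.resN_sub_self n h
  simp only [yosida, resN, smul_apply, sub_apply,
    one_apply_eq_self] at this ⊢
  rw [this]

theorem resN_commute (hA : MaxDissipative A) (n m : ℕ) : Commute (hA.resN n) (hA.resN m) := by
  refine (Commute.smul_right (Commute.smul_left ?_ _) _)
  ext f
  exact hA.res_comm _ _ f

theorem yosida_commute (hA : MaxDissipative A) (n m : ℕ) :
    Commute (hA.yosida n) (hA.yosida m) := by
  refine (Commute.smul_right (Commute.smul_left ?_ _) _)
  exact ((hA.resN_commute n m).sub_right (Commute.one_right _)).sub_left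
    ((Commute.one_left _).sub_right (Commute.one_left _))

theorem inner_yosida_nonpos (hA : MaxDissipative A) (n : ℕ) (f : E) :
    ⟪hA.yosida n f, f⟫ ≤ 0 := by
  have h1 := real_inner_le_norm (hA.resN n f) f
  have h2 := hA.resN_le n f
  have h3 : 0 ≤ (n : ℝ) + 1 := by positivity
  simp only [yosida, smul_apply, sub_apply, one_apply_eq_self, inner_smul_left, inner_sub_left,
    real_inner_self_eq_norm_sq, conj_trivial]
  refine mul_nonpos_of_nonneg_of_nonpos h3 ?_
  nlinarith [norm_nonneg f]

/-- The group generated by the Yosida approximation. -/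
def expY (hA : MaxDissipative A) (n : ℕ) (t : ℝ) : E →L[ℝ] E :=
  NormedSpace.exp (t • hA.yosida n)

theorem expY_zero (hA : MaxDissipative A) (n : ℕ) : hA.expY n 0 = 1 := by
  simp [expY]

theorem yosida_commute_expY (hA : MaxDissipative A) (m n : ℕ) (t : ℝ) :
    Commute (hA.yosida m) (hA.expY n t) :=
  ((hA.yosida_commute m n).smul_right t).exp_right

variable [CompleteSpace E]

/-- The domain is dense: a vector `f` orthogonal to it satisfies `⟪f, (1 - A)⁻¹ f⟫ = 0`, which
forces `(1 - A)⁻¹ f = 0`. -/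
theorem dense_domain (hA : MaxDissipative A) : Dense {u : E | ∃ w, (u, w) ∈ A} := by
  have key : (A.map (LinearMap.fst ℝ E E))ᗮ = ⊥ := by
    rw [Submodule.eq_bot_iff]
    intro f hf
    rw [Submodule.mem_orthogonal] at hf
    have hm := hA.res_mem one_pos f
    set u := hA.res 1 one_pos f
    have h1 := hf u ⟨_, hm, rfl⟩
    have h2 := hA.dissip _ hm
    simp only [one_smul, inner_sub_left, real_inner_self_eq_norm_sq] at h2
    rw [real_inner_comm] at h1
    have h3 : u = 0 := by
      rw [← norm_eq_zero]
      nlinarith [norm_nonneg u]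
    rw [h3, smul_zero, zero_sub] at hm
    exact neg_eq_zero.1 (hA.single _ hm)
  have := (Submodule.topologicalClosure_eq_top_iff (K := A.map (LinearMap.fst ℝ E E))).2 key
  rw [← Submodule.dense_iff_topologicalClosure_eq_top] at this
  refine this.mono ?_
  rintro _ ⟨p, hp, rfl⟩
  exact ⟨p.2, hp⟩

/-- On the domain `J_n - 1 = (n + 1 - A)⁻¹ A` is of order `1 / (n + 1)`; as `J_n` is a contraction
and the domain is dense, `J_n → 1` strongly. -/
theorem tendsto_resN (hA : MaxDissipative A) (z : E) :
    Tendsto (fun n => hA.resN n z) atTop (𝓝 z) := by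
  rw [Metric.tendsto_atTop]
  intro ε hε
  obtain ⟨u, ⟨w, hw⟩, hu⟩ := hA.dense_domain.exists_dist_lt z (show 0 < ε / 3 by positivity)
  obtain ⟨N, hN⟩ := exists_nat_gt (‖w‖ / (ε / 3))
  refine ⟨N, fun n hn => ?_⟩
  have hn' : (N : ℝ) ≤ n := by exact_mod_cast hn
  have h1 : ‖hA.resN n u - u‖ < ε / 3 := by
    rw [hA.resN_sub_self n hw]
    refine (hA.res_le _ w).trans_lt ?_
    rw [inv_mul_eq_div, div_lt_iff₀ (by positivity)]
    rw [div_lt_iff₀ (by positivity)] at hN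
    nlinarith
  have h2 := hA.resN_le n (z - u)
  rw [dist_eq_norm] at hu ⊢
  calc ‖hA.resN n z - z‖ = ‖hA.resN n (z - u) + (hA.resN n u - u) - (z - u)‖ := by
        rw [map_sub]; congr 1; abel
    _ ≤ ‖hA.resN n (z - u)‖ + ‖hA.resN n u - u‖ + ‖z - u‖ :=
        (norm_sub_le _ _).trans (by gcongr; exact norm_add_le _ _)
    _ < ε := by linarith

theorem hasDerivAt_expY (hA : MaxDissipative A) (n : ℕ) (t : ℝ) :
    HasDerivAt (hA.expY n) (hA.expY n t * hA.yosida n) t :=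
  hasDerivAt_exp_smul_const (hA.yosida n) t

theorem hasDerivAt_expY_apply (hA : MaxDissipative A) (n : ℕ) (t : ℝ) (f : E) :
    HasDerivAt (fun t => hA.expY n t f) (hA.expY n t (hA.yosida n f)) t :=
  (hA.hasDerivAt_expY n t).clm_apply (hasDerivAt_const t f) |>.congr_deriv (by simp)

theorem continuous_expY_apply (hA : MaxDissipative A) (n : ℕ) (f : E) :
    Continuous fun t => hA.expY n t f :=
  continuous_iff_continuousAt.2 fun t => (hA.hasDerivAt_expY_apply n t f).continuousAt

theorem expY_le (hA : MaxDissipative A) (n : ℕ) {t : ℝ} (ht : 0 ≤ t) (f : E) :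
    ‖hA.expY n t f‖ ≤ ‖f‖ := by
  have hd : ∀ s, HasDerivAt (fun s => ‖hA.expY n s f‖ ^ 2)
      (2 * ⟪hA.expY n s f, hA.expY n s (hA.yosida n f)⟫) s := fun s =>
    (hA.hasDerivAt_expY_apply n s f).norm_sq
  have hanti : Antitone fun s => ‖hA.expY n s f‖ ^ 2 :=
    antitone_of_hasDerivAt_nonpos hd fun s => by
      have h1 := hA.inner_yosida_nonpos n (hA.expY n s f)
      have h2 : hA.yosida n (hA.expY n s f) = hA.expY n s (hA.yosida n f) :=
        DFunLike.congr_fun (hA.yosida_commute_expY n n s) f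
      rw [h2, real_inner_comm] at h1
      exact mul_nonpos_of_nonneg_of_nonpos zero_le_two h1
  have := hanti ht
  simp only [hA.expY_zero, one_apply_eq_self] at this
  exact (sq_le_sq₀ (norm_nonneg _) (norm_nonneg _)).1 this

/-- Two Yosida groups are compared by differentiating `exp(s A_n) exp((t - s) A_m) f` in `s`; as the
approximations commute, the derivative is `exp(s A_n) exp((t - s) A_m) (A_n - A_m) f`. -/
theorem expY_sub_le (hA : MaxDissipative A) (n m : ℕ) {t : ℝ} (ht : 0 ≤ t) (f : E) :
    ‖hA.expY n t f - hA.expY m t f‖ ≤ t * ‖hA.yosida n f - hA.yosida m f‖ := by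
  set F : ℝ → E := fun s => hA.expY n s (hA.expY m (t - s) f)
  have hd : ∀ s, HasDerivAt F
      (hA.expY n s (hA.expY m (t - s) (hA.yosida n f - hA.yosida m f))) s := by
    intro s
    have h1 : HasDerivAt (fun s => hA.expY m (t - s) f)
        (-(hA.expY m (t - s) (hA.yosida m f))) s := by
      have := (hA.hasDerivAt_expY_apply m (t - s) f).scomp s ((hasDerivAt_id s).const_sub t)
      simpa [Function.comp_def] using this
    refine ((hA.hasDerivAt_expY n s).clm_apply h1).congr_deriv ?_
    have h2 : hA.yosida n (hA.expY m (t - s) f) = hA.expY m (t - s) (hA.yosida n f) :=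
      DFunLike.congr_fun (hA.yosida_commute_expY n m (t - s)) f
    simp only [mul_apply_eq_comp, h2, map_neg, map_sub]
    abel
  have := norm_image_sub_le_of_norm_deriv_le_segment' (f := F) (a := 0) (b := t)
    (C := ‖hA.yosida n f - hA.yosida m f‖) (fun s _ => (hd s).hasDerivWithinAt)
    (fun s hs => (hA.expY_le n hs.1 _).trans (hA.expY_le m (sub_nonneg.2 hs.2.le) _)) t
    (right_mem_Icc.2 ht)
  simpa [F, hA.expY_zero, mul_comm] using this

theorem uniformCauchySeqOn_expY (hA : MaxDissipative A) (z : E) (T : ℝ) :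
    UniformCauchySeqOn (fun n t => hA.expY n t z) atTop (Icc 0 T) := by
  rw [Metric.uniformCauchySeqOn_iff]
  intro ε hε
  rcases lt_or_ge T 0 with hT | hT
  · exact ⟨0, fun m _ n _ x hx => absurd (hx.1.trans hx.2) (not_le.2 hT)⟩
  obtain ⟨u, ⟨w, hw⟩, hu⟩ := hA.dense_domain.exists_dist_lt z (show 0 < ε / 3 by positivity)
  have hcs := (hA.tendsto_resN w).cauchySeq
  rw [Metric.cauchySeq_iff] at hcs
  obtain ⟨N, hN⟩ := hcs (ε / 3 / (T + 1)) (by positivity)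
  refine ⟨N, fun m hm n hn t ht => ?_⟩
  have h1 := hN m hm n hn
  rw [dist_eq_norm, ← hA.yosida_eq m hw, ← hA.yosida_eq n hw] at h1
  have h2 : ‖hA.expY m t u - hA.expY n t u‖ < ε / 3 := by
    refine (hA.expY_sub_le m n ht.1 u).trans_lt ?_
    rw [lt_div_iff₀ (by positivity)] at h1
    nlinarith [norm_nonneg (hA.yosida m u - hA.yosida n u), ht.2]
  have h3 := hA.expY_le m ht.1 (z - u)
  have h4 := hA.expY_le n ht.1 (z - u)
  rw [dist_eq_norm] at hu ⊢
  calc ‖hA.expY m t z - hA.expY n t z‖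
      = ‖hA.expY m t (z - u) + (hA.expY m t u - hA.expY n t u) - hA.expY n t (z - u)‖ := by
        rw [map_sub, map_sub]; congr 1; abel
    _ ≤ ‖hA.expY m t (z - u)‖ + ‖hA.expY m t u - hA.expY n t u‖ + ‖hA.expY n t (z - u)‖ :=
        (norm_sub_le _ _).trans (by gcongr; exact norm_add_le _ _)
    _ < ε := by linarith

/-- The semigroup generated by `A`, as the limit of the groups of the Yosida approximations. -/
theorem exists_semigroup_limit (hA : MaxDissipative A) (z : E) :
    ∃ S : ℝ → E, ContinuousOn S (Ici 0) ∧
      ∀ t, 0 ≤ t → Tendsto (fun n => hA.expY n t z) atTop (𝓝 (S t)) := by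
  have h : ∀ t, ∃ s, 0 ≤ t → Tendsto (fun n => hA.expY n t z) atTop (𝓝 s) := by
    intro t
    by_cases ht : 0 ≤ t
    · have := (hA.uniformCauchySeqOn_expY z t).cauchySeq ⟨ht, le_rfl⟩
      obtain ⟨s, hs⟩ := cauchySeq_tendsto_of_complete this
      exact ⟨s, fun _ => hs⟩
    · exact ⟨0, fun h => absurd h ht⟩
  choose S hS using h
  refine ⟨S, fun t ht => ?_, hS⟩
  have hu := (hA.uniformCauchySeqOn_expY z (t + 1)).tendstoUniformlyOn_of_tendsto
    fun s hs => hS s hs.1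
  have hc : ContinuousOn S (Icc 0 (t + 1)) :=
    hu.continuousOn (Frequently.of_forall fun n => (hA.continuous_expY_apply n z).continuousOn)
  have hmem : Icc 0 (t + 1) ∈ 𝓝[Ici 0] t := by
    rw [← Ici_inter_Iic]
    exact inter_mem self_mem_nhdsWithin (mem_nhdsWithin_of_mem_nhds (Iic_mem_nhds (by linarith)))
  exact (hc t ⟨ht, by linarith⟩).mono_of_mem_nhdsWithin hmem

/-- Data in the domain produce `C¹` solutions. -/
theorem exists_regular (hA : MaxDissipative A) {y w : E} (hy : (y, w) ∈ A) :
    ∃ v v' : ℝ → E, v 0 = y ∧ ContinuousOn v' (Ici 0) ∧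
      (∀ t, 0 ≤ t → HasDerivWithinAt v (v' t) (Ici 0) t) ∧ ∀ t, 0 ≤ t → (v t, v' t) ∈ A := by
  obtain ⟨S, hSc, hS⟩ := hA.exists_semigroup_limit w
  -- `exp(t A_n) A_n y` has the same limit as `exp(t A_n) w`
  have hS' : ∀ t, 0 ≤ t → Tendsto (fun n => hA.expY n t (hA.yosida n y)) atTop (𝓝 (S t)) := by
    intro t ht
    have h0 : Tendsto (fun n => hA.expY n t (hA.yosida n y - w)) atTop (𝓝 0) := by
      refine squeeze_zero_norm (fun n => hA.expY_le n ht _) ?_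
      have : Tendsto (fun n => hA.yosida n y - w) atTop (𝓝 0) := by
        simp only [fun n => hA.yosida_eq n hy]
        simpa using (hA.tendsto_resN w).sub_const w
      simpa using this.norm
    simpa using (hS t ht).add h0
  have hint : ∀ n t, hA.expY n t y = y + ∫ s in (0 : ℝ)..t, hA.expY n s (hA.yosida n y) := by
    intro n t
    rw [intervalIntegral.integral_eq_sub_of_hasDerivAt
      (fun s _ => hA.hasDerivAt_expY_apply n s y)
      ((hA.continuous_expY_apply n _).intervalIntegrable _ _)]
    simp [hA.expY_zero]
  have hlim : ∀ t, 0 ≤ t →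
      Tendsto (fun n => hA.expY n t y) atTop (𝓝 (y + ∫ s in (0 : ℝ)..t, S s)) := by
    intro t ht
    simp only [hint]
    refine Tendsto.const_add _ ?_
    refine intervalIntegral.tendsto_integral_filter_of_dominated_convergence (fun _ => ‖w‖)
      (Eventually.of_forall fun n => (hA.continuous_expY_apply n _).aestronglyMeasurable)
      (Eventually.of_forall fun n => ae_of_all _ fun s hs => ?_) intervalIntegrable_const
      (ae_of_all _ fun s hs => ?_)
    · rw [uIoc_of_le ht] at hs
      refine (hA.expY_le n hs.1.le _).trans ?_
      rw [hA.yosida_eq n hy]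
      exact hA.resN_le n w
    · rw [uIoc_of_le ht] at hs
      exact hS' s hs.1.le
  refine ⟨fun t => y + ∫ s in (0 : ℝ)..t, S s, S, by simp, hSc, fun t ht => ?_, fun t ht => ?_⟩
  · exact (hasDerivWithinAt_integral_Ici hSc ht).const_add y
  · have hJ : Tendsto (fun n => hA.resN n (hA.expY n t y)) atTop
        (𝓝 (y + ∫ s in (0 : ℝ)..t, S s)) := by
      set v := y + ∫ s in (0 : ℝ)..t, S s
      have h0 : Tendsto (fun n => hA.resN n (hA.expY n t y - v)) atTop (𝓝 0) := by
        refine squeeze_zero_norm (fun n => hA.resN_le n _) ?_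
        rw [← norm_zero (E := E), ← sub_self v]
        exact ((hlim t ht).sub_const v).norm
      simpa using (hA.tendsto_resN v).add h0
    have hY : Tendsto (fun n => hA.yosida n (hA.expY n t y)) atTop (𝓝 (S t)) := by
      have : ∀ n, hA.yosida n (hA.expY n t y) = hA.expY n t (hA.yosida n y) := fun n =>
        DFunLike.congr_fun (hA.yosida_commute_expY n n t) y
      simpa only [this] using hS' t ht
    exact hA.isClosed.mem_of_tendsto (hJ.prodMk_nhds hY)
      (Eventually.of_forall fun n => hA.yosida_mem n _)

theorem integral_mem (hA : MaxDissipative A) {u w : ℝ → E} {t : ℝ} (ht : 0 ≤ t)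
    (hu : ContinuousOn u (Ici 0)) (hw : ContinuousOn w (Ici 0))
    (h : ∀ s, 0 ≤ s → (u s, w s) ∈ A) :
    (∫ s in (0 : ℝ)..t, u s, ∫ s in (0 : ℝ)..t, w s) ∈ A := by
  have hsub : uIcc 0 t ⊆ Ici 0 := by rw [uIcc_of_le ht]; exact Icc_subset_Ici_self
  have iu : IntervalIntegrable u volume 0 t := (hu.mono hsub).intervalIntegrable
  have iw : IntervalIntegrable w volume 0 t := (hw.mono hsub).intervalIntegrable
  rw [hA.mem_iff, ← intervalIntegral.integral_sub iu iw,
    ← ContinuousLinearMap.intervalIntegral_comp_comm _ (iu.sub iw)]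
  exact intervalIntegral.integral_congr fun s hs => hA.mem_iff.1 (h s (hsub hs))

end MaxDissipative

/-- A single-valued linear relation with `⟪A u, u⟫ ≤ κ ‖u‖²` such that `λ - A` is onto for all
`λ > κ`. -/
structure QuasiMaxDissipative (A : Submodule ℝ (E × E)) (κ : ℝ) : Prop where
  single : ∀ w, ((0 : E), w) ∈ A → w = 0
  dissip : ∀ p ∈ A, ⟪p.2, p.1⟫ ≤ κ * ‖p.1‖ ^ 2
  range : ∀ lam : ℝ, κ < lam → ∀ f, ∃ p ∈ A, lam • p.1 - p.2 = f

/-- `U` is a mild solution of `dU/dt = A U`, `U(0) = x`, on `[0,∞)`. -/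
structure IsMildSol (A : Submodule ℝ (E × E)) (x : E) (U : ℝ → E) : Prop where
  continuousOn : ContinuousOn U (Ici 0)
  initial : U 0 = x
  integral_mem : ∀ t, 0 ≤ t → (∫ s in (0 : ℝ)..t, U s, U t - x) ∈ A

namespace QuasiMaxDissipative

variable {A : Submodule ℝ (E × E)} {κ : ℝ}

/-- The relation `A - κ`. -/
def shift (A : Submodule ℝ (E × E)) (κ : ℝ) : Submodule ℝ (E × E) :=
  A.comap ((LinearMap.fst ℝ E E).prod (LinearMap.snd ℝ E E + κ • LinearMap.fst ℝ E E))

theorem mem_shift {u w : E} : (u, w) ∈ shift A κ ↔ (u, w + κ • u) ∈ A := Iff.rfl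

theorem maxDissipative_shift (hA : QuasiMaxDissipative A κ) : MaxDissipative (shift A κ) where
  single w hw := by
    rw [mem_shift, smul_zero, add_zero] at hw
    exact hA.single w hw
  dissip := by
    rintro ⟨u, w⟩ hp
    have := hA.dissip _ (mem_shift.1 hp)
    simp only [inner_add_left, inner_smul_left, real_inner_self_eq_norm_sq, conj_trivial] at this
    simpa using this
  range lam hl f := by
    obtain ⟨⟨u, w⟩, hp, h⟩ := hA.range (lam + κ) (by linarith) f
    refine ⟨(u, w - κ • u), ?_, ?_⟩
    · rw [mem_shift, sub_add_cancel]; exact hp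
    · rw [← h]; simp only [add_smul]; abel

variable [CompleteSpace E]

theorem integral_mem (hA : QuasiMaxDissipative A κ) {u w : ℝ → E} {t : ℝ} (ht : 0 ≤ t)
    (hu : ContinuousOn u (Ici 0)) (hw : ContinuousOn w (Ici 0))
    (h : ∀ s, 0 ≤ s → (u s, w s) ∈ A) :
    (∫ s in (0 : ℝ)..t, u s, ∫ s in (0 : ℝ)..t, w s) ∈ A := by
  have hsub : uIcc 0 t ⊆ Ici 0 := by rw [uIcc_of_le ht]; exact Icc_subset_Ici_self
  have hcu : ContinuousOn (fun s => κ • u s) (Ici 0) := hu.const_smul κ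
  have h1 := hA.maxDissipative_shift.integral_mem (w := fun s => w s - κ • u s) ht hu (hw.sub hcu)
    fun s hs => mem_shift.2 (by rw [sub_add_cancel]; exact h s hs)
  rw [mem_shift, intervalIntegral.integral_sub (hw.mono hsub).intervalIntegrable
    (hcu.mono hsub).intervalIntegrable, intervalIntegral.integral_smul,
    sub_add_cancel] at h1
  exact h1

theorem exists_regular (hA : QuasiMaxDissipative A κ) {y w : E} (hy : (y, w) ∈ A) :
    ∃ v v' : ℝ → E, v 0 = y ∧ ContinuousOn v' (Ici 0) ∧
      (∀ t, 0 ≤ t → HasDerivWithinAt v (v' t) (Ici 0) t) ∧ ∀ t, 0 ≤ t → (v t, v' t) ∈ A := by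
  have hy' : (y, w - κ • y) ∈ shift A κ := mem_shift.2 (by rw [sub_add_cancel]; exact hy)
  obtain ⟨v, v', h0, hc, hd, hm⟩ := hA.maxDissipative_shift.exists_regular hy'
  have hvc : ContinuousOn v (Ici 0) := fun t ht => (hd t ht).continuousWithinAt
  have he : Continuous fun t : ℝ => Real.exp (κ * t) := by fun_prop
  refine ⟨fun t => Real.exp (κ * t) • v t, fun t => Real.exp (κ * t) • (v' t + κ • v t),
    by simp [h0], he.continuousOn.smul (hc.add (hvc.const_smul κ)), fun t ht => ?_,
    fun t ht => A.smul_mem (Real.exp (κ * t)) (mem_shift.1 (hm t ht))⟩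
  have h1 : HasDerivAt (fun t : ℝ => Real.exp (κ * t)) (Real.exp (κ * t) * κ) t := by
    simpa using ((hasDerivAt_id t).const_mul κ).exp
  refine (h1.hasDerivWithinAt.smul (hd t ht)).congr_deriv ?_
  simp only [smul_add, smul_smul]

theorem integral_deriv_eq {v v' : ℝ → E} (hc : ContinuousOn v' (Ici 0))
    (hd : ∀ t, 0 ≤ t → HasDerivWithinAt v (v' t) (Ici 0) t) {t : ℝ} (ht : 0 ≤ t) :
    ∫ s in (0 : ℝ)..t, v' s = v t - v 0 := by
  have hsub : Icc 0 t ⊆ Ici 0 := Icc_subset_Ici_self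
  refine intervalIntegral.integral_eq_sub_of_hasDerivAt_of_le ht
    (fun s hs => (hd s hs.1).continuousWithinAt.mono hsub)
    (fun s hs => (hd s hs.1.le).hasDerivAt (Ici_mem_nhds hs.1)) ?_
  exact ContinuousOn.intervalIntegrable (by rw [uIcc_of_le ht]; exact hc.mono hsub)

theorem isMildSol_of_regular (hA : QuasiMaxDissipative A κ) {v v' : ℝ → E}
    (hc : ContinuousOn v' (Ici 0)) (hd : ∀ t, 0 ≤ t → HasDerivWithinAt v (v' t) (Ici 0) t)
    (hm : ∀ t, 0 ≤ t → (v t, v' t) ∈ A) : IsMildSol A (v 0) v where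
  continuousOn := fun t ht => (hd t ht).continuousWithinAt
  initial := rfl
  integral_mem t ht := by
    rw [← integral_deriv_eq hc hd ht]
    exact hA.integral_mem ht (fun t ht => (hd t ht).continuousWithinAt) hc hm

/-- Mild solutions exist for all data: if `v` is the `C¹` solution with `(c - A) v(0) = x`, then
`(c - A) v = c v - v'` is the mild solution starting at `x`. -/
theorem exists_isMildSol (hA : QuasiMaxDissipative A κ) (x : E) : ∃ U, IsMildSol A x U := by
  set c := κ + 1
  obtain ⟨⟨y, w⟩, hy, hx⟩ := hA.range c (lt_add_one κ) x
  obtain ⟨v, v', h0, hc, hd, hm⟩ := hA.exists_regular hy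
  have hvc : ContinuousOn v (Ici 0) := fun t ht => (hd t ht).continuousWithinAt
  have hw : v' 0 = w := by
    have := A.sub_mem (hm 0 le_rfl) hy
    rw [h0, Prod.mk_sub_mk, sub_self] at this
    exact sub_eq_zero.1 (hA.single _ this)
  refine ⟨fun t => c • v t - v' t, (hvc.const_smul c).sub hc, by rw [h0, hw]; exact hx,
    fun t ht => ?_⟩
  have hsub : uIcc 0 t ⊆ Ici 0 := by rw [uIcc_of_le ht]; exact Icc_subset_Ici_self
  have hcv : ContinuousOn (fun s => c • v s) (Ici 0) := hvc.const_smul c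
  have h1 := (hA.isMildSol_of_regular hc hd hm).integral_mem t ht
  have h2 := A.sub_mem (A.smul_mem c h1) (A.sub_mem (hm t ht) hy)
  rw [intervalIntegral.integral_sub (hcv.mono hsub).intervalIntegrable
    (hc.mono hsub).intervalIntegrable, intervalIntegral.integral_smul, integral_deriv_eq hc hd ht]
  convert h2 using 1
  rw [← hx]
  ext1
  · simp [h0]
  · simp only [h0, Prod.snd_sub, Prod.smul_snd, smul_sub]; abel

/-- Mild solutions are unique: the integral of the difference of two of them is a `C¹` solution
vanishing at `0`. -/
theorem eqOn_of_isMildSol (hA : QuasiMaxDissipative A κ) {x : E} {U U' : ℝ → E}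
    (h : IsMildSol A x U) (h' : IsMildSol A x U') : EqOn U' U (Ici 0) := by
  set W : ℝ → E := fun t => U' t - U t
  have hW : ContinuousOn W (Ici 0) := h'.continuousOn.sub h.continuousOn
  set I : ℝ → E := fun t => ∫ s in (0 : ℝ)..t, W s
  have hI : ∀ t, 0 ≤ t → HasDerivWithinAt I (W t) (Ici 0) t := fun t ht =>
    hasDerivWithinAt_integral_Ici hW ht
  have hmem : ∀ t, 0 ≤ t → (I t, W t) ∈ A := by
    intro t ht
    have hsub : uIcc 0 t ⊆ Ici 0 := by rw [uIcc_of_le ht]; exact Icc_subset_Ici_self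
    have := A.sub_mem (h'.integral_mem t ht) (h.integral_mem t ht)
    rw [Prod.mk_sub_mk, sub_sub_sub_cancel_right, ← intervalIntegral.integral_sub
      (h'.continuousOn.mono hsub).intervalIntegrable
      (h.continuousOn.mono hsub).intervalIntegrable] at this
    exact this
  -- the energy `exp(-2κt) ‖I(t)‖²` is non-increasing and vanishes at `0`
  set F : ℝ → ℝ := fun t => Real.exp (-(2 * κ) * t) * ‖I t‖ ^ 2
  have hF : ∀ t, 0 ≤ t → HasDerivWithinAt F
      (Real.exp (-(2 * κ) * t) * (-(2 * κ)) * ‖I t‖ ^ 2 +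
        Real.exp (-(2 * κ) * t) * (2 * ⟪I t, W t⟫)) (Ici 0) t := by
    intro t ht
    have h1 : HasDerivAt (fun t : ℝ => Real.exp (-(2 * κ) * t))
        (Real.exp (-(2 * κ) * t) * (-(2 * κ))) t := by
      simpa using ((hasDerivAt_id t).const_mul (-(2 * κ))).exp
    exact h1.hasDerivWithinAt.mul (hI t ht).norm_sq
  have hanti : AntitoneOn F (Ici 0) := by
    refine antitoneOn_of_hasDerivWithinAt_nonpos (convex_Ici 0)
      (fun t ht => (hF t ht).continuousWithinAt)
      (fun t ht => (hF t (interior_subset ht)).mono interior_subset) fun t ht => ?_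
    have h1 := hA.dissip _ (hmem t (interior_subset ht))
    rw [real_inner_comm] at h1
    have h2 := Real.exp_pos (-(2 * κ) * t)
    simp only at h1
    nlinarith
  have hI0 : ∀ t ∈ Ici (0 : ℝ), I t = 0 := by
    intro t ht
    have h1 := hanti self_mem_Ici ht ht
    have h2 : F 0 = 0 := by simp [F, I]
    rw [h2] at h1
    have h3 : ‖I t‖ ^ 2 ≤ 0 := by
      by_contra hc
      exact absurd h1 (not_le.2 (mul_pos (Real.exp_pos _) (not_le.1 hc)))
    exact norm_eq_zero.1 (pow_eq_zero_iff two_ne_zero |>.1 (le_antisymm h3 (by positivity)))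
  intro t ht
  have h1 : HasDerivWithinAt I 0 (Ici 0) t :=
    (hasDerivWithinAt_const t (Ici 0) (0 : E)).congr hI0 (hI0 t ht)
  have h2 : W t = 0 := (uniqueDiffOn_Ici 0 t ht).eq_deriv _ (hI t ht) h1
  exact sub_eq_zero.1 h2

end QuasiMaxDissipative

end HilleYosida

/-! ### Abstract second order systems with memory -/

section MemorySystem

variable {H L G : Type*} [NormedAddCommGroup H] [InnerProductSpace ℝ H]
  [NormedAddCommGroup L] [InnerProductSpace ℝ L] [NormedAddCommGroup G] [InnerProductSpace ℝ G]

/-- The inner product of a real inner product space as a continuous bilinear map. -/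
def innerBilin (E : Type*) [NormedAddCommGroup E] [InnerProductSpace ℝ E] : E →L[ℝ] E →L[ℝ] ℝ :=
  (isBoundedBilinearMap_inner (𝕜 := ℝ) (E := E)).toContinuousLinearMap

/-- The evolution `u'' + u + D η = 0` (weakly, in the pivot space `L` of `J : H → L`) coupled to
`η' = Q u' + T η`, as a first order linear relation: the pair `(U, W)`, with `U = (u₁, u₂, η)`,
belongs to it if `W = (w₁, w₂, w₃)` with `u₂ = J w₁`, `⟪w₂, J h⟫ + ⟪u₁, h⟫ + D η h = 0` for all `h`
and `w₃ - Q w₁ = T η`. -/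
def memorySystem (J : H →L[ℝ] L) (Q : H →L[ℝ] G) (D : G →L[ℝ] H →L[ℝ] ℝ)
    (T : Submodule ℝ (G × G)) :
    Submodule ℝ (WithLp 2 (H × WithLp 2 (L × G)) × WithLp 2 (H × WithLp 2 (L × G))) where
  carrier := {p | J p.2.fst = p.1.snd.fst ∧
    (∀ h, ⟪p.2.snd.fst, J h⟫ + ⟪p.1.fst, h⟫ + D p.1.snd.snd h = 0) ∧
    (p.1.snd.snd, p.2.snd.snd - Q p.2.fst) ∈ T}
  add_mem' := by
    rintro p q ⟨h1, h2, h3⟩ ⟨h1', h2', h3'⟩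
    refine ⟨?_, fun h => ?_, ?_⟩
    · simp [h1, h1']
    · have a := h2 h
      have b := h2' h
      simp only [Prod.fst_add, Prod.snd_add, WithLp.add_fst, WithLp.add_snd, inner_add_left,
        map_add, add_apply]
      linarith
    · have := T.add_mem h3 h3'
      simp only [Prod.mk_add_mk] at this
      simp only [Prod.fst_add, Prod.snd_add, WithLp.add_fst, WithLp.add_snd, map_add]
      convert this using 2
      abel
  zero_mem' := by
    refine ⟨by simp, fun h => by simp, ?_⟩
    simp only [Prod.fst_zero, Prod.snd_zero, WithLp.zero_fst, WithLp.zero_snd, map_zero, sub_zero]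
    exact T.zero_mem
  smul_mem' := by
    rintro c p ⟨h1, h2, h3⟩
    refine ⟨?_, fun h => ?_, ?_⟩
    · simp [h1]
    · have a := h2 h
      simp only [Prod.smul_fst, Prod.smul_snd, WithLp.smul_fst, WithLp.smul_snd, inner_smul_left,
        map_smul, smul_apply, smul_eq_mul, conj_trivial]
      linear_combination c * a
    · have := T.smul_mem c h3
      simpa [smul_sub] using this

variable {J : H →L[ℝ] L} {Q : H →L[ℝ] G} {D : G →L[ℝ] H →L[ℝ] ℝ} {T : Submodule ℝ (G × G)}

theorem mem_memorySystem {U W : WithLp 2 (H × WithLp 2 (L × G))} :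
    (U, W) ∈ memorySystem J Q D T ↔ J W.fst = U.snd.fst ∧
      (∀ h, ⟪W.snd.fst, J h⟫ + ⟪U.fst, h⟫ + D U.snd.snd h = 0) ∧
      (U.snd.snd, W.snd.snd - Q W.fst) ∈ T := Iff.rfl

/-- Testing the variational identity with `h = w₁` cancels `⟪w₁, u₁⟫`; of the two memory terms only
`⟪Q w₁, η⟫ - D η w₁` remains, which is controlled by `‖η‖ ‖u₂‖`. -/
theorem memorySystem_dissip (hT : MaxDissipative T) {c : ℝ} (hc : 0 ≤ c)
    (hD : ∀ η h, |⟪η, Q h⟫ - D η h| ≤ c * ‖η‖ * ‖J h‖)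
    {U W : WithLp 2 (H × WithLp 2 (L × G))} (h : (U, W) ∈ memorySystem J Q D T) :
    ⟪W, U⟫ ≤ c * ‖U‖ ^ 2 := by
  obtain ⟨h1, h2, h3⟩ := mem_memorySystem.1 h
  have e1 := h2 W.fst
  have e2 := hT.dissip _ h3
  have e3 := le_of_abs_le (hD U.snd.snd W.fst)
  rw [h1] at e1 e3
  simp only [inner_sub_left] at e2
  have n1 : ‖U.snd‖ ^ 2 = ‖U.snd.fst‖ ^ 2 + ‖U.snd.snd‖ ^ 2 := WithLp.prod_norm_sq_eq_of_L2 _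
  have n2 : ‖U‖ ^ 2 = ‖U.fst‖ ^ 2 + ‖U.snd‖ ^ 2 := WithLp.prod_norm_sq_eq_of_L2 _
  have e4 : ⟪W, U⟫ = ⟪W.fst, U.fst⟫ + (⟪W.snd.fst, U.snd.fst⟫ + ⟪W.snd.snd, U.snd.snd⟫) := by
    rw [WithLp.prod_inner_apply]
    congr 1
  have e5 : ‖U.snd.snd‖ * ‖U.snd.fst‖ ≤ ‖U‖ ^ 2 := by
    nlinarith [sq_nonneg ‖U.fst‖, sq_nonneg (‖U.snd.snd‖ - ‖U.snd.fst‖),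
      sq_nonneg (‖U.snd.snd‖ + ‖U.snd.fst‖)]
  have e6 := mul_le_mul_of_nonneg_left e5 hc
  rw [e4]
  rw [real_inner_comm] at e3
  rw [real_inner_comm W.fst] at e1
  nlinarith

/-- The resolvent equation reduces to one variational problem for the first component, which is
coercive on `H` for large `λ`. -/
theorem memorySystem_range [CompleteSpace H] (hT : MaxDissipative T) {c : ℝ} (hc : 0 ≤ c)
    (hD : ∀ η h, |⟪η, Q h⟫ - D η h| ≤ c * ‖η‖ * ‖J h‖) {lam : ℝ} (hl : 0 < lam)
    (hlc : c * ‖Q‖ ≤ lam) (F : WithLp 2 (H × WithLp 2 (L × G))) :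
    ∃ p ∈ memorySystem J Q D T, lam • p.1 - p.2 = F := by
  set R := hT.res lam hl
  -- eliminating `w₁ = λ u - f₁` and `η = R (f₃ + Q w₁)` leaves `B u h = ell h` for all `h`
  set B : H →L[ℝ] H →L[ℝ] ℝ := lam ^ 2 • (innerBilin L).bilinearComp J J + innerBilin H +
    lam • (D ∘L R ∘L Q)
  have hB : ∀ u h, B u h = lam ^ 2 * ⟪J u, J h⟫ + ⟪u, h⟫ + lam * D (R (Q u)) h := fun u h => rfl
  have hmono : ∀ f, 0 ≤ ⟪R f, f⟫ := by
    intro f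
    have := hT.dissip _ (hT.res_mem hl f)
    simp only [inner_sub_left, inner_smul_left, conj_trivial, real_inner_self_eq_norm_sq] at this
    rw [real_inner_comm]
    have h2 : 0 ≤ lam * ‖R f‖ ^ 2 := by positivity
    linarith
  -- `λ D (R Q u) u` is the nonnegative `λ ⟪R Q u, Q u⟫` up to `λ c ‖R Q u‖ ‖J u‖ ≤ λ ‖u‖ ‖J u‖`,
  -- which the two squares in `B u u` absorb
  have hco : IsCoercive B := by
    refine ⟨1 / 2, by norm_num, fun u => ?_⟩
    rw [hB, real_inner_self_eq_norm_sq, real_inner_self_eq_norm_sq]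
    have h1 := le_of_abs_le (hD (R (Q u)) u)
    have h2 := hmono (Q u)
    have h3 : lam * ‖R (Q u)‖ ≤ ‖Q‖ * ‖u‖ := by
      have := (hT.res_le hl (Q u)).trans
        (mul_le_mul_of_nonneg_left (Q.le_opNorm u) (inv_pos.2 hl).le)
      rwa [inv_mul_eq_div, le_div_iff₀' hl] at this
    have h4 : lam * (c * ‖R (Q u)‖ * ‖J u‖) ≤ lam * ‖u‖ * ‖J u‖ := by
      calc lam * (c * ‖R (Q u)‖ * ‖J u‖) = c * (lam * ‖R (Q u)‖) * ‖J u‖ := by ring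
        _ ≤ c * (‖Q‖ * ‖u‖) * ‖J u‖ := by gcongr
        _ = c * ‖Q‖ * ‖u‖ * ‖J u‖ := by ring
        _ ≤ lam * ‖u‖ * ‖J u‖ := by gcongr
    have h5 := mul_le_mul_of_nonneg_left h1 hl.le
    have h6 := mul_nonneg hl.le h2
    nlinarith [sq_nonneg (lam * ‖J u‖ - ‖u‖), sq_nonneg (lam * ‖J u‖)]
  obtain ⟨f₁, f₂, f₃, hF1, hF2, hF3⟩ : ∃ f₁ f₂ f₃, F.fst = f₁ ∧ F.snd.fst = f₂ ∧ F.snd.snd = f₃ :=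
    ⟨_, _, _, rfl, rfl, rfl⟩
  set ell : H →L[ℝ] ℝ := (innerBilin L (lam • J f₁ + f₂)) ∘L J - D (R (f₃ - Q f₁))
  have hell : ∀ h, ell h = ⟪lam • J f₁ + f₂, J h⟫ - D (R (f₃ - Q f₁)) h := fun h => rfl
  set u : H := hco.continuousLinearEquivOfBilin.symm ((InnerProductSpace.toDual ℝ H).symm ell)
  have hu : ∀ h, B u h = ell h := fun h => by
    rw [← hco.continuousLinearEquivOfBilin_apply, ContinuousLinearEquiv.apply_symm_apply,
      InnerProductSpace.toDual_symm_apply]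
  set w : H := lam • u - f₁
  set η : G := R (f₃ + Q w)
  have hη : η = R (f₃ - Q f₁) + lam • R (Q u) := by
    rw [← map_smul, ← map_add]
    simp only [η, w, map_sub, map_smul]
    congr 1
    abel
  refine ⟨(WithLp.toLp 2 (u, WithLp.toLp 2 (J w, η)),
    WithLp.toLp 2 (w, WithLp.toLp 2 (lam • J w - f₂, lam • η - f₃))), ?_, ?_⟩
  · refine mem_memorySystem.2 ⟨rfl, fun h => ?_, ?_⟩
    · have h1 := hu h
      rw [hB, hell] at h1
      simp only [WithLp.toLp_fst, WithLp.toLp_snd, hη, map_add, map_smul, add_apply, smul_apply,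
        smul_eq_mul, w, map_sub, inner_sub_left, inner_smul_left, inner_add_left, smul_sub,
        conj_trivial] at h1 ⊢
      linear_combination h1
    · have := hT.res_mem hl (f₃ + Q w)
      simp only [WithLp.toLp_fst, WithLp.toLp_snd]
      rw [sub_sub]
      exact this
  · have e : F = WithLp.toLp 2 (f₁, WithLp.toLp 2 (f₂, f₃)) := by
      rw [← hF1, ← hF2, ← hF3]; rfl
    rw [e]
    simp only [← WithLp.toLp_smul, ← WithLp.toLp_sub, Prod.smul_mk, Prod.mk_sub_mk, w,
      sub_sub_cancel]

theorem quasiMaxDissipative_memorySystem [CompleteSpace H]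
    (hT : MaxDissipative T) (hJ : Function.Injective J)
    (hJd : ∀ x, (∀ h, ⟪x, J h⟫ = 0) → x = 0) {c : ℝ} (hc : 0 ≤ c)
    (hD : ∀ η h, |⟪η, Q h⟫ - D η h| ≤ c * ‖η‖ * ‖J h‖) :
    QuasiMaxDissipative (memorySystem J Q D T) (c + c * ‖Q‖) where
  single W hW := by
    obtain ⟨h1, h2, h3⟩ := mem_memorySystem.1 hW
    have w1 : W.fst = 0 := hJ (by rw [h1, map_zero]; rfl)
    have w2 : W.snd.fst = 0 := by
      refine hJd _ fun h => ?_
      simpa using h2 h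
    have w3 : W.snd.snd = 0 := by
      rw [w1, map_zero, sub_zero] at h3
      exact hT.single _ h3
    have e : W = WithLp.toLp 2 (W.fst, WithLp.toLp 2 (W.snd.fst, W.snd.snd)) := rfl
    rw [e, w1, w2, w3]
    rfl
  dissip p hp := (memorySystem_dissip hT hc hD hp).trans (by
    have : 0 ≤ c * ‖Q‖ := by positivity
    gcongr
    linarith)
  range lam hl F := by
    have h1 : 0 ≤ c * ‖Q‖ := by positivity
    exact memorySystem_range hT hc hD (by linarith) (by linarith) F

end MemorySystem

/-! ### The history operator -/

/-- The Cauchy-Schwarz inequality for the measure `w dμ`, paired with `1`. -/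
theorem ENNReal.lintegral_mul_sq_le {α : Type*} {m : MeasurableSpace α} {μ : Measure α}
    {w F : α → ℝ≥0∞} (hw : AEMeasurable w μ) (hF : AEMeasurable F μ) :
    (∫⁻ a, w a * F a ∂μ) ^ 2 ≤ (∫⁻ a, w a ∂μ) * ∫⁻ a, w a * F a ^ 2 ∂μ := by
  have h := ENNReal.lintegral_mul_le_Lp_mul_Lq μ Real.HolderConjugate.two_two
    (hw.pow_const (1 / 2 : ℝ)) ((hw.pow_const (1 / 2 : ℝ)).mul hF)
  have e1 : ∀ a, w a ^ (1 / 2 : ℝ) * (w a ^ (1 / 2 : ℝ) * F a) = w a * F a := fun a => by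
    rw [← mul_assoc, ← ENNReal.rpow_add_of_nonneg _ _ (by norm_num) (by norm_num)]
    norm_num
  have e2 : ∀ a, (w a ^ (1 / 2 : ℝ)) ^ (2 : ℝ) = w a := fun a => by
    rw [← ENNReal.rpow_mul]; norm_num
  have e3 : ∀ a, (w a ^ (1 / 2 : ℝ) * F a) ^ (2 : ℝ) = w a * F a ^ 2 := fun a => by
    rw [ENNReal.mul_rpow_of_nonneg _ _ (by norm_num), e2, ENNReal.rpow_two]
  simp only [Pi.mul_apply, e1, e2, e3] at h
  calc (∫⁻ a, w a * F a ∂μ) ^ 2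
      ≤ ((∫⁻ a, w a ∂μ) ^ (1 / 2 : ℝ) * (∫⁻ a, w a * F a ^ 2 ∂μ) ^ (1 / 2 : ℝ)) ^ 2 := by gcongr
    _ = _ := by
      rw [mul_pow, ← ENNReal.rpow_two, ← ENNReal.rpow_two, ← ENNReal.rpow_mul, ← ENNReal.rpow_mul]
      norm_num

/-- Integration by parts for the primitive of an integrable vector-valued function. -/
theorem integral_deriv_smul_primitive {V : Type*} [NormedAddCommGroup V] [NormedSpace ℝ V]
    [CompleteSpace V] {φ φ' : ℝ → ℝ} (hφ : ∀ r, HasDerivAt φ (φ' r) r) (hφ' : Continuous φ')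
    {f : ℝ → V} {s : ℝ} (hs : 0 ≤ s) (hf : IntegrableOn f (Ioc 0 s)) :
    ∫ r in (0 : ℝ)..s, φ' r • ∫ t in (0 : ℝ)..r, f t =
      φ s • (∫ t in (0 : ℝ)..s, f t) - ∫ t in (0 : ℝ)..s, φ t • f t := by
  set μ : Measure ℝ := volume.restrict (Ioc 0 s)
  have hφ'i : Integrable φ' μ := (hφ'.integrableOn_Icc).mono_set Ioc_subset_Icc_self
  have hprod : Integrable (fun z : ℝ × ℝ => φ' z.1 • f z.2) (μ.prod μ) := hφ'i.smul_prod hf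
  have hm : MeasurableSet {z : ℝ × ℝ | z.2 ≤ z.1} := measurableSet_le measurable_snd measurable_fst
  have hswap := integral_integral_swap (μ := μ) (ν := μ)
    (f := fun r t => {z : ℝ × ℝ | z.2 ≤ z.1}.indicator (fun z => φ' z.1 • f z.2) (r, t))
    (hprod.indicator hm)
  have hφc : Continuous φ := continuous_iff_continuousAt.2 fun r => (hφ r).continuousAt
  have hφi : Integrable (fun t => φ t • f t) μ := by
    obtain ⟨C, hC⟩ := (isCompact_Icc (a := (0 : ℝ)) (b := s)).exists_bound_of_continuousOn
      hφc.continuousOn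
    exact Integrable.bdd_smul hf C hφc.aestronglyMeasurable
      ((ae_restrict_iff' measurableSet_Ioc).2
        (ae_of_all _ fun t ht => hC t (Ioc_subset_Icc_self ht)))
  have hl : ∀ r ∈ Ioc 0 s,
      ∫ t, {z : ℝ × ℝ | z.2 ≤ z.1}.indicator (fun z => φ' z.1 • f z.2) (r, t) ∂μ =
        φ' r • ∫ t in (0 : ℝ)..r, f t := by
    intro r hr
    have e : (fun t => {z : ℝ × ℝ | z.2 ≤ z.1}.indicator (fun z => φ' z.1 • f z.2) (r, t)) =
        (Iic r).indicator fun t => φ' r • f t := by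
      ext t; simp only [indicator_apply, mem_ofPred_eq, mem_Iic]
    rw [e, integral_indicator measurableSet_Iic, Measure.restrict_restrict measurableSet_Iic,
      inter_comm, Ioc_inter_Iic, min_eq_right hr.2, intervalIntegral.integral_of_le hr.1.le,
      integral_smul]
  have hr : ∀ t ∈ Ioc 0 s,
      ∫ r, {z : ℝ × ℝ | z.2 ≤ z.1}.indicator (fun z => φ' z.1 • f z.2) (r, t) ∂μ =
        φ s • f t - φ t • f t := by
    intro t ht
    have e : (fun r => {z : ℝ × ℝ | z.2 ≤ z.1}.indicator (fun z => φ' z.1 • f z.2) (r, t)) =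
        (Ici t).indicator fun r => φ' r • f t := by
      ext r; simp only [indicator_apply, mem_ofPred_eq, mem_Ici]
    have e2 : Ici t ∩ Ioc 0 s = Icc t s := by
      ext r
      simp only [mem_inter_iff, mem_Ici, mem_Ioc, mem_Icc]
      exact ⟨fun h => ⟨h.1, h.2.2⟩, fun h => ⟨h.1, ht.1.trans_le h.1, h.2⟩⟩
    rw [e, integral_indicator measurableSet_Ici, Measure.restrict_restrict measurableSet_Ici, e2,
      integral_Icc_eq_integral_Ioc, integral_smul_const, ← intervalIntegral.integral_of_le ht.2,
      intervalIntegral.integral_eq_sub_of_hasDerivAt (fun r _ => hφ r)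
        (hφ'.intervalIntegrable _ _), sub_smul]
  have hfs : Integrable (fun t => φ s • f t) μ := Integrable.smul (φ s) hf
  rw [intervalIntegral.integral_of_le hs, intervalIntegral.integral_of_le hs,
    intervalIntegral.integral_of_le hs, ← integral_smul, ← integral_sub hfs hφi,
    ← setIntegral_congr_fun measurableSet_Ioc hl, ← setIntegral_congr_fun measurableSet_Ioc hr]
  exact hswap

namespace ViscoMedium

variable {n : ℕ} (S : ViscoMedium n)

theorem aemeasurable_g : AEMeasurable (fun s => ENNReal.ofReal (S.g s))
    (volume.restrict (Ioi (0 : ℝ))) :=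
  ((S.g_smooth.continuousOn.mono Ioi_subset_Ici_self).aemeasurable measurableSet_Ioi).ennreal_ofReal

theorem gMeas_absolutelyContinuous : S.gMeas ≪ volume.restrict (Ioi (0 : ℝ)) :=
  withDensity_absolutelyContinuous _ _

theorem absolutelyContinuous_gMeas : volume.restrict (Ioi (0 : ℝ)) ≪ S.gMeas :=
  withDensity_absolutelyContinuous' S.aemeasurable_g
    ((ae_restrict_iff' measurableSet_Ioi).2 (ae_of_all _ fun s hs => by
      simpa using S.g_pos s (Ioi_subset_Ici_self hs)))

theorem ae_gMeas_iff {p : ℝ → Prop} :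
    (∀ᵐ s ∂S.gMeas, p s) ↔ ∀ᵐ s ∂volume.restrict (Ioi (0 : ℝ)), p s :=
  ⟨fun h => S.absolutelyContinuous_gMeas h, fun h => S.gMeas_absolutelyContinuous h⟩

instance : IsFiniteMeasure S.gMeas where
  measure_univ_lt_top := by
    have h := S.g_integrable.mono_set Ioi_subset_Ici_self
    rw [gMeas, withDensity_apply _ MeasurableSet.univ, Measure.restrict_univ]
    refine lt_of_le_of_lt (lintegral_mono fun s => ?_) h.hasFiniteIntegral
    rw [← ofReal_norm]
    exact ENNReal.ofReal_le_ofReal (le_abs_self _)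

variable {V : Type*} [NormedAddCommGroup V]

/-- As `g` is non-increasing and positive, it is bounded below by `g(s)` on `(0, s]`. -/
theorem integrableOn_of_memLp_gMeas {f : ℝ → V} (hf : MemLp f 2 S.gMeas) (s : ℝ) :
    IntegrableOn f (Ioc 0 s) := by
  rcases lt_or_ge 0 s with hs | hs
  · have hgs := S.g_pos s hs.le
    have hle : (volume.restrict (Ioc 0 s) : Measure ℝ) ≤ (ENNReal.ofReal (S.g s))⁻¹ • S.gMeas := by
      have hc' : ENNReal.ofReal (S.g s) ≠ 0 := by simpa using hgs
      have h1 : ENNReal.ofReal (S.g s) • (volume.restrict (Ioc 0 s) : Measure ℝ) ≤ S.gMeas := by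
        calc ENNReal.ofReal (S.g s) • (volume.restrict (Ioc 0 s) : Measure ℝ)
            = (volume.restrict (Ioc 0 s)).withDensity fun _ => ENNReal.ofReal (S.g s) :=
              (withDensity_const _).symm
          _ ≤ (volume.restrict (Ioc 0 s)).withDensity fun r => ENNReal.ofReal (S.g r) :=
              withDensity_mono ((ae_restrict_iff' measurableSet_Ioc).2 (ae_of_all _ fun r hr =>
                ENNReal.ofReal_le_ofReal (S.g_anti hr.1.le hs.le hr.2)))
          _ = S.gMeas.restrict (Ioc 0 s) := by
              rw [gMeas, restrict_withDensity measurableSet_Ioc,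
                Measure.restrict_restrict measurableSet_Ioc, inter_eq_left.2 Ioc_subset_Ioi_self]
          _ ≤ S.gMeas := Measure.restrict_le_self
      calc (volume.restrict (Ioc 0 s) : Measure ℝ)
          = (ENNReal.ofReal (S.g s))⁻¹ • (ENNReal.ofReal (S.g s) • volume.restrict (Ioc 0 s)) := by
            rw [smul_smul, ENNReal.inv_mul_cancel hc' ENNReal.ofReal_ne_top, one_smul]
        _ ≤ _ := by gcongr
    exact (hf.of_measure_le_smul (by simpa using hgs) hle).integrable (by norm_num)
  · rw [Ioc_eq_empty (not_lt.2 hs)]; exact integrableOn_empty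

variable {S} in
theorem intervalIntegral_congr_gMeas [NormedSpace ℝ V] {f f' : ℝ → V} (h : f =ᵐ[S.gMeas] f')
    {s : ℝ} (hs : 0 ≤ s) : ∫ r in (0 : ℝ)..s, f r = ∫ r in (0 : ℝ)..s, f' r := by
  rw [intervalIntegral.integral_of_le hs, intervalIntegral.integral_of_le hs]
  exact integral_congr_ae (ae_restrict_of_ae_restrict_of_subset Ioc_subset_Ioi_self
    (S.ae_gMeas_iff.1 h))

section Resolvent

variable [InnerProductSpace ℝ V]

/-- The solution `K` of `K' + λ K = f`, `K(0) = 0`. -/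
def expConv (lam : ℝ) (f : ℝ → V) (s : ℝ) : V :=
  Real.exp (-(lam * s)) • ∫ r in (0 : ℝ)..s, Real.exp (lam * r) • f r

variable {S}

theorem integrableOn_exp_smul {f : ℝ → V} (hf : MemLp f 2 S.gMeas) (lam s : ℝ) :
    IntegrableOn (fun r => Real.exp (lam * r) • f r) (Ioc 0 s) := by
  have hc : Continuous fun r : ℝ => Real.exp (lam * r) := by fun_prop
  obtain ⟨C, hC⟩ := (isCompact_Icc (a := (0 : ℝ)) (b := s)).exists_bound_of_continuousOn
    hc.continuousOn
  exact Integrable.bdd_smul (S.integrableOn_of_memLp_gMeas hf s) C hc.aestronglyMeasurable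
    ((ae_restrict_iff' measurableSet_Ioc).2 (ae_of_all _ fun t ht => hC t (Ioc_subset_Icc_self ht)))

theorem continuousOn_primitive_Ici {f : ℝ → V} (hf : ∀ s, IntegrableOn f (Ioc 0 s)) :
    ContinuousOn (fun s => ∫ r in (0 : ℝ)..s, f r) (Ici 0) := by
  intro s hs
  have hs' : (0 : ℝ) ≤ s + 1 := by have := mem_Ici.1 hs; linarith
  have h := intervalIntegral.continuousOn_primitive_interval' (μ := volume) (f := f)
    (b₁ := 0) (b₂ := s + 1) (a := 0) ((intervalIntegrable_iff_integrableOn_Ioc_of_le hs').2 (hf _))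
    left_mem_uIcc
  rw [uIcc_of_le hs'] at h
  refine (h s ⟨hs, by linarith⟩).mono_of_mem_nhdsWithin ?_
  rw [← Ici_inter_Iic]
  exact inter_mem self_mem_nhdsWithin (mem_nhdsWithin_of_mem_nhds (Iic_mem_nhds (by linarith)))

theorem continuousOn_expConv {f : ℝ → V} (hf : MemLp f 2 S.gMeas) (lam : ℝ) :
    ContinuousOn (expConv lam f) (Ici 0) :=
  (by fun_prop : Continuous fun s : ℝ => Real.exp (-(lam * s))).continuousOn.smul
    (continuousOn_primitive_Ici fun s => integrableOn_exp_smul hf lam s)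

theorem aestronglyMeasurable_expConv {f : ℝ → V} (hf : MemLp f 2 S.gMeas) (lam : ℝ) :
    AEStronglyMeasurable (expConv lam f) S.gMeas :=
  (((continuousOn_expConv hf lam).mono Ioi_subset_Ici_self).aestronglyMeasurable
    measurableSet_Ioi).mono_ac S.gMeas_absolutelyContinuous

theorem lintegral_exp_Ioc_le {lam : ℝ} (hl : 0 < lam) (s : ℝ) :
    ∫⁻ r in Ioc 0 s, ENNReal.ofReal (Real.exp (-(lam * (s - r)))) ≤ ENNReal.ofReal lam⁻¹ := by
  have hd : ∀ r, HasDerivAt (fun r => lam⁻¹ * Real.exp (-(lam * (s - r))))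
      (Real.exp (-(lam * (s - r)))) r := by
    intro r
    have := ((((hasDerivAt_id r).const_sub s).const_mul lam).neg.exp).const_mul lam⁻¹
    refine this.congr_deriv ?_
    simp only [id, Pi.neg_apply]
    field_simp
  rcases le_or_gt 0 s with hs | hs
  · have hc : Continuous fun r => Real.exp (-(lam * (s - r))) := by fun_prop
    rw [← ofReal_integral_eq_lintegral_ofReal (hc.integrableOn_Icc.mono_set Ioc_subset_Icc_self)
      (ae_of_all _ fun r => (Real.exp_pos _).le), ← intervalIntegral.integral_of_le hs,
      intervalIntegral.integral_eq_sub_of_hasDerivAt (fun r _ => hd r)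
        (hc.intervalIntegrable _ _)]
    refine ENNReal.ofReal_le_ofReal ?_
    have h1 : 0 ≤ lam⁻¹ * Real.exp (-(lam * (s - 0))) := by positivity
    simpa using h1
  · rw [Ioc_eq_empty (not_lt.2 hs.le)]; simp

theorem lintegral_exp_Ici_le {lam : ℝ} (hl : 0 < lam) (r : ℝ) :
    ∫⁻ s in Ici r, ENNReal.ofReal (Real.exp (-(lam * (s - r)))) ≤ ENNReal.ofReal lam⁻¹ := by
  have e : ∀ s, Real.exp (-(lam * (s - r))) = Real.exp (lam * r) * Real.exp (-lam * s) :=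
    fun s => by rw [← Real.exp_add]; congr 1; ring
  have hi := integrableOn_exp_mul_Ioi (neg_lt_zero.2 hl) r
  simp only [e]
  rw [setLIntegral_congr Ioi_ae_eq_Ici.symm,
    ← ofReal_integral_eq_lintegral_ofReal (hi.const_mul _)
      (ae_of_all _ fun s => by positivity), integral_const_mul,
    integral_exp_mul_Ioi (neg_lt_zero.2 hl)]
  refine ENNReal.ofReal_le_ofReal (le_of_eq ?_)
  rw [neg_div_neg_eq, ← mul_div_assoc, ← Real.exp_add]
  simp [neg_mul]

theorem enorm_expConv_sq_le {f : ℝ → V} (hf : MemLp f 2 S.gMeas) {lam : ℝ} (hl : 0 < lam)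
    {s : ℝ} (hs : 0 ≤ s) :
    ‖expConv lam f s‖ₑ ^ 2 ≤ ENNReal.ofReal lam⁻¹ *
      ∫⁻ r in Ioc 0 s, ENNReal.ofReal (Real.exp (-(lam * (s - r)))) * ‖f r‖ₑ ^ 2 := by
  have hmeas : AEMeasurable (fun r => ‖f r‖ₑ) (volume.restrict (Ioc 0 s)) :=
    (S.integrableOn_of_memLp_gMeas hf s).aestronglyMeasurable.enorm
  have hw : Measurable fun r => ENNReal.ofReal (Real.exp (-(lam * (s - r)))) := by fun_prop
  have h1 : ‖expConv lam f s‖ₑ ≤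
      ∫⁻ r in Ioc 0 s, ENNReal.ofReal (Real.exp (-(lam * (s - r)))) * ‖f r‖ₑ := by
    rw [expConv, intervalIntegral.integral_of_le hs, ← integral_smul]
    refine (enorm_integral_le_lintegral_enorm _).trans (lintegral_mono fun r => le_of_eq ?_)
    rw [smul_smul, ← Real.exp_add, enorm_smul, Real.enorm_eq_ofReal (Real.exp_pos _).le]
    congr 3
    ring
  calc ‖expConv lam f s‖ₑ ^ 2
      ≤ (∫⁻ r in Ioc 0 s, ENNReal.ofReal (Real.exp (-(lam * (s - r)))) * ‖f r‖ₑ) ^ 2 := by gcongr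
    _ ≤ _ := ENNReal.lintegral_mul_sq_le hw.aemeasurable hmeas
    _ ≤ _ := by gcongr; exact lintegral_exp_Ioc_le hl s

/-- Young's inequality for the convolution with `exp(-λ s)` in the weighted space; the weight `g`
may be moved inside the integral because it is non-increasing. -/
theorem lintegral_expConv_le {f : ℝ → V} (hf : MemLp f 2 S.gMeas) {lam : ℝ} (hl : 0 < lam) :
    ∫⁻ s, ‖expConv lam f s‖ₑ ^ 2 ∂S.gMeas ≤
      ENNReal.ofReal lam⁻¹ ^ 2 * ∫⁻ s, ‖f s‖ₑ ^ 2 ∂S.gMeas := by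
  set μ : Measure ℝ := volume.restrict (Ioi (0 : ℝ))
  have hfm : AEMeasurable (fun r => ‖f r‖ₑ ^ 2) μ :=
    (hf.aestronglyMeasurable.mono_ac S.absolutelyContinuous_gMeas).enorm.pow_const 2
  have hKm : AEMeasurable (fun r => ‖expConv lam f r‖ₑ ^ 2) μ :=
    ((aestronglyMeasurable_expConv hf lam).mono_ac S.absolutelyContinuous_gMeas).enorm.pow_const 2
  set W : ℝ → ℝ≥0∞ := fun r => ENNReal.ofReal (S.g r) * ‖f r‖ₑ ^ 2
  have hWm : AEMeasurable W μ := S.aemeasurable_g.mul hfm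
  set k : ℝ × ℝ → ℝ≥0∞ := {z : ℝ × ℝ | z.2 ≤ z.1}.indicator fun z =>
    ENNReal.ofReal (Real.exp (-(lam * (z.1 - z.2))))
  have hk : Measurable k := by
    refine Measurable.indicator ?_ (measurableSet_le measurable_snd measurable_fst)
    fun_prop
  rw [gMeas, lintegral_withDensity_eq_lintegral_mul₀ S.aemeasurable_g hKm,
    lintegral_withDensity_eq_lintegral_mul₀ S.aemeasurable_g hfm]
  calc ∫⁻ s, ((fun s => ENNReal.ofReal (S.g s)) * fun s => ‖expConv lam f s‖ₑ ^ 2) s ∂μ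
      ≤ ∫⁻ s, ENNReal.ofReal lam⁻¹ * ∫⁻ r, k (s, r) * W r ∂μ ∂μ := by
        refine lintegral_mono_ae ((ae_restrict_iff' measurableSet_Ioi).2
          (ae_of_all _ fun s hs => ?_))
        have hs0 : (0 : ℝ) ≤ s := le_of_lt hs
        have e1 : ∫⁻ r, k (s, r) * W r ∂μ =
            ∫⁻ r in Ioc 0 s, ENNReal.ofReal (Real.exp (-(lam * (s - r)))) * W r := by
          have : ∀ r, k (s, r) * W r = (Iic s).indicator
              (fun r => ENNReal.ofReal (Real.exp (-(lam * (s - r)))) * W r) r := by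
            intro r
            by_cases h : r ≤ s <;> simp [k, h]
          simp only [this]
          rw [lintegral_indicator measurableSet_Iic, Measure.restrict_restrict measurableSet_Iic,
            inter_comm, Ioi_inter_Iic]
        rw [e1, Pi.mul_apply]
        calc ENNReal.ofReal (S.g s) * ‖expConv lam f s‖ₑ ^ 2
            ≤ ENNReal.ofReal (S.g s) * (ENNReal.ofReal lam⁻¹ *
              ∫⁻ r in Ioc 0 s, ENNReal.ofReal (Real.exp (-(lam * (s - r)))) * ‖f r‖ₑ ^ 2) := by
              gcongr; exact enorm_expConv_sq_le hf hl hs0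
          _ = ENNReal.ofReal lam⁻¹ * ∫⁻ r in Ioc 0 s, ENNReal.ofReal (S.g s) *
              (ENNReal.ofReal (Real.exp (-(lam * (s - r)))) * ‖f r‖ₑ ^ 2) := by
              rw [lintegral_const_mul' _ _ ENNReal.ofReal_ne_top]; ring
          _ ≤ _ := by
              refine mul_le_mul_right (setLIntegral_mono' measurableSet_Ioc fun r hr => ?_) _
              have : ENNReal.ofReal (S.g s) ≤ ENNReal.ofReal (S.g r) :=
                ENNReal.ofReal_le_ofReal (S.g_anti hr.1.le hs0 hr.2)
              calc _ ≤ ENNReal.ofReal (S.g r) *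
                    (ENNReal.ofReal (Real.exp (-(lam * (s - r)))) * ‖f r‖ₑ ^ 2) := by gcongr
                _ = _ := by ring
    _ = ENNReal.ofReal lam⁻¹ * ∫⁻ r, ∫⁻ s, k (s, r) * W r ∂μ ∂μ := by
        rw [lintegral_const_mul' _ _ ENNReal.ofReal_ne_top, lintegral_lintegral_swap]
        exact hk.aemeasurable.mul hWm.comp_snd
    _ ≤ ENNReal.ofReal lam⁻¹ * ∫⁻ r, ENNReal.ofReal lam⁻¹ * W r ∂μ := by
        refine mul_le_mul_right (lintegral_mono fun r => ?_) _
        rw [lintegral_mul_const (f := fun s => k (s, r)) _ (hk.comp measurable_prodMk_right)]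
        refine mul_le_mul_left ?_ _
        refine (lintegral_mono' Measure.restrict_le_self le_rfl).trans
          (le_trans (le_of_eq ?_) (lintegral_exp_Ici_le hl r))
        rw [← lintegral_indicator measurableSet_Ici]
        congr 1
    _ = _ := by
        rw [lintegral_const_mul' _ _ ENNReal.ofReal_ne_top, ← mul_assoc, ← sq]
        rfl

theorem eLpNorm_expConv_le {f : ℝ → V} (hf : MemLp f 2 S.gMeas) {lam : ℝ} (hl : 0 < lam) :
    eLpNorm (expConv lam f) 2 S.gMeas ≤ ENNReal.ofReal lam⁻¹ * eLpNorm f 2 S.gMeas := by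
  have h := lintegral_expConv_le hf hl
  simp only [eLpNorm_eq_lintegral_rpow_enorm_toReal two_ne_zero ENNReal.ofNat_ne_top,
    ENNReal.toReal_ofNat, ENNReal.rpow_two]
  calc (∫⁻ s, ‖expConv lam f s‖ₑ ^ 2 ∂S.gMeas) ^ (1 / 2 : ℝ)
      ≤ (ENNReal.ofReal lam⁻¹ ^ 2 * ∫⁻ s, ‖f s‖ₑ ^ 2 ∂S.gMeas) ^ (1 / 2 : ℝ) := by gcongr
    _ = _ := by
      rw [ENNReal.mul_rpow_of_nonneg _ _ (by norm_num), ← ENNReal.rpow_two, ← ENNReal.rpow_mul]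
      norm_num

theorem memLp_expConv {f : ℝ → V} (hf : MemLp f 2 S.gMeas) {lam : ℝ} (hl : 0 < lam) :
    MemLp (expConv lam f) 2 S.gMeas :=
  ⟨aestronglyMeasurable_expConv hf lam, (eLpNorm_expConv_le hf hl).trans_lt
    (ENNReal.mul_lt_top ENNReal.ofReal_lt_top hf.2)⟩

end Resolvent

section Generator

variable (V) [InnerProductSpace ℝ V]

/-- The generator `-d/ds` of right translations on `L²_g(ℝ⁺; V)`: the pairs `(η, -η_s)` with
`η(0) = 0`. -/
def histGen : Submodule ℝ (Lp V 2 S.gMeas × Lp V 2 S.gMeas) where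
  carrier := {p | ∀ᵐ s ∂volume.restrict (Ioi (0 : ℝ)), p.1 s = -∫ r in (0 : ℝ)..s, p.2 r}
  add_mem' := by
    intro p q hp hq
    filter_upwards [hp, hq, S.ae_gMeas_iff.1 (Lp.coeFn_add p.1 q.1),
      ae_restrict_mem measurableSet_Ioi] with s h1 h2 h3 hs
    have hs0 : (0 : ℝ) ≤ s := le_of_lt hs
    rw [Prod.fst_add, h3, Pi.add_apply, h1, h2, Prod.snd_add,
      intervalIntegral_congr_gMeas (Lp.coeFn_add p.2 q.2) hs0]
    simp only [Pi.add_apply]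
    have hi : ∀ f : Lp V 2 S.gMeas, IntervalIntegrable f volume 0 s := fun f =>
      (intervalIntegrable_iff_integrableOn_Ioc_of_le hs0).2
        (S.integrableOn_of_memLp_gMeas (Lp.memLp f) s)
    rw [intervalIntegral.integral_add (hi _) (hi _), neg_add]
  zero_mem' := by
    filter_upwards [S.ae_gMeas_iff.1 (Lp.coeFn_zero V 2 S.gMeas),
      ae_restrict_mem measurableSet_Ioi] with s h1 hs
    rw [Prod.fst_zero, h1, Prod.snd_zero,
      intervalIntegral_congr_gMeas (Lp.coeFn_zero V 2 S.gMeas) (le_of_lt hs)]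
    simp
  smul_mem' := by
    intro c p hp
    filter_upwards [hp, S.ae_gMeas_iff.1 (Lp.coeFn_smul c p.1),
      ae_restrict_mem measurableSet_Ioi] with s h1 h2 hs
    rw [Prod.smul_fst, h2, Pi.smul_apply, h1, Prod.smul_snd,
      intervalIntegral_congr_gMeas (Lp.coeFn_smul c p.2) (le_of_lt hs)]
    simp only [Pi.smul_apply]
    rw [intervalIntegral.integral_smul, smul_neg]

variable {S V}

theorem mem_histGen {η θ : Lp V 2 S.gMeas} : (η, θ) ∈ histGen S V ↔
    ∀ᵐ s ∂volume.restrict (Ioi (0 : ℝ)), η s = -∫ r in (0 : ℝ)..s, θ r := Iff.rfl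

variable [CompleteSpace V]

/-- The solution `η` of `λ η + η_s = f`, `η(0) = 0`, is given by Duhamel's formula. -/
theorem histGen_eq_expConv {η θ : Lp V 2 S.gMeas} (h : (η, θ) ∈ histGen S V) (lam : ℝ) :
    η =ᵐ[S.gMeas] expConv lam (lam • η - θ : Lp V 2 S.gMeas) := by
  rw [mem_histGen] at h
  refine S.ae_gMeas_iff.2 ?_
  filter_upwards [h, ae_restrict_mem measurableSet_Ioi] with s hs hs'
  have hs0 : (0 : ℝ) ≤ s := le_of_lt hs'
  have hθ := S.integrableOn_of_memLp_gMeas (Lp.memLp θ) s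
  have hd : ∀ r, HasDerivAt (fun r => Real.exp (lam * r)) (lam * Real.exp (lam * r)) r :=
      fun r => by
    have := ((hasDerivAt_id r).const_mul lam).exp
    simpa [mul_comm] using this
  have hibp := integral_deriv_smul_primitive hd (by fun_prop) hs0 hθ
  have e1 : ∫ r in (0 : ℝ)..s, Real.exp (lam * r) • (lam • η - θ : Lp V 2 S.gMeas) r =
      ∫ r in (0 : ℝ)..s, (-((lam * Real.exp (lam * r)) • ∫ t in (0 : ℝ)..r, θ t) -
        Real.exp (lam * r) • θ r) := by
    refine intervalIntegral_congr_gMeas (S := S) ?_ hs0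
    filter_upwards [S.ae_gMeas_iff.2 h, Lp.coeFn_sub (lam • η) θ, Lp.coeFn_smul lam η]
      with r h1 h2 h3
    rw [h2, Pi.sub_apply, h3, Pi.smul_apply, h1, smul_sub, smul_neg, smul_neg,
      smul_smul, mul_comm (Real.exp _)]
  have hi1 : IntervalIntegrable (fun r => -((lam * Real.exp (lam * r)) • ∫ t in (0 : ℝ)..r, θ t))
      volume 0 s := by
    refine ContinuousOn.intervalIntegrable (ContinuousOn.neg (ContinuousOn.smul
      (by fun_prop) ((continuousOn_primitive_Ici fun s =>
        S.integrableOn_of_memLp_gMeas (Lp.memLp θ) s).mono ?_)))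
    rw [uIcc_of_le hs0]; exact Icc_subset_Ici_self
  have hi2 : IntervalIntegrable (fun r => Real.exp (lam * r) • θ r) volume 0 s :=
    (intervalIntegrable_iff_integrableOn_Ioc_of_le hs0).2
      (integrableOn_exp_smul (Lp.memLp θ) lam s)
  rw [hs, expConv, e1, intervalIntegral.integral_sub hi1 hi2, intervalIntegral.integral_neg, hibp,
    neg_sub, sub_sub_cancel_left, smul_neg, smul_smul, ← Real.exp_add]
  simp

/-- The resolvent bound for `histGen`, as an a priori estimate. -/
theorem norm_le_of_mem_histGen {η θ : Lp V 2 S.gMeas} (h : (η, θ) ∈ histGen S V) {lam : ℝ}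
    (hl : 0 < lam) : ‖η‖ ≤ lam⁻¹ * ‖lam • η - θ‖ := by
  have h1 := eLpNorm_expConv_le (Lp.memLp (lam • η - θ)) hl
  rw [← eLpNorm_congr_ae (histGen_eq_expConv h lam)] at h1
  have h2 := ENNReal.toReal_mono
    (ENNReal.mul_ne_top ENNReal.ofReal_ne_top (Lp.eLpNorm_ne_top _)) h1
  rwa [ENNReal.toReal_mul, ENNReal.toReal_ofReal (inv_pos.2 hl).le, ← Lp.norm_def,
    ← Lp.norm_def] at h2

theorem expConv_mem_histGen (f : Lp V 2 S.gMeas) {lam : ℝ} (hl : 0 < lam) :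
    ((memLp_expConv (Lp.memLp f) hl).toLp _,
      lam • (memLp_expConv (Lp.memLp f) hl).toLp _ - f) ∈ histGen S V := by
  set η : Lp V 2 S.gMeas := (memLp_expConv (Lp.memLp f) hl).toLp _
  have hη : η =ᵐ[S.gMeas] expConv lam f := MemLp.coeFn_toLp _
  rw [mem_histGen]
  filter_upwards [S.ae_gMeas_iff.1 hη, ae_restrict_mem measurableSet_Ioi] with s hs hs'
  have hs0 : (0 : ℝ) ≤ s := le_of_lt hs'
  have hd : ∀ r, HasDerivAt (fun r => -Real.exp (-(lam * r))) (lam * Real.exp (-(lam * r))) r :=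
    fun r => by
      have := ((hasDerivAt_id r).const_mul lam).neg.exp.neg
      refine this.congr_deriv ?_
      simp [mul_comm]
  have hibp := integral_deriv_smul_primitive hd (by fun_prop) hs0
    (integrableOn_exp_smul (Lp.memLp f) lam s)
  have e1 : ∫ r in (0 : ℝ)..s, (lam • η - f : Lp V 2 S.gMeas) r =
      ∫ r in (0 : ℝ)..s, ((lam * Real.exp (-(lam * r))) •
        (∫ t in (0 : ℝ)..r, Real.exp (lam * t) • f t) - f r) := by
    refine intervalIntegral_congr_gMeas (S := S) ?_ hs0
    filter_upwards [hη, Lp.coeFn_sub (lam • η) f, Lp.coeFn_smul lam η] with r h1 h2 h3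
    rw [h2, Pi.sub_apply, h3, Pi.smul_apply, h1, expConv, smul_smul]
  have hi1 : IntervalIntegrable (fun r => (lam * Real.exp (-(lam * r))) •
      ∫ t in (0 : ℝ)..r, Real.exp (lam * t) • f t) volume 0 s := by
    refine ContinuousOn.intervalIntegrable (ContinuousOn.smul
      (by fun_prop) ((continuousOn_primitive_Ici fun s =>
        integrableOn_exp_smul (Lp.memLp f) lam s).mono ?_))
    rw [uIcc_of_le hs0]; exact Icc_subset_Ici_self
  have hi2 : IntervalIntegrable (f : ℝ → V) volume 0 s :=
    (intervalIntegrable_iff_integrableOn_Ioc_of_le hs0).2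
      (S.integrableOn_of_memLp_gMeas (Lp.memLp f) s)
  have e2 : ∀ t, -Real.exp (-(lam * t)) • Real.exp (lam * t) • f t = -f t := fun t => by
    rw [smul_smul, neg_mul, ← Real.exp_add]; simp
  rw [hs, expConv, e1, intervalIntegral.integral_sub hi1 hi2, hibp]
  simp only [e2, intervalIntegral.integral_neg, neg_smul]
  abel

theorem maxDissipative_histGen : MaxDissipative (histGen S V) where
  single θ hθ := by
    rw [mem_histGen] at hθ
    have h0 : ∀ s ∈ Ioi (0 : ℝ), ∫ r in (0 : ℝ)..s, θ r = 0 := by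
      have hc := (continuousOn_primitive_Ici fun s =>
        S.integrableOn_of_memLp_gMeas (Lp.memLp θ) s).mono Ioi_subset_Ici_self
      refine Measure.eqOn_of_ae_eq (μ := volume) ?_ hc continuousOn_const ?_
      · filter_upwards [hθ, S.ae_gMeas_iff.1 (Lp.coeFn_zero V 2 S.gMeas)] with s h1 h2
        rw [h2] at h1
        simpa using h1.symm
      · rw [isOpen_Ioi.interior_eq]; exact subset_closure
    refine Lp.ext (S.ae_gMeas_iff.2 ?_)
    -- by the Lebesgue differentiation theorem `θ` is a.e. the derivative of its primitive
    have hall : ∀ᵐ s : ℝ, ∀ N : ℕ, s ∈ uIcc 0 (N : ℝ) → ∀ c ∈ uIcc 0 (N : ℝ),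
        HasDerivAt (fun s => ∫ r in c..s, θ r) (θ s) s :=
      ae_all_iff.2 fun N => ((intervalIntegrable_iff_integrableOn_Ioc_of_le N.cast_nonneg).2
        (S.integrableOn_of_memLp_gMeas (Lp.memLp θ) N)).ae_hasDerivAt_integral
    filter_upwards [ae_restrict_of_ae hall, ae_restrict_mem measurableSet_Ioi,
      S.ae_gMeas_iff.1 (Lp.coeFn_zero V 2 S.gMeas)] with s h1 hs h2
    obtain ⟨N, hN⟩ := exists_nat_ge s
    have h3 := h1 N (by rw [uIcc_of_le N.cast_nonneg]; exact ⟨le_of_lt hs, hN⟩) 0 left_mem_uIcc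
    have h4 : HasDerivAt (fun s => ∫ r in (0 : ℝ)..s, θ r) 0 s :=
      (hasDerivAt_const s (0 : V)).congr_of_eventuallyEq
        (Filter.eventually_of_mem (Ioi_mem_nhds hs) h0)
    rw [h2, h3.unique h4]
    rfl
  dissip := by
    -- squaring `λ ‖η‖ ≤ ‖λ η - θ‖` gives `2 λ ⟪θ, η⟫ ≤ ‖θ‖²` for all `λ > 0`
    rintro ⟨η, θ⟩ h
    by_contra hc
    simp only [not_le] at hc
    set a := ⟪θ, η⟫
    have hl : 0 < (‖θ‖ ^ 2 + 1) / a := by positivity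
    set lam := (‖θ‖ ^ 2 + 1) / a
    have h1 := norm_le_of_mem_histGen h hl
    rw [inv_mul_eq_div, le_div_iff₀ hl] at h1
    have h2 : (‖η‖ * lam) ^ 2 ≤ ‖lam • η - θ‖ ^ 2 := by gcongr
    rw [norm_sub_sq_real, norm_smul, Real.norm_of_nonneg hl.le, inner_smul_left,
      real_inner_comm] at h2
    have h3 : lam * a = ‖θ‖ ^ 2 + 1 := div_mul_cancel₀ _ hc.ne'
    simp only [conj_trivial] at h2
    nlinarith [sq_nonneg ‖θ‖]
  range lam hl f := ⟨_, expConv_mem_histGen f hl, by simp⟩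

end Generator

end ViscoMedium

/-! ### The Poincaré inequality -/

/-- The Cauchy-Schwarz inequality. -/
theorem abs_integral_mul_le_eLpNorm {α : Type*} {m : MeasurableSpace α} {μ : Measure α}
    {f g : α → ℝ} (hf : MemLp f 2 μ) (hg : MemLp g 2 μ) :
    |∫ x, f x * g x ∂μ| ≤ (eLpNorm f 2 μ).toReal * (eLpNorm g 2 μ).toReal := by
  have h := abs_real_inner_le_norm (hf.toLp f) (hg.toLp g)
  rw [L2.inner_def, Lp.norm_toLp, Lp.norm_toLp] at h
  refine le_trans (le_of_eq ?_) h
  congr 1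
  refine integral_congr_ae ?_
  filter_upwards [hf.coeFn_toLp, hg.coeFn_toLp] with x h1 h2
  rw [h1, h2]
  simp [mul_comm]

/-- If `P` is the weak derivative in the unit direction `e` of an `L²` function `W` vanishing
outside a ball, then translating a test function `φ` along `e` until it leaves the support of `W`
gives `|∫ W φ| ≤ T ‖P‖ ‖φ‖`. -/
theorem abs_integral_mul_test_le {n : ℕ} {W P : Eu n → ℝ} {R : ℝ}
    (hW : MemLp W 2 volume) (hP : MemLp P 2 volume) (hWR : ∀ x, R ≤ ‖x‖ → W x = 0)
    {e : Eu n} (he : ‖e‖ = 1)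
    (hWP : ∀ φ, IsTest univ φ → ∫ x, (W x * fderiv ℝ φ x e + φ x * P x) = 0)
    {φ : Eu n → ℝ} (hφ : IsTest univ φ) {T : ℝ} (hT : 0 ≤ T) (hφT : ∀ x, T - R ≤ ‖x‖ → φ x = 0) :
    |∫ x, W x * φ x| ≤ (eLpNorm φ 2 volume).toReal * (eLpNorm P 2 volume).toReal * T := by
  have hWi : Integrable W := by
    have h1 : IntegrableOn W (Metric.ball 0 R) := by
      have : IsFiniteMeasure (volume.restrict (Metric.ball (0 : Eu n) R)) :=
        ⟨by rw [Measure.restrict_apply_univ]; exact measure_ball_lt_top⟩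
      exact (hW.mono_measure Measure.restrict_le_self).integrable (by norm_num)
    exact (integrableOn_iff_integrable_of_support_subset fun x hx => by
      by_contra hc
      exact hx (hWR x (by simpa using hc))).1 h1
  have hc : Continuous fun x => fderiv ℝ φ x e :=
    (hφ.1.continuous_fderiv (by simp)).clm_apply continuous_const
  obtain ⟨C, hC⟩ :=
    hc.bounded_above_of_compact_support (HasCompactSupport.fderiv_apply ℝ hφ.2.1 e)
  obtain ⟨C', hC'⟩ := hφ.1.continuous.bounded_above_of_compact_support hφ.2.1
  have tr : ∀ r : ℝ, IsTest univ fun y => φ (y + r • e) := fun r =>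
    ⟨hφ.1.comp (contDiff_id.add contDiff_const),
      hφ.2.1.comp_homeomorph (Homeomorph.addRight (r • e)), subset_univ _⟩
  have dtr : ∀ (r : ℝ) y, fderiv ℝ (fun y => φ (y + r • e)) y = fderiv ℝ φ (y + r • e) :=
    fun r y => fderiv_comp_add_right _
  set F : ℝ → ℝ := fun r => ∫ y, W y * φ (y + r • e) with hF
  have hder : ∀ r, HasDerivAt F (-∫ y, φ (y + r • e) * P y) r := by
    intro r
    have key := (hasDerivAt_integral_of_dominated_loc_of_deriv_le (μ := volume)
      (F := fun r y => W y * φ (y + r • e))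
      (F' := fun r y => W y * fderiv ℝ φ (y + r • e) e)
      (bound := fun y => ‖W y‖ * C) (s := univ) (x₀ := r) univ_mem
      (Eventually.of_forall fun r => hWi.aestronglyMeasurable.mul
        (tr r).1.continuous.aestronglyMeasurable)
      (hWi.mul_bdd (tr r).1.continuous.aestronglyMeasurable (ae_of_all _ fun y => hC' _))
      (hWi.aestronglyMeasurable.mul
        (hc.comp (continuous_id.add continuous_const)).aestronglyMeasurable)
      (ae_of_all _ fun y r _ => by
        rw [norm_mul]; exact mul_le_mul_of_nonneg_left (hC _) (norm_nonneg _))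
      (hWi.norm.mul_const C)
      (ae_of_all _ fun y r _ => by
        have l : HasDerivAt (fun r : ℝ => y + r • e) e r := by
          simpa using ((hasDerivAt_id r).smul_const e).const_add y
        exact (((hφ.1.differentiable (by simp)) _).hasFDerivAt.comp_hasDerivAt r l).const_mul
          (W y))).2
    have z := hWP _ (tr r)
    simp only [dtr] at z
    rw [integral_add] at z
    · rwa [← eq_neg_of_add_eq_zero_left z]
    · exact hWi.mul_bdd
        (hc.comp (continuous_id.add (continuous_const (y := r • e)))).aestronglyMeasurable
        (ae_of_all _ fun y => hC _)
    · exact ((tr r).memLp volume).integrable_mul hP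
  have hbound : ∀ r : ℝ, ‖-∫ y, φ (y + r • e) * P y‖ ≤
      (eLpNorm φ 2 volume).toReal * (eLpNorm P 2 volume).toReal := by
    intro r
    rw [norm_neg, Real.norm_eq_abs]
    refine (abs_integral_mul_le_eLpNorm ((tr r).memLp volume) hP).trans (le_of_eq ?_)
    have := eLpNorm_comp_measurePreserving (p := 2) (hφ.1.continuous.aestronglyMeasurable)
      (measurePreserving_add_right (volume : Measure (Eu n)) (r • e))
    rw [← this]
    rfl
  have hmv := norm_image_sub_le_of_norm_deriv_le_segment' (f := F) (a := 0) (b := T)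
    (fun r _ => (hder r).hasDerivWithinAt) (fun r _ => hbound r) T (right_mem_Icc.2 hT)
  have hFT : F T = 0 := by
    refine integral_eq_zero_of_ae (ae_of_all _ fun y => ?_)
    by_cases hy : R ≤ ‖y‖
    · simp [hWR y hy]
    · have h1 : ‖T • e‖ = T := by rw [norm_smul, he, mul_one, Real.norm_of_nonneg hT]
      have h2 : ‖T • e‖ ≤ ‖y + T • e‖ + ‖y‖ := by
        have := norm_sub_le (y + T • e) y
        simpa using this
      simp [hφT (y + T • e) (by linarith)]
  rw [hFT, zero_sub, norm_neg, Real.norm_eq_abs, sub_zero] at hmv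
  simpa [hF] using hmv

/-- A one-directional Poincaré inequality. The cut-off test functions vanish outside the ball of
radius `R + 1`, so a translation by `2 R + 1` moves them off the ball of radius `R`. -/
theorem eLpNorm_le_of_weakDeriv {n : ℕ} {W P : Eu n → ℝ} {R : ℝ} (hR : 0 < R)
    (hW : MemLp W 2 volume) (hP : MemLp P 2 volume) (hWR : ∀ x, R ≤ ‖x‖ → W x = 0)
    {e : Eu n} (he : ‖e‖ = 1)
    (hWP : ∀ φ, IsTest univ φ → ∫ x, (W x * fderiv ℝ φ x e + φ x * P x) = 0) :
    (eLpNorm W 2 volume).toReal ≤ (eLpNorm P 2 volume).toReal * (2 * R + 1) := by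
  set w : ℝ := (eLpNorm W 2 volume).toReal
  set C : ℝ := (eLpNorm P 2 volume).toReal * (2 * R + 1)
  have hw0 : 0 ≤ w := ENNReal.toReal_nonneg
  have hC0 : 0 ≤ C := by positivity
  let χ : ContDiffBump (0 : Eu n) := ⟨R, R + 1, hR, by linarith⟩
  have hWW : ∫ x, W x * W x = w ^ 2 := by
    have := real_inner_self_eq_norm_sq (hW.toLp W)
    rw [L2.inner_def, Lp.norm_toLp] at this
    rw [← this]
    refine integral_congr_ae ?_
    filter_upwards [hW.coeFn_toLp] with x h1
    rw [h1]; simp [sq]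
  -- test with smooth approximations of `W`, cut off outside the ball
  have key : ∀ ε : ℝ, 0 < ε → w ^ 2 ≤ w * ε + C * (w + ε) := by
    intro ε hε
    obtain ⟨φ, hφs, hφc, hφ⟩ := hW.exist_eLpNorm_sub_le ENNReal.ofNat_ne_top (by norm_num) hε
    have tφ : IsTest univ φ := ⟨hφc, hφs, subset_univ _⟩
    have tψ : IsTest univ fun x => χ x * φ x :=
      ⟨χ.contDiff.mul hφc, hφs.mul_left, subset_univ _⟩
    have hφL := tφ.memLp (volume : Measure (Eu n))
    have hsub : MemLp (W - φ) 2 volume := hW.sub hφL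
    have h1 : ∫ x, W x * (χ x * φ x) = ∫ x, W x * φ x := by
      congr 1; ext x
      rcases le_or_gt R ‖x‖ with h | h
      · simp [hWR x h]
      · rw [χ.one_of_mem_closedBall (by simpa [χ] using h.le), one_mul]
    have h2 := abs_integral_mul_test_le hW hP hWR he hWP tψ (T := 2 * R + 1) (by positivity)
      (fun x hx => by
        rw [χ.zero_of_le_dist (by simpa [χ] using (by linarith : R + 1 ≤ ‖x‖)), zero_mul])
    rw [h1] at h2
    have h3 : (eLpNorm (W - φ) 2 volume).toReal ≤ ε :=
      ENNReal.toReal_le_of_le_ofReal hε.le hφ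
    have h4 : (eLpNorm φ 2 volume).toReal ≤ w + ε := by
      have h := norm_sub_le (hW.toLp W) (hsub.toLp (W - φ))
      rw [← MemLp.toLp_sub, Lp.norm_toLp, Lp.norm_toLp, Lp.norm_toLp, sub_sub_cancel] at h
      linarith
    have h5 : (eLpNorm (fun x => χ x * φ x) 2 volume).toReal ≤ (eLpNorm φ 2 volume).toReal := by
      refine ENNReal.toReal_mono hφL.2.ne (eLpNorm_mono fun x => ?_)
      rw [norm_mul, Real.norm_of_nonneg χ.nonneg]
      exact mul_le_of_le_one_left (norm_nonneg _) χ.le_one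
    have h6 := abs_integral_mul_le_eLpNorm hW hsub
    have h7 : ∫ x, W x * (W - φ) x = w ^ 2 - ∫ x, W x * φ x := by
      rw [← hWW]
      refine Eq.trans ?_ (integral_sub (hW.integrable_mul hW) (hW.integrable_mul hφL))
      congr 1; ext x; simp [mul_sub]
    rw [h7] at h6
    have h8 := le_of_abs_le h6
    have h9 := le_of_abs_le h2
    have h10 : w * (eLpNorm (W - φ) 2 volume).toReal ≤ w * ε := by gcongr
    have h11 : (eLpNorm (fun x => χ x * φ x) 2 volume).toReal * (eLpNorm P 2 volume).toReal *
        (2 * R + 1) ≤ C * (w + ε) := by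
      calc _ = C * (eLpNorm (fun x => χ x * φ x) 2 volume).toReal := by simp only [C]; ring
        _ ≤ C * (w + ε) := by gcongr; exact h5.trans h4
    linarith
  have hlim : w ^ 2 ≤ C * w := by
    refine le_of_forall_pos_le_add fun δ hδ => ?_
    have h := key (δ / (w + C + 1)) (by positivity)
    have h2 : (w + C) * (δ / (w + C + 1)) ≤ δ := by
      rw [mul_div_assoc', div_le_iff₀ (by positivity)]
      nlinarith
    nlinarith
  rcases hw0.eq_or_lt' with h | h
  · rw [h]; exact hC0
  · rw [sq] at hlim
    exact le_of_mul_le_mul_right hlim h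

namespace ViscoMedium

variable {n : ℕ} (S : ViscoMedium n)

theorem wt_le_smul {A : Set (Eu n)} {w w' : Eu n → ℝ} {c : ℝ} (hc : 0 ≤ c)
    (h : ∀ᵐ x ∂volume.restrict A, w x ≤ c * w' x) : wt A w ≤ ENNReal.ofReal c • wt A w' := by
  rw [wt, wt, ← withDensity_smul' _ _ ENNReal.ofReal_ne_top]
  refine withDensity_mono (h.mono fun x hx => ?_)
  rw [Pi.smul_apply, smul_eq_mul, ← ENNReal.ofReal_mul hc]
  exact ENNReal.ofReal_le_ofReal hx

theorem wt_le_smul_restrict {A : Set (Eu n)} {w : Eu n → ℝ} {c : ℝ}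
    (h : ∀ᵐ x ∂volume.restrict A, w x ≤ c) :
    wt A w ≤ ENNReal.ofReal c • (volume.restrict A : Measure (Eu n)) := by
  rw [wt, ← withDensity_const]
  exact withDensity_mono (h.mono fun x hx => ENNReal.ofReal_le_ofReal hx)

theorem wt_grad₁_ge : (volume.restrict S.Ω₁ : Measure (Eu n)) ≤
    (ENNReal.ofReal (S.k₁ * S.l))⁻¹ • wt S.Ω₁ fun x => S.k₁ * (1 - S.k₀ * S.b x) :=
  restrict_le_smul_wt (mul_pos S.k₁_pos S.l_pos) S.isOpen_Ω₁.measurableSet Subset.rfl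
    (S.l_le_coeff.mono fun _ hx => mul_le_mul_of_nonneg_left hx S.k₁_pos.le)

theorem wt_grad₂_ge : (volume.restrict S.Ω₂ : Measure (Eu n)) ≤
    (ENNReal.ofReal S.k₂)⁻¹ • wt S.Ω₂ fun _ => S.k₂ :=
  restrict_le_smul_wt S.k₂_pos S.isOpen_Ω₂.measurableSet Subset.rfl (ae_of_all _ fun _ => le_rfl)

/-- The inclusion of the weighted space of gradients on `Ω₁` into `L²(Ω₁)`. -/
def grad₁L : Lp (Eu n) 2 (wt S.Ω₁ fun x => S.k₁ * (1 - S.k₀ * S.b x)) →L[ℝ]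
    Lp (Eu n) 2 (volume.restrict S.Ω₁) :=
  Lp.LpToLpOfMeasureLeSMul (ENNReal.inv_ne_top.2
    (ENNReal.ofReal_pos.2 (mul_pos S.k₁_pos S.l_pos)).ne') S.wt_grad₁_ge

/-- The inclusion of the weighted space of gradients on `Ω₂` into `L²(Ω₂)`. -/
def grad₂L : Lp (Eu n) 2 (wt S.Ω₂ fun _ => S.k₂) →L[ℝ] Lp (Eu n) 2 (volume.restrict S.Ω₂) :=
  Lp.LpToLpOfMeasureLeSMul (ENNReal.inv_ne_top.2
    (ENNReal.ofReal_pos.2 S.k₂_pos).ne') S.wt_grad₂_ge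

theorem coeFn_grad₁L (p) : S.grad₁L p =ᵐ[volume.restrict S.Ω₁] p :=
  Lp.coeFn_LpToLpOfMeasureLeSMul _ _ _

theorem coeFn_grad₂L (p) : S.grad₂L p =ᵐ[volume.restrict S.Ω₂] p :=
  Lp.coeFn_LpToLpOfMeasureLeSMul _ _ _

theorem disjoint_Ω₁_Ω₂ : Disjoint S.Ω₁ S.Ω₂ :=
  Set.disjoint_left.2 fun _ hx h => hx.2 (subset_closure h)

theorem eLpNorm_indicator_inner_le {O : Set (Eu n)} (hO : MeasurableSet O) (p : Eu n → Eu n)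
    {e : Eu n} (he : ‖e‖ = 1) : eLpNorm (O.indicator fun x => ⟪p x, e⟫) 2 volume ≤
      eLpNorm p 2 (volume.restrict O) := by
  rw [eLpNorm_indicator_eq_eLpNorm_restrict hO]
  exact eLpNorm_mono fun x => by simpa [he] using norm_inner_le_norm (𝕜 := ℝ) (p x) e

/-- The extension by zero of a pair `(u, v)` with `u = 0` on `∂Ω` and `u = v` on `∂Ω₂` is in
`H¹(ℝⁿ)`, so the inequality on the whole space applies. -/
theorem exists_poincare_pair : ∃ C : ℝ, 0 ≤ C ∧ ∀ (u v : Eu n → ℝ) (p q : Eu n → Eu n),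
    MemLp u 2 (volume.restrict S.Ω₁) → MemLp v 2 (volume.restrict S.Ω₂) →
    MemLp p 2 (volume.restrict S.Ω₁) → MemLp q 2 (volume.restrict S.Ω₂) →
    S.ZeroTrace u p → S.TraceEq u v p q → ∃ W : Eu n → ℝ, EqOn W u S.Ω₁ ∧ EqOn W v S.Ω₂ ∧
      MemLp W 2 volume ∧ (eLpNorm W 2 volume).toReal ≤
        C * ((eLpNorm p 2 (volume.restrict S.Ω₁)).toReal +
          (eLpNorm q 2 (volume.restrict S.Ω₂)).toReal) := by
  obtain ⟨R, hR0, hR⟩ : ∃ R : ℝ, 0 < R ∧ ∀ x ∈ S.Ω, ‖x‖ < R := by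
    obtain ⟨R, hR⟩ := S.isBounded_Ω.subset_ball (0 : Eu n)
    exact ⟨max R 1, by positivity, fun x hx => lt_max_of_lt_left (by simpa using hR hx)⟩
  set e : Eu n := EuclideanSpace.single ⟨0, S.dim_pos⟩ 1
  have he : ‖e‖ = 1 := by rw [PiLp.norm_single, norm_one]
  have m1 := S.isOpen_Ω₁.measurableSet
  have m2 := S.isOpen_Ω₂.measurableSet
  refine ⟨2 * R + 1, by positivity, fun u v p q hu hv hpL hqL hz ht => ?_⟩
  set W : Eu n → ℝ := fun x => S.Ω₁.indicator u x + S.Ω₂.indicator v x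
  set Pe : Eu n → ℝ := fun x => S.Ω₁.indicator (fun x => ⟪p x, e⟫) x +
    S.Ω₂.indicator (fun x => ⟪q x, e⟫) x
  have hP1 : MemLp (S.Ω₁.indicator fun x => ⟪p x, e⟫) 2 volume :=
    (memLp_indicator_iff_restrict m1).2 (memLp_inner hpL e)
  have hP2 : MemLp (S.Ω₂.indicator fun x => ⟪q x, e⟫) 2 volume :=
    (memLp_indicator_iff_restrict m2).2 (memLp_inner hqL e)
  have hW : MemLp W 2 volume := ((memLp_indicator_iff_restrict m1).2 hu).add
    ((memLp_indicator_iff_restrict m2).2 hv)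
  have hP : MemLp Pe 2 volume := hP1.add hP2
  have hWR : ∀ x, R ≤ ‖x‖ → W x = 0 := by
    intro x hx
    have hxΩ : x ∉ S.Ω := fun h => absurd (hR x h) (not_lt.2 hx)
    have a1 : x ∉ S.Ω₁ := fun h => hxΩ h.1
    have a2 : x ∉ S.Ω₂ := fun h => hxΩ (S.closure_Ω₂ (subset_closure h))
    simp [W, a1, a2]
  have hWP : ∀ φ, IsTest univ φ → ∫ x, (W x * fderiv ℝ φ x e + φ x * Pe x) = 0 := by
    intro φ hφ
    rw [← S.pair_univ hu hpL hz ht hφ e]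
    unfold green
    rw [← integral_indicator m1, ← integral_indicator m2, ← integral_add]
    · congr 1; ext x
      by_cases h1 : x ∈ S.Ω₁ <;> by_cases h2 : x ∈ S.Ω₂ <;> simp [W, Pe, h1, h2]
      ring
    · exact ((integrable_test_left hu hφ e).add
        (integrable_test_right hpL hφ e)).integrable_indicator m1
    · exact ((integrable_test_left hv hφ e).add
        (integrable_test_right hqL hφ e)).integrable_indicator m2
  refine ⟨W, fun x hx => ?_, fun x hx => ?_, hW, ?_⟩
  · simp [W, hx, Set.disjoint_left.1 S.disjoint_Ω₁_Ω₂ hx]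
  · simp [W, hx, Set.disjoint_right.1 S.disjoint_Ω₁_Ω₂ hx]
  · rw [mul_comm]
    refine (eLpNorm_le_of_weakDeriv hR0 hW hP hWR he hWP).trans ?_
    gcongr
    rw [← ENNReal.toReal_add hpL.2.ne hqL.2.ne]
    exact ENNReal.toReal_mono (ENNReal.add_ne_top.2 ⟨hpL.2.ne, hqL.2.ne⟩)
      ((eLpNorm_add_le hP1.1 hP2.1 (by norm_num)).trans (add_le_add
        (eLpNorm_indicator_inner_le m1 p he) (eLpNorm_indicator_inner_le m2 q he)))

theorem exists_poincare : ∃ C : ℝ, 0 ≤ C ∧ ∀ h : S.H, ‖h.u‖ ≤ C * ‖h‖ ∧ ‖h.v‖ ≤ C * ‖h‖ := by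
  obtain ⟨C, hC, H⟩ := S.exists_poincare_pair
  refine ⟨C * (‖S.grad₁L‖ + ‖S.grad₂L‖), by positivity, fun h => ?_⟩
  obtain ⟨W, hW1, hW2, hW, hle⟩ := H h.u h.v h.gradu h.gradv (Lp.memLp _) (Lp.memLp _)
    (S.memLp_grad₁ (Lp.memLp _)) (S.memLp_grad₂ (Lp.memLp _)) h.2.2.2.1 h.2.2.2.2
  have e1 : (eLpNorm h.gradu 2 (volume.restrict S.Ω₁)).toReal ≤ ‖S.grad₁L‖ * ‖h‖ := by
    rw [← eLpNorm_congr_ae (S.coeFn_grad₁L h.gradu), ← Lp.norm_def]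
    exact (S.grad₁L.le_opNorm _).trans
      (mul_le_mul_of_nonneg_left (WithLp.norm_fst_le _ (S.gradMap h)) (norm_nonneg _))
  have e2 : (eLpNorm h.gradv 2 (volume.restrict S.Ω₂)).toReal ≤ ‖S.grad₂L‖ * ‖h‖ := by
    rw [← eLpNorm_congr_ae (S.coeFn_grad₂L h.gradv), ← Lp.norm_def]
    exact (S.grad₂L.le_opNorm _).trans
      (mul_le_mul_of_nonneg_left (WithLp.norm_snd_le _ (S.gradMap h)) (norm_nonneg _))
  have hfin : (eLpNorm W 2 volume).toReal ≤ C * (‖S.grad₁L‖ + ‖S.grad₂L‖) * ‖h‖ := by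
    refine hle.trans ?_
    rw [mul_assoc, add_mul]
    gcongr
  constructor
  · refine le_trans ?_ hfin
    rw [Lp.norm_def]
    refine ENNReal.toReal_mono hW.2.ne ?_
    rw [← eLpNorm_congr_ae (ae_restrict_of_forall_mem S.isOpen_Ω₁.measurableSet hW1)]
    exact eLpNorm_mono_measure _ Measure.restrict_le_self
  · refine le_trans ?_ hfin
    rw [Lp.norm_def]
    refine ENNReal.toReal_mono hW.2.ne ?_
    rw [← eLpNorm_congr_ae (ae_restrict_of_forall_mem S.isOpen_Ω₂.measurableSet hW2)]
    exact eLpNorm_mono_measure _ Measure.restrict_le_self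

end ViscoMedium

/-! ### Completeness of the energy spaces -/

/-- Pairing with a fixed `L²` function is continuous on `L²`. -/
theorem continuous_integral_inner {α F : Type*} {m : MeasurableSpace α} {μ : Measure α}
    [NormedAddCommGroup F] [InnerProductSpace ℝ F] {ψ : α → F} (hψ : MemLp ψ 2 μ) :
    Continuous fun f : Lp F 2 μ => ∫ x, ⟪f x, ψ x⟫ ∂μ := by
  have : (fun f : Lp F 2 μ => ∫ x, ⟪f x, ψ x⟫ ∂μ) = fun f => ⟪f, hψ.toLp ψ⟫ := by
    ext f
    rw [L2.inner_def]
    refine integral_congr_ae ?_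
    filter_upwards [hψ.coeFn_toLp] with x hx
    rw [hx]
  rw [this]
  fun_prop

theorem IsTest.memLp_smul {n : ℕ} {O : Set (Eu n)} {φ : Eu n → ℝ} (hφ : IsTest O φ) (e : Eu n)
    (μ : Measure (Eu n)) [IsFiniteMeasureOnCompacts μ] : MemLp (fun x => φ x • e) 2 μ :=
  (hφ.1.continuous.smul continuous_const).memLp_of_hasCompactSupport hφ.2.1.smul_right

theorem continuous_green {n : ℕ} {X : Type*} [TopologicalSpace X] {O O' : Set (Eu n)}
    {φ : Eu n → ℝ} (hφ : IsTest O' φ) (e : Eu n) {U : X → Lp ℝ 2 (volume.restrict O)}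
    {P : X → Lp (Eu n) 2 (volume.restrict O)} (hU : Continuous U) (hP : Continuous P) :
    Continuous fun x => green O (U x) (P x) φ e := by
  have h1 := (continuous_integral_inner (hφ.fderiv_memLp e (volume.restrict O))).comp hU
  have h2 := (continuous_integral_inner (IsTest.memLp_smul hφ e (volume.restrict O))).comp hP
  refine (h1.add h2).congr fun x => ?_
  unfold green
  rw [integral_add (integrable_test_left (Lp.memLp _) hφ e)
    (integrable_test_right (Lp.memLp _) hφ e)]
  refine congrArg₂ (fun a b : ℝ => a + b) (integral_congr_ae (ae_of_all _ fun y => ?_))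
    (integral_congr_ae (ae_of_all _ fun y => ?_))
  · simp [mul_comm]
  · simp [inner_smul_right]

namespace ViscoMedium

variable {n : ℕ} (S : ViscoMedium n)

theorem continuous_green₁ {O : Set (Eu n)} {φ : Eu n → ℝ} (hφ : IsTest O φ) (e : Eu n) :
    Continuous fun h : S.PreH => green S.Ω₁ h.1.1 h.2.fst φ e := by
  have h1 : Continuous fun h : S.PreH => h.1.1 := by fun_prop
  have h2 : Continuous fun h : S.PreH => S.grad₁L h.2.fst := by fun_prop
  refine (continuous_green hφ e h1 h2).congr fun h => ?_
  exact green_congr (EventuallyEq.refl _ _) (S.coeFn_grad₁L _)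

theorem continuous_green₂ {O : Set (Eu n)} {φ : Eu n → ℝ} (hφ : IsTest O φ) (e : Eu n) :
    Continuous fun h : S.PreH => green S.Ω₂ h.1.2 h.2.snd φ e := by
  have h1 : Continuous fun h : S.PreH => h.1.2 := by fun_prop
  have h2 : Continuous fun h : S.PreH => S.grad₂L h.2.snd := by fun_prop
  refine (continuous_green hφ e h1 h2).congr fun h => ?_
  exact green_congr (EventuallyEq.refl _ _) (S.coeFn_grad₂L _)

theorem isClosed_HSub : IsClosed (S.HSub : Set S.PreH) := by
  have : (S.HSub : Set S.PreH) =
      {h | ∀ φ, IsTest S.Ω₁ φ → ∀ e, green S.Ω₁ h.1.1 h.2.fst φ e = 0} ∩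
      ({h | ∀ φ, IsTest S.Ω₂ φ → ∀ e, green S.Ω₂ h.1.2 h.2.snd φ e = 0} ∩
      ({h | ∀ φ, IsTest (closure S.Ω₂)ᶜ φ → ∀ e, green S.Ω₁ h.1.1 h.2.fst φ e = 0} ∩
      {h | ∀ φ, IsTest S.Ω φ → ∀ e,
        green S.Ω₁ h.1.1 h.2.fst φ e + green S.Ω₂ h.1.2 h.2.snd φ e = 0})) := rfl
  rw [this]
  simp only [ofPred_forall]
  refine IsClosed.inter ?_ (IsClosed.inter ?_ (IsClosed.inter ?_ ?_)) <;>
  refine isClosed_iInter fun φ => isClosed_iInter fun hφ => isClosed_iInter fun e => ?_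
  · exact isClosed_eq (S.continuous_green₁ hφ e) continuous_const
  · exact isClosed_eq (S.continuous_green₂ hφ e) continuous_const
  · exact isClosed_eq (S.continuous_green₁ hφ e) continuous_const
  · exact isClosed_eq ((S.continuous_green₁ hφ e).add (S.continuous_green₂ hφ e)) continuous_const

instance : InnerProductSpace ℝ S.H :=
  { (inferInstance : NormedSpace ℝ S.H) with
    inner := fun x y => ⟪S.gradMap x, S.gradMap y⟫
    norm_sq_eq_re_inner := fun x => (real_inner_self_eq_norm_sq (S.gradMap x)).symm
    conj_inner_symm := fun x y => real_inner_comm (S.gradMap x) (S.gradMap y)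
    add_left := fun x y z => by simp only [map_add, inner_add_left]
    smul_left := fun x y r => by simp only [map_smul, inner_smul_left] }

theorem inner_H_eq (h h' : S.H) : ⟪h, h'⟫ = ⟪h.gradu, h'.gradu⟫ + ⟪h.gradv, h'.gradv⟫ :=
  WithLp.prod_inner_apply _ _

/-- The embedding `(u, v) ↦ (u, v)` of `ℍ¹_{∂Ω}` into `𝕃²`. -/
def toL2 : S.H →L[ℝ] S.L2 :=
  LinearMap.mkContinuousOfExistsBound
    ({ toFun := fun h => WithLp.toLp 2 (h.u, h.v)
       map_add' := fun _ _ => rfl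
       map_smul' := fun _ _ => rfl } : S.H →ₗ[ℝ] S.L2) (by
    obtain ⟨C, hC, h⟩ := S.exists_poincare
    refine ⟨2 * C, fun x => ?_⟩
    have h1 := (h x).1
    have h2 := (h x).2
    have h3 : ‖WithLp.toLp 2 (x.u, x.v)‖ ^ 2 = ‖x.u‖ ^ 2 + ‖x.v‖ ^ 2 :=
      WithLp.prod_norm_sq_eq_of_L2 _
    have h4 : 0 ≤ C * ‖x‖ := by positivity
    refine abs_le_of_sq_le_sq' ?_ (by positivity) |>.2
    refine h3.trans_le ?_
    nlinarith [norm_nonneg x.u, norm_nonneg x.v])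

/-- `(u, v) ↦ (∇u, ∇v)` as an isometry. -/
def gradIso : S.H →ₗᵢ[ℝ] WithLp 2 (Lp (Eu n) 2 (wt S.Ω₁ fun x => S.k₁ * (1 - S.k₀ * S.b x)) ×
    Lp (Eu n) 2 (wt S.Ω₂ fun _ => S.k₂)) :=
  ⟨S.gradMap, fun _ => rfl⟩

/-- The norm only contains the gradients; by the Poincaré inequality the functions converge too. -/
instance : CompleteSpace S.H := by
  refine Metric.complete_of_cauchySeq_tendsto fun h hh => ?_
  obtain ⟨z, hz⟩ := cauchySeq_tendsto_of_complete
    (S.gradIso.isometry.uniformContinuous.comp_cauchySeq hh)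
  obtain ⟨y, hy⟩ := cauchySeq_tendsto_of_complete
    (S.toL2.uniformContinuous.comp_cauchySeq hh)
  have hy1 : Tendsto (fun k => (h k).u) atTop (𝓝 y.fst) :=
    ((WithLp.fstL 2 ℝ _ _).continuous.tendsto y).comp hy
  have hy2 : Tendsto (fun k => (h k).v) atTop (𝓝 y.snd) :=
    ((WithLp.sndL 2 ℝ _ _).continuous.tendsto y).comp hy
  have hlim : Tendsto (fun k => ((h k).1 : S.PreH)) atTop (𝓝 ((y.fst, y.snd), z)) :=
    (hy1.prodMk_nhds hy2).prodMk_nhds hz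
  have hmem := S.isClosed_HSub.mem_of_tendsto hlim (Eventually.of_forall fun k => (h k).2)
  obtain ⟨x, hx⟩ : ∃ x : S.H, S.gradIso x = z := ⟨(⟨((y.fst, y.snd), z), hmem⟩ : S.HSub), rfl⟩
  refine ⟨x, ?_⟩
  rw [S.gradIso.isometry.isEmbedding.tendsto_nhds_iff, hx]
  exact hz

theorem posSet_subset : S.posSet ⊆ S.Ω₁ := fun _ hx => hx.1

/-- On the support of a test function in `{b > 0}` the weight `b` is bounded below, so the two
integrals defining the weak gradient depend continuously on `(w, ∇w)`. -/
theorem continuous_green_posSet {φ : Eu n → ℝ} (hφ : IsTest S.posSet φ) (e : Eu n) :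
    Continuous fun z : S.PreV => green S.posSet z.fst z.snd φ e := by
  set K := tsupport φ
  have hK : IsCompact K := hφ.2.1.isCompact
  obtain ⟨c, hc, hle⟩ := S.exists_pos_le hK hφ.2.2
  have hKΩ : K ⊆ S.Ω₁ := hφ.2.2.trans S.posSet_subset
  let A : Lp (Eu n) 2 (wt S.Ω₁ fun x => S.k₁ * S.b x) →L[ℝ] Lp (Eu n) 2 (volume.restrict K) :=
    Lp.LpToLpOfMeasureLeSMul (ENNReal.inv_ne_top.2 (ENNReal.ofReal_pos.2 hc).ne')
      (restrict_le_smul_wt hc hK.measurableSet hKΩ hle)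
  let B : Lp ℝ 2 (wt S.Ω₁ fun _ => S.k₁) →L[ℝ] Lp ℝ 2 (volume.restrict K) :=
    Lp.LpToLpOfMeasureLeSMul (ENNReal.inv_ne_top.2 (ENNReal.ofReal_pos.2 S.k₁_pos).ne')
      (restrict_le_smul_wt S.k₁_pos hK.measurableSet hKΩ (ae_of_all _ fun _ => le_rfl))
  have hA : ∀ p, A p =ᵐ[volume.restrict K] p := fun p => Lp.coeFn_LpToLpOfMeasureLeSMul _ _ _
  have hB : ∀ p, B p =ᵐ[volume.restrict K] p := fun p => Lp.coeFn_LpToLpOfMeasureLeSMul _ _ _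
  have h1 : Continuous fun z : S.PreV => B z.fst := by fun_prop
  have h2 : Continuous fun z : S.PreV => A z.snd := by fun_prop
  refine (continuous_green hφ e h1 h2).congr fun z => ?_
  rw [green_congr (hB _) (hA _)]
  unfold green
  refine (setIntegral_eq_of_subset_of_forall_sdiff_eq_zero S.isOpen_posSet.measurableSet hφ.2.2
    fun x hx => ?_).symm
  have h0 : φ x = 0 := image_eq_zero_of_notMem_tsupport hx.2
  have h0' : fderiv ℝ φ x = 0 := fderiv_of_notMem_tsupport ℝ hx.2
  simp [h0, h0']

theorem isClosed_V : IsClosed (S.V : Set S.PreV) := by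
  have : (S.weightedSub : Set S.PreV) =
      {z | ∀ φ, IsTest S.posSet φ → ∀ e, green S.posSet z.fst z.snd φ e = 0} := rfl
  have h1 : IsClosed (S.weightedSub : Set S.PreV) := by
    rw [this]
    simp only [ofPred_forall]
    exact isClosed_iInter fun φ => isClosed_iInter fun hφ => isClosed_iInter fun e =>
      isClosed_eq (S.continuous_green_posSet hφ e) continuous_const
  exact h1.inter (Submodule.isClosed_topologicalClosure _)

instance : CompleteSpace S.V := S.isClosed_V.completeSpace_coe

/-! ### The embedding of `ℍ¹_{∂Ω}` into `V` -/

/-- `L²(Ω₁) ⊆ L²(Ω₁; k₁ dx)`. -/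
def toK₁L : Lp ℝ 2 (volume.restrict S.Ω₁) →L[ℝ] Lp ℝ 2 (wt S.Ω₁ fun _ => S.k₁) :=
  Lp.LpToLpOfMeasureLeSMul ENNReal.ofReal_ne_top
    (wt_le_smul_restrict (ae_of_all _ fun _ => le_rfl))

theorem coeFn_toK₁L (p) : S.toK₁L p =ᵐ[wt S.Ω₁ fun _ => S.k₁] p :=
  Lp.coeFn_LpToLpOfMeasureLeSMul _ _ _

/-- `b` is bounded, and `1 - k₀ b` is bounded below by `l > 0`. -/
theorem exists_wt_b_le : ∃ C : ℝ≥0∞, C ≠ ⊤ ∧ wt S.Ω₁ (fun x => S.k₁ * S.b x) ≤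
    C • wt S.Ω₁ fun x => S.k₁ * (1 - S.k₀ * S.b x) := by
  obtain ⟨C, hC⟩ := S.exists_b_bound
  have hl : 0 < S.l := S.l_pos
  refine ⟨ENNReal.ofReal (|C| / S.l), ENNReal.ofReal_ne_top, wt_le_smul (by positivity) ?_⟩
  filter_upwards [S.l_le_coeff, ae_restrict_mem S.isOpen_Ω₁.measurableSet] with x hx hxm
  have h1 : S.b x ≤ |C| := (le_abs_self _).trans ((hC x hxm).trans (le_abs_self _))
  have h2 : |C| ≤ |C| / S.l * (1 - S.k₀ * S.b x) := by
    rw [div_mul_eq_mul_div, le_div_iff₀ hl]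
    gcongr
  calc S.k₁ * S.b x ≤ S.k₁ * (|C| / S.l * (1 - S.k₀ * S.b x)) := by
        have := S.k₁_pos.le
        gcongr
        exact h1.trans h2
    _ = _ := by ring

/-- The inclusion of the weighted space of gradients on `Ω₁` into `L²(Ω₁; k₁ b dx)`. -/
def gradBL : Lp (Eu n) 2 (wt S.Ω₁ fun x => S.k₁ * (1 - S.k₀ * S.b x)) →L[ℝ]
    Lp (Eu n) 2 (wt S.Ω₁ fun x => S.k₁ * S.b x) :=
  Lp.LpToLpOfMeasureLeSMul S.exists_wt_b_le.choose_spec.1 S.exists_wt_b_le.choose_spec.2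

theorem coeFn_gradBL (p) : S.gradBL p =ᵐ[wt S.Ω₁ fun x => S.k₁ * S.b x] p :=
  Lp.coeFn_LpToLpOfMeasureLeSMul S.exists_wt_b_le.choose_spec.1 S.exists_wt_b_le.choose_spec.2 p

/-- `(u, v) ↦ (u, ∇u)`, with values in the ambient space of `V`. -/
def toPreV : S.H →L[ℝ] S.PreV :=
  (WithLp.prodContinuousLinearEquiv 2 ℝ _ _).symm.toContinuousLinearMap ∘L
    ((S.toK₁L ∘L WithLp.fstL 2 ℝ _ _ ∘L S.toL2).prod
      (S.gradBL ∘L WithLp.fstL 2 ℝ _ _ ∘L S.gradIso.toContinuousLinearMap))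

theorem toPreV_mem (h : S.H) : S.toPreV h ∈ S.V := by
  obtain ⟨hg, -, hz, -⟩ := h.2
  have e1 : (S.toPreV h).fst =ᵐ[wt S.Ω₁ fun _ => S.k₁] h.u := S.coeFn_toK₁L _
  have e2 : (S.toPreV h).snd =ᵐ[wt S.Ω₁ fun x => S.k₁ * S.b x] h.gradu := S.coeFn_gradBL _
  refine ⟨fun φ hφ e => ?_, subset_closure ⟨h.u, h.gradu, Lp.memLp _,
    S.memLp_grad₁ (Lp.memLp _), hg, hz, e1, e2⟩⟩
  rw [← hg φ (hφ.mono S.posSet_subset) e, green_congr (ae_restrict_of_ae_restrict_of_subset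
    S.posSet_subset (S.ae_k₁ e1)) (S.ae_posSet e2)]
  unfold green
  refine (setIntegral_eq_of_subset_of_forall_sdiff_eq_zero S.isOpen_Ω₁.measurableSet
    S.posSet_subset fun x hx => ?_).symm
  have hx' : x ∉ tsupport φ := fun hc => hx.2 (hφ.2.2 hc)
  have h0 : φ x = 0 := image_eq_zero_of_notMem_tsupport hx'
  have h0' : fderiv ℝ φ x = 0 := fderiv_of_notMem_tsupport ℝ hx'
  simp [h0, h0']

/-- The embedding `(u, v) ↦ u` of `ℍ¹_{∂Ω}` into `V`. -/
def toV : S.H →L[ℝ] S.V := S.toPreV.codRestrict S.V S.toPreV_mem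

/-- `w ↦ w`, from `V` to `L²(Ω₁; k₁ dx)`. -/
def fstV : S.V →L[ℝ] Lp ℝ 2 (wt S.Ω₁ fun _ => S.k₁) := WithLp.fstL 2 ℝ _ _ ∘L S.V.subtypeL

/-- `w ↦ ∇w`, from `V` to `L²(Ω₁; k₁ b dx)`. -/
def sndV : S.V →L[ℝ] Lp (Eu n) 2 (wt S.Ω₁ fun x => S.k₁ * S.b x) :=
  WithLp.sndL 2 ℝ _ _ ∘L S.V.subtypeL

theorem inner_V_eq (z z' : S.V) : ⟪z, z'⟫ = ⟪S.fstV z, S.fstV z'⟫ + ⟪S.sndV z, S.sndV z'⟫ :=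
  WithLp.prod_inner_apply _ _

/-- `(u, v) ↦ u`, as histories constant in `s`. -/
def histConst : S.H →L[ℝ] S.Lg := Lp.constL 2 S.gMeas ℝ ∘L S.toV

/-- The memory form `k₁ ∫₀^∞ g(s) ∫_{Ω₁} b ∇η(s)·∇u dx ds`. -/
def memForm : S.Lg →L[ℝ] S.H →L[ℝ] ℝ :=
  (innerBilin (Lp (Lp (Eu n) 2 (wt S.Ω₁ fun x => S.k₁ * S.b x)) 2 S.gMeas)).bilinearComp
    (S.sndV.compLpL 2 S.gMeas) (Lp.constL 2 S.gMeas ℝ ∘L S.sndV ∘L S.toV)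

theorem inner_const_eq {F : Type*} [NormedAddCommGroup F] [InnerProductSpace ℝ F]
    (A : S.V →L[ℝ] F) (η : S.Lg) (z : F) :
    ⟪A.compLpL 2 S.gMeas η, Lp.constL 2 S.gMeas ℝ z⟫ = ∫ s, ⟪A (η s), z⟫ ∂S.gMeas := by
  rw [L2.inner_def]
  refine integral_congr_ae ?_
  filter_upwards [A.coeFn_compLpL η, Lp.coeFn_const 2 S.gMeas z] with s h1 h2
  rw [h1, Lp.constL_apply]
  rw [h2]; rfl

theorem integrable_inner_const {F : Type*} [NormedAddCommGroup F] [InnerProductSpace ℝ F]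
    (A : S.V →L[ℝ] F) (η : S.Lg) (z : F) : Integrable (fun s => ⟪A (η s), z⟫) S.gMeas :=
  (((A.comp_memLp' (Lp.memLp η)).integrable (by norm_num))).inner_const z

theorem memForm_apply (η : S.Lg) (h : S.H) :
    S.memForm η h = ∫ s, ⟪S.sndV (η s), S.sndV (S.toV h)⟫ ∂S.gMeas :=
  S.inner_const_eq S.sndV η _

theorem inner_histConst (η : S.Lg) (h : S.H) :
    ⟪η, S.histConst h⟫ = ∫ s, ⟪η s, S.toV h⟫ ∂S.gMeas := by
  have e : S.histConst h = Lp.const 2 S.gMeas (S.toV h) := rfl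
  rw [e, L2.inner_def]
  refine integral_congr_ae ?_
  filter_upwards [Lp.coeFn_const 2 S.gMeas (S.toV h)] with s h2
  rw [h2]; rfl

/-- `(u, v) ↦ u`, as functions in `L²(Ω₁; k₁ dx)` constant in `s`. -/
def constU : S.L2 →L[ℝ] Lp (Lp ℝ 2 (wt S.Ω₁ fun _ => S.k₁)) 2 S.gMeas :=
  Lp.constL 2 S.gMeas ℝ ∘L S.toK₁L ∘L
    WithLp.fstL 2 ℝ (Lp ℝ 2 (volume.restrict S.Ω₁)) (Lp ℝ 2 (volume.restrict S.Ω₂))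

theorem inner_histConst_sub_memForm (η : S.Lg) (h : S.H) :
    ⟪η, S.histConst h⟫ - S.memForm η h =
      ⟪S.fstV.compLpL 2 S.gMeas η, S.constU (S.toL2 h)⟫ := by
  have e1 : ⟪S.fstV.compLpL 2 S.gMeas η, S.constU (S.toL2 h)⟫ =
      ∫ s, ⟪S.fstV (η s), S.fstV (S.toV h)⟫ ∂S.gMeas :=
    S.inner_const_eq S.fstV η (S.fstV (S.toV h))
  rw [e1, inner_histConst, memForm_apply, sub_eq_iff_eq_add,
    ← integral_add (S.integrable_inner_const S.fstV η _) (S.integrable_inner_const S.sndV η _)]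
  exact integral_congr_ae (ae_of_all _ fun s => S.inner_V_eq _ _)

/-- The inner product with a constant history differs from the memory form by a term of order
zero. -/
theorem exists_memForm_bound : ∃ c : ℝ, 0 ≤ c ∧ ∀ η h,
    |⟪η, S.histConst h⟫ - S.memForm η h| ≤ c * ‖η‖ * ‖S.toL2 h‖ := by
  refine ⟨‖S.fstV.compLpL 2 S.gMeas‖ * ‖S.constU‖, by positivity, fun η h => ?_⟩
  rw [inner_histConst_sub_memForm]
  refine (abs_real_inner_le_norm _ _).trans ?_
  have h1 := (S.fstV.compLpL 2 S.gMeas).le_opNorm η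
  have h2 := S.constU.le_opNorm (S.toL2 h)
  calc _ ≤ (‖S.fstV.compLpL 2 S.gMeas‖ * ‖η‖) * (‖S.constU‖ * ‖S.toL2 h‖) :=
        mul_le_mul h1 h2 (norm_nonneg _) (by positivity)
    _ = _ := by ring

end ViscoMedium

/-! ### Test functions as elements of `ℍ¹_{∂Ω}` -/

section TestFunctions

variable {n : ℕ} {O O' : Set (Eu n)} {φ ψ : Eu n → ℝ}

theorem ae_eq_zero_of_integral_test {F : Type*} [NormedAddCommGroup F] [NormedSpace ℝ F]
    [CompleteSpace F] {f : Eu n → F} (hO : IsOpen O) (hf : MemLp f 2 (volume.restrict O))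
    (h : ∀ φ, IsTest O φ → ∫ x in O, φ x • f x = 0) : f =ᵐ[volume.restrict O] 0 := by
  refine (ae_restrict_iff' hO.measurableSet).2 (hO.ae_eq_zero_of_integral_contDiff_smul_eq_zero
    (locallyIntegrableOn_of_locallyIntegrable_restrict (hf.locallyIntegrable (by norm_num)))
    fun φ h1 h2 h3 => ?_)
  rw [← h φ ⟨h1, h2, h3⟩]
  refine (setIntegral_eq_integral_of_forall_compl_eq_zero fun x hx => ?_).symm
  rw [image_eq_zero_of_notMem_tsupport fun hc => hx (h3 hc), zero_smul]

theorem HasWeakGrad.ae_eq_zero {u : Eu n → ℝ} {p : Eu n → Eu n} (hO : IsOpen O)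
    (h : HasWeakGrad O u p) (hp : MemLp p 2 (volume.restrict O))
    (hu : u =ᵐ[volume.restrict O] 0) : p =ᵐ[volume.restrict O] 0 := by
  refine ae_eq_zero_of_integral_test hO hp fun φ hφ => ?_
  have hi : Integrable (fun x => φ x • p x) (volume.restrict O) :=
    memLp_one_iff_integrable.1 (hp.smul (hφ.memLp _))
  refine ext_inner_left ℝ fun e => ?_
  rw [inner_zero_right, ← integral_inner hi, ← h φ hφ e]
  refine integral_congr_ae ?_
  filter_upwards [hu] with x hx
  simp [hx, inner_smul_right, real_inner_comm]

theorem inner_gradient (φ : Eu n → ℝ) (x e : Eu n) :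
    ⟪gradient φ x, e⟫ = fderiv ℝ φ x e := by
  simp [gradient]

theorem IsTest.memLp_gradient (hφ : IsTest O φ) (μ : Measure (Eu n))
    [IsFiniteMeasureOnCompacts μ] : MemLp (gradient φ) 2 μ := by
  have hc : Continuous (gradient φ) :=
    (InnerProductSpace.toDual ℝ (Eu n)).symm.continuous.comp (hφ.1.continuous_fderiv (by simp))
  exact hc.memLp_of_hasCompactSupport (hφ.2.1.fderiv ℝ |>.comp_left (map_zero _))

theorem green_test (hφ : IsTest O φ) (hψ : IsTest O' ψ) (e : Eu n) :
    green O φ (gradient φ) ψ e = 0 := by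
  have h1 : Integrable fun x => φ x * fderiv ℝ ψ x e :=
    (hφ.memLp volume).integrable_mul (hψ.fderiv_memLp e volume)
  have h2 : Integrable fun x => fderiv ℝ φ x e * ψ x :=
    (hφ.fderiv_memLp e volume).integrable_mul (hψ.memLp volume)
  have h3 : Integrable fun x => φ x * ψ x := (hφ.memLp volume).integrable_mul (hψ.memLp volume)
  have key := integral_mul_fderiv_eq_neg_fderiv_mul_of_integrable h2 h1 h3
    (fun x _ => (hφ.1.differentiable (by simp)) x) (fun x _ => (hψ.1.differentiable (by simp)) x)
  unfold green
  rw [setIntegral_eq_integral_of_forall_compl_eq_zero fun x hx => ?_]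
  · simp only [inner_gradient]
    rw [integral_add h1 (by simpa only [mul_comm] using h2), key]
    simp [mul_comm]
  · have hx' : x ∉ tsupport φ := fun hc => hx (hφ.2.2 hc)
    rw [inner_gradient, image_eq_zero_of_notMem_tsupport hx',
      fderiv_of_notMem_tsupport ℝ hx']
    simp

end TestFunctions

namespace ViscoMedium

variable {n : ℕ} (S : ViscoMedium n)

/-- A pair with weak gradients whose boundary integrals all vanish, on `∂Ω` as well as on both
sides of `∂Ω₂`, belongs to `ℍ¹_{∂Ω}`. -/
theorem exists_H_of_green {u v : Eu n → ℝ} {p q : Eu n → Eu n}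
    (hu : MemLp u 2 (volume.restrict S.Ω₁)) (hv : MemLp v 2 (volume.restrict S.Ω₂))
    (hp : MemLp p 2 (volume.restrict S.Ω₁)) (hq : MemLp q 2 (volume.restrict S.Ω₂))
    (h₁ : ∀ O φ, IsTest O φ → ∀ e, green S.Ω₁ u p φ e = 0)
    (h₂ : ∀ O φ, IsTest O φ → ∀ e, green S.Ω₂ v q φ e = 0) :
    ∃ h : S.H, h.u =ᵐ[volume.restrict S.Ω₁] u ∧ h.v =ᵐ[volume.restrict S.Ω₂] v ∧
      h.gradu =ᵐ[volume.restrict S.Ω₁] p ∧ h.gradv =ᵐ[volume.restrict S.Ω₂] q := by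
  have hp' : MemLp p 2 (wt S.Ω₁ fun x => S.k₁ * (1 - S.k₀ * S.b x)) :=
    hp.of_measure_le_smul ENNReal.ofReal_ne_top (wt_le_smul_restrict (c := S.k₁)
      ((ae_restrict_iff' S.isOpen_Ω₁.measurableSet).2 (ae_of_all _ fun x hx => by
        have := mul_nonneg S.k₁_pos.le (mul_nonneg S.k₀_nonneg (S.b_nonneg x hx))
        linarith)))
  have hq' : MemLp q 2 (wt S.Ω₂ fun _ => S.k₂) :=
    hq.of_measure_le_smul ENNReal.ofReal_ne_top
      (wt_le_smul_restrict (c := S.k₂) (ae_of_all _ fun _ => le_rfl))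
  have e3 := S.ae_grad₁ hp'.coeFn_toLp
  have e4 := S.ae_grad₂ hq'.coeFn_toLp
  have g₁ : ∀ O φ, IsTest O φ → ∀ e, green S.Ω₁ (hu.toLp u) (hp'.toLp p) φ e = 0 :=
    fun O φ hφ e => (green_congr hu.coeFn_toLp e3).trans (h₁ O φ hφ e)
  have g₂ : ∀ O φ, IsTest O φ → ∀ e, green S.Ω₂ (hv.toLp v) (hq'.toLp q) φ e = 0 :=
    fun O φ hφ e => (green_congr hv.coeFn_toLp e4).trans (h₂ O φ hφ e)
  exact ⟨(⟨((hu.toLp u, hv.toLp v), WithLp.toLp 2 (hp'.toLp p, hq'.toLp q)),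
    fun φ hφ e => g₁ _ φ hφ e, fun φ hφ e => g₂ _ φ hφ e, fun φ hφ e => g₁ _ φ hφ e,
    fun φ hφ e => by
      show green S.Ω₁ (hu.toLp u) (hp'.toLp p) φ e + green S.Ω₂ (hv.toLp v) (hq'.toLp q) φ e = 0
      rw [g₁ _ φ hφ e, g₂ _ φ hφ e, add_zero]⟩ : S.HSub),
    hu.coeFn_toLp, hv.coeFn_toLp, e3, e4⟩

theorem exists_H_test₁ {φ : Eu n → ℝ} (hφ : IsTest S.Ω₁ φ) :
    ∃ h : S.H, h.u =ᵐ[volume.restrict S.Ω₁] φ ∧ h.v =ᵐ[volume.restrict S.Ω₂] 0 ∧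
      h.gradu =ᵐ[volume.restrict S.Ω₁] gradient φ ∧ h.gradv =ᵐ[volume.restrict S.Ω₂] 0 :=
  S.exists_H_of_green (hφ.memLp _) MemLp.zero (hφ.memLp_gradient _) MemLp.zero
    (fun _ _ hψ e => green_test hφ hψ e) (fun _ _ _ e => green_zero e)

theorem exists_H_test₂ {φ : Eu n → ℝ} (hφ : IsTest S.Ω₂ φ) :
    ∃ h : S.H, h.u =ᵐ[volume.restrict S.Ω₁] 0 ∧ h.v =ᵐ[volume.restrict S.Ω₂] φ ∧
      h.gradu =ᵐ[volume.restrict S.Ω₁] 0 ∧ h.gradv =ᵐ[volume.restrict S.Ω₂] gradient φ :=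
  S.exists_H_of_green MemLp.zero (hφ.memLp _) MemLp.zero (hφ.memLp_gradient _)
    (fun _ _ _ e => green_zero e) (fun _ _ hψ e => green_test hφ hψ e)

theorem inner_toL2 (x : S.L2) (h : S.H) :
    ⟪x, S.toL2 h⟫ = (∫ y in S.Ω₁, x.fst y * h.u y) + ∫ y in S.Ω₂, x.snd y * h.v y := by
  rw [WithLp.prod_inner_apply, L2.inner_def, L2.inner_def]
  refine congrArg₂ (fun a b : ℝ => a + b) (integral_congr_ae (ae_of_all _ fun y => ?_))
    (integral_congr_ae (ae_of_all _ fun y => ?_))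
  · exact mul_comm _ _
  · exact mul_comm _ _

/-- `ℍ¹_{∂Ω}` contains `C_c^∞(Ω₁) × C_c^∞(Ω₂)`, so it is dense in `𝕃²`. -/
theorem eq_zero_of_inner_toL2 (x : S.L2) (hx : ∀ h, ⟪x, S.toL2 h⟫ = 0) : x = 0 := by
  have h1 : x.fst = 0 := by
    refine (Lp.eq_zero_iff_ae_eq_zero).2 (ae_eq_zero_of_integral_test S.isOpen_Ω₁ (Lp.memLp _)
      fun φ hφ => ?_)
    obtain ⟨h, e1, e2, -, -⟩ := S.exists_H_test₁ hφ
    have := hx h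
    rw [inner_toL2, integral_eq_zero_of_ae (μ := volume.restrict S.Ω₂), add_zero] at this
    · rw [← this]
      refine integral_congr_ae ?_
      filter_upwards [e1] with y hy
      rw [hy, smul_eq_mul, mul_comm]
    · filter_upwards [e2] with y hy
      simp [hy]
  have h2 : x.snd = 0 := by
    refine (Lp.eq_zero_iff_ae_eq_zero).2 (ae_eq_zero_of_integral_test S.isOpen_Ω₂ (Lp.memLp _)
      fun φ hφ => ?_)
    obtain ⟨h, e1, e2, -, -⟩ := S.exists_H_test₂ hφ
    have := hx h
    rw [inner_toL2, integral_eq_zero_of_ae (μ := volume.restrict S.Ω₁), zero_add] at this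
    · rw [← this]
      refine integral_congr_ae ?_
      filter_upwards [e2] with y hy
      rw [hy, smul_eq_mul, mul_comm]
    · filter_upwards [e1] with y hy
      simp [hy]
  have e : x = WithLp.toLp 2 (x.fst, x.snd) := rfl
  rw [e, h1, h2]
  rfl

theorem wt_absolutelyContinuous (A : Set (Eu n)) (w : Eu n → ℝ) :
    wt A w ≪ volume.restrict A := withDensity_absolutelyContinuous _ _

/-- If `u` and `v` vanish, so do their weak gradients, which determine the norm of `ℍ¹_{∂Ω}`. -/
theorem toL2_injective : Function.Injective S.toL2 := by
  refine (injective_iff_map_eq_zero _).2 fun h h0 => S.zero_of_grad_zero h ?_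
  have hu : h.u = 0 := congrArg WithLp.fst h0
  have hv : h.v = 0 := congrArg WithLp.snd h0
  have e1 : h.gradu = 0 := (Lp.eq_zero_iff_ae_eq_zero).2
    ((wt_absolutelyContinuous _ _).ae_le (HasWeakGrad.ae_eq_zero S.isOpen_Ω₁ h.2.1
      (S.memLp_grad₁ (Lp.memLp _)) ((Lp.eq_zero_iff_ae_eq_zero).1 hu)))
  have e2 : h.gradv = 0 := (Lp.eq_zero_iff_ae_eq_zero).2
    ((wt_absolutelyContinuous _ _).ae_le (HasWeakGrad.ae_eq_zero S.isOpen_Ω₂ h.2.2.1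
      (S.memLp_grad₂ (Lp.memLp _)) ((Lp.eq_zero_iff_ae_eq_zero).1 hv)))
  have e : h.1.2 = WithLp.toLp 2 (h.gradu, h.gradv) := rfl
  rw [e, e1, e2]
  rfl

end ViscoMedium

/-! ### The generator as an abstract system with memory -/

section Weighted

variable {n : ℕ}

theorem integral_wt {A : Set (Eu n)} {w : Eu n → ℝ} (hw : AEMeasurable w (volume.restrict A))
    (h0 : ∀ᵐ x ∂volume.restrict A, 0 ≤ w x) (f : Eu n → ℝ) :
    ∫ x, f x ∂wt A w = ∫ x in A, w x * f x := by
  rw [wt, integral_withDensity_eq_integral_toReal_smul₀ hw.ennreal_ofReal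
    (ae_of_all _ fun _ => ENNReal.ofReal_lt_top)]
  refine integral_congr_ae ?_
  filter_upwards [h0] with x hx
  rw [ENNReal.toReal_ofReal hx, smul_eq_mul]

theorem inner_Lp_wt {F : Type*} [NormedAddCommGroup F] [InnerProductSpace ℝ F] {A : Set (Eu n)}
    {w : Eu n → ℝ} (hw : AEMeasurable w (volume.restrict A))
    (h0 : ∀ᵐ x ∂volume.restrict A, 0 ≤ w x) (p q : Lp F 2 (wt A w)) :
    ⟪p, q⟫ = ∫ x in A, w x * ⟪p x, q x⟫ := by
  rw [L2.inner_def, integral_wt hw h0]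

end Weighted

namespace ViscoMedium

variable {n : ℕ} (S : ViscoMedium n)

theorem aemeasurable_b : AEMeasurable S.b (volume.restrict S.Ω₁) :=
  S.b_smooth.continuousOn.aemeasurable S.isOpen_Ω₁.measurableSet

theorem integral_gMeas (f : ℝ → ℝ) : ∫ s, f s ∂S.gMeas = ∫ s in Ioi (0 : ℝ), S.g s * f s := by
  rw [gMeas, integral_withDensity_eq_integral_toReal_smul₀ S.aemeasurable_g
    (ae_of_all _ fun _ => ENNReal.ofReal_lt_top)]
  refine setIntegral_congr_fun measurableSet_Ioi fun s hs => ?_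
  simp only [ENNReal.toReal_ofReal (S.g_pos s (Ioi_subset_Ici_self hs)).le, smul_eq_mul]

theorem memForm_eq_integral (η : S.Lg) (h : S.H) : S.memForm η h =
    S.k₁ * ∫ s in Ioi (0 : ℝ), S.g s * ∫ x in S.Ω₁, S.b x * ⟪(η s).1.snd x, h.gradu x⟫ := by
  rw [memForm_apply, integral_gMeas, ← integral_const_mul]
  refine integral_congr_ae (ae_of_all _ fun s => ?_)
  have e : ⟪S.sndV (η s), S.sndV (S.toV h)⟫ =
      ∫ x, ⟪(η s).1.snd x, h.gradu x⟫ ∂wt S.Ω₁ fun x => S.k₁ * S.b x := by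
    rw [L2.inner_def]
    refine integral_congr_ae ?_
    filter_upwards [S.coeFn_gradBL h.gradu] with x hx
    exact congrArg _ hx
  simp only [e]
  rw [integral_wt (S.aemeasurable_b.const_mul _) ((ae_restrict_iff' S.isOpen_Ω₁.measurableSet).2
    (ae_of_all _ fun x hx => mul_nonneg S.k₁_pos.le (S.b_nonneg x hx)))]
  simp only [mul_assoc]
  rw [integral_const_mul]
  ring

variable {S}

theorem k₁_mul_stress (h k : S.H) (η : S.Lg) :
    S.k₁ * stress h.gradu η k.gradu = ⟪h.gradu, k.gradu⟫ + S.memForm η k := by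
  rw [stress, mul_add, memForm_eq_integral, inner_Lp_wt ((S.aemeasurable_b.const_mul _).const_sub 1
    |>.const_mul _) (S.l_le_coeff.mono fun x hx => mul_nonneg S.k₁_pos.le
      ((show 0 < S.l from S.l_pos).le.trans hx)), ← integral_const_mul]
  simp only [mul_assoc]

theorem k₂_mul_integral (h k : S.H) :
    S.k₂ * ∫ x in S.Ω₂, ⟪h.gradv x, k.gradv x⟫ = ⟪h.gradv, k.gradv⟫ := by
  rw [inner_Lp_wt aemeasurable_const (ae_of_all _ fun _ => S.k₂_pos.le), integral_const_mul]

theorem stress_congr {p q q' : Eu n → Eu n} (η : S.Lg) (hq : q =ᵐ[volume.restrict S.Ω₁] q') :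
    stress p η q = stress p η q' := by
  unfold stress
  congr 1
  · exact integral_congr_ae (hq.mono fun x hx => by simp only [hx])
  · refine integral_congr_ae (ae_of_all _ fun s => ?_)
    exact congrArg _ (integral_congr_ae (hq.mono fun x hx => by simp only [hx]))

theorem stress_zero (p : Eu n → Eu n) (η : S.Lg) : stress p η 0 = 0 := by
  simp [stress]

/-- By Green's formula the two momentum equations and the transmission condition are together one
variational identity over `ℍ¹_{∂Ω}`. -/
theorem transmission_iff (U W : S.X) :
    ((∀ φ, IsTest S.Ω₁ φ →
      ∫ x in S.Ω₁, W.snd.fst.fst x * φ x = -(S.k₁ * stress U.fst.gradu U.snd.snd (gradient φ))) ∧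
    (∀ φ, IsTest S.Ω₂ φ → ∫ x in S.Ω₂, W.snd.fst.snd x * φ x =
      -(S.k₂ * ∫ x in S.Ω₂, ⟪U.fst.gradv x, gradient φ x⟫)) ∧
    ∀ h : S.H, (∫ x in S.Ω₂, W.snd.fst.snd x * h.v x) +
        S.k₂ * (∫ x in S.Ω₂, ⟪U.fst.gradv x, h.gradv x⟫) =
      -((∫ x in S.Ω₁, W.snd.fst.fst x * h.u x) + S.k₁ * stress U.fst.gradu U.snd.snd h.gradu)) ↔
    ∀ h : S.H, ⟪W.snd.fst, S.toL2 h⟫ + ⟪U.fst, h⟫ + S.memForm U.snd.snd h = 0 := by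
  have key : (∀ h : S.H, ⟪W.snd.fst, S.toL2 h⟫ + ⟪U.fst, h⟫ + S.memForm U.snd.snd h = 0) ↔
      ∀ h : S.H, (∫ x in S.Ω₂, W.snd.fst.snd x * h.v x) +
        S.k₂ * (∫ x in S.Ω₂, ⟪U.fst.gradv x, h.gradv x⟫) =
      -((∫ x in S.Ω₁, W.snd.fst.fst x * h.u x) +
        S.k₁ * stress U.fst.gradu U.snd.snd h.gradu) := by
    refine forall_congr' fun h => ?_
    rw [inner_toL2, inner_H_eq, k₁_mul_stress, k₂_mul_integral]
    constructor <;> intro hh <;> linarith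
  rw [key]
  refine ⟨fun h => h.2.2, fun H => ⟨fun φ hφ => ?_, fun φ hφ => ?_, H⟩⟩
  · obtain ⟨h, e1, e2, e3, e4⟩ := S.exists_H_test₁ hφ
    have := H h
    rw [stress_congr _ e3, integral_eq_zero_of_ae (e2.mono fun x hx => by simp [hx]),
      integral_eq_zero_of_ae (e4.mono fun x hx => by simp [hx]),
      integral_congr_ae (g := fun x => W.snd.fst.fst x * φ x)
        (e1.mono fun x hx => by simp only [hx])] at this
    linarith
  · obtain ⟨h, e1, e2, e3, e4⟩ := S.exists_H_test₂ hφ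
    have := H h
    rw [stress_congr _ e3, stress_zero,
      integral_eq_zero_of_ae (f := fun x => W.snd.fst.fst x * h.u x)
        (e1.mono fun x hx => by simp [hx]),
      integral_congr_ae (f := fun x => W.snd.fst.snd x * h.v x)
        (g := fun x => W.snd.fst.snd x * φ x) (e2.mono fun x hx => by simp only [hx]),
      integral_congr_ae (f := fun x => ⟪U.fst.gradv x, h.gradv x⟫)
        (g := fun x => ⟪U.fst.gradv x, gradient φ x⟫)
        (e4.mono fun x hx => by simp only [hx])] at this
    linarith

theorem mem_histGen_neg {η ζ : S.Lg} : (η, -ζ) ∈ histGen S S.V ↔ IsHistDeriv η ζ := by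
  rw [mem_histGen]
  have e : ∀ᵐ s ∂volume.restrict (Ioi (0 : ℝ)),
      -∫ r in (0 : ℝ)..s, (-ζ : S.Lg) r = ∫ r in (0 : ℝ)..s, ζ r := by
    filter_upwards [ae_restrict_mem measurableSet_Ioi] with s hs
    rw [intervalIntegral_congr_gMeas (Lp.coeFn_neg ζ) (le_of_lt hs)]
    simp
  constructor <;> intro h <;> filter_upwards [h, e] with s h1 h2
  · rw [h1, h2]
  · rw [h1, h2]

/-- The element `z` of `V` that represents `u₂` is the image of `(u₂, v₂)` under `ℍ¹_{∂Ω} → V`, so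
the history equation `θ = u₂ - η_s` reads `θ - Q h = -η_s`. -/
theorem history_iff {η θ θ' : S.Lg} {h : S.H} (hθ : ∀ᵐ s ∂S.gMeas, θ' s = θ s - S.toV h) :
    (∃ ζ : S.Lg, IsHistDeriv η ζ ∧ ∃ z : S.V, z.1.fst =ᵐ[volume.restrict S.Ω₁] h.u ∧
      (z.1.snd : Eu n → Eu n) =ᵐ[wt S.Ω₁ fun x => S.k₁ * S.b x] h.gradu ∧
      ∀ᵐ s ∂volume.restrict (Ioi (0 : ℝ)), θ s = z - ζ s) ↔ (η, θ') ∈ histGen S S.V := by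
  constructor
  · rintro ⟨ζ, h1, z, h2, h3, h4⟩
    have hz : z = S.toV h := by
      refine Subtype.ext (WithLp.ofLp_injective 2 (Prod.ext (Lp.ext ?_) (Lp.ext ?_)))
      · exact EventuallyEq.trans ((wt_absolutelyContinuous _ _).ae_le h2) (S.coeFn_toK₁L h.u).symm
      · exact h3.trans (S.coeFn_gradBL h.gradu).symm
    have e : θ' = -ζ := by
      refine Lp.ext ?_
      filter_upwards [hθ, Lp.coeFn_neg ζ, S.ae_gMeas_iff.2 h4] with s a b c
      rw [a, b, Pi.neg_apply, c, hz]
      abel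
    rw [e]
    exact mem_histGen_neg.2 h1
  · intro hm
    rw [← neg_neg θ'] at hm
    refine ⟨-θ', mem_histGen_neg.1 hm, S.toV h, S.ae_k₁ (S.coeFn_toK₁L h.u),
      S.coeFn_gradBL _, ?_⟩
    filter_upwards [S.ae_gMeas_iff.1 (Lp.coeFn_neg θ'), S.ae_gMeas_iff.1 hθ] with s a b
    rw [a, Pi.neg_apply, b]
    abel

theorem sub_histConst_ae (θ : S.Lg) (h : S.H) :
    ∀ᵐ s ∂S.gMeas, (θ - S.histConst h : S.Lg) s = θ s - S.toV h := by
  filter_upwards [Lp.coeFn_sub θ (S.histConst h), Lp.coeFn_const 2 S.gMeas (S.toV h)] with s a b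
  rw [a]
  exact congrArg (fun v : S.V => θ s - v) b

variable (S) in
/-- The graph of `𝒜` as a system with memory over `ℍ¹_{∂Ω} ⊆ 𝕃²`. -/
def genGraph : Submodule ℝ (S.X × S.X) :=
  memorySystem S.toL2 S.histConst S.memForm (histGen S S.V)

theorem mem_genGraph (U W : S.X) : (U, W) ∈ S.genGraph ↔ IsGen U W := by
  have hv : S.toL2 W.fst = U.snd.fst ↔ W.fst.u = U.snd.fst.fst ∧ W.fst.v = U.snd.fst.snd :=
    ⟨fun h => ⟨congrArg WithLp.fst h, congrArg WithLp.snd h⟩,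
      fun h => WithLp.ofLp_injective 2 (Prod.ext h.1 h.2)⟩
  rw [genGraph, mem_memorySystem, hv, ← transmission_iff U W]
  constructor
  · rintro ⟨⟨h1, h2⟩, ⟨h3, h4, h5⟩, h6⟩
    exact ⟨h1, h2, h3, h4, h5, h1 ▸ (history_iff (sub_histConst_ae _ _)).2 h6⟩
  · rintro ⟨h1, h2, h3, h4, h5, h6⟩
    exact ⟨⟨h1, h2⟩, ⟨h3, h4, h5⟩, (history_iff (sub_histConst_ae _ _)).1 (h1 ▸ h6)⟩

variable (S) in
theorem exists_quasiMaxDissipative_genGraph : ∃ κ, QuasiMaxDissipative S.genGraph κ := by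
  obtain ⟨c, hc, h⟩ := S.exists_memForm_bound
  exact ⟨_, quasiMaxDissipative_memorySystem maxDissipative_histGen S.toL2_injective
    S.eq_zero_of_inner_toL2 hc h⟩

theorem isMildSolution_iff (U₀ : S.X) (U : ℝ → S.X) :
    IsMildSolution U₀ U ↔ IsMildSol S.genGraph U₀ U :=
  ⟨fun h => ⟨h.continuousOn, h.initial, fun t ht => (mem_genGraph _ _).2 (h.integral_eq t ht)⟩,
    fun h => ⟨h.continuousOn, h.initial, fun t ht => (mem_genGraph _ _).1 (h.integral_mem t ht)⟩⟩

end ViscoMedium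

end

theorem mainTheorem2 {n : ℕ} (S : ViscoMedium n) (U₀ : S.X) :
    (∃ U : ℝ → S.X, ViscoMedium.IsMildSolution U₀ U ∧
      ∀ U' : ℝ → S.X, ViscoMedium.IsMildSolution U₀ U' → EqOn U' U (Ici 0)) ∧
    (U₀ ∈ S.domA → ∀ U : ℝ → S.X, ViscoMedium.IsMildSolution U₀ U →
      ViscoMedium.IsRegularSolution U) := by
  obtain ⟨κ, hA⟩ := S.exists_quasiMaxDissipative_genGraph
  simp only [ViscoMedium.isMildSolution_iff]
  refine ⟨?_, ?_⟩
  · obtain ⟨U, hU⟩ := hA.exists_isMildSol U₀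
    exact ⟨U, hU, fun U' hU' => hA.eqOn_of_isMildSol hU hU'⟩
  · rintro ⟨W, hW⟩ U hU
    obtain ⟨v, v', h0, hc, hd, hm⟩ := hA.exists_regular ((ViscoMedium.mem_genGraph _ _).2 hW)
    have hv := hA.isMildSol_of_regular hc hd hm
    rw [h0] at hv
    have hUv : EqOn U v (Ici 0) := hA.eqOn_of_isMildSol hv hU
    refine ⟨v', hU.continuousOn, hc, fun t ht => (hd t ht).congr hUv (hUv ht), fun t ht => ?_⟩
    rw [hUv ht]
    exact (ViscoMedium.mem_genGraph _ _).1 (hm t ht)
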